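/- Let $a_0,a_1,a_2,a_3,b_1,b_2,b_3\in\mathbb R$ with $a_1^2+b_1^2\neq0$, let $f(x,y)=2x^2-y^2$ and $g=f+x\,\partial_yf-y\,\partial_xf$, and consider on $\mathbb R^3$ the piecewise smooth vector field $X_\varepsilon$ equal to $$X^+_\varepsilon=\big(-y+\varepsilon(a_0+a_1z)+\varepsilon^2(a_2+a_3z),\ x,\ -z+g(x,y)\big)\quad\text{for } y>0,$$ $$X^-_\varepsilon=\big(-y,\ x+\varepsilon b_1z+\varepsilon^2(b_2+b_3z),\ -z+g(x,y)\big)\quad\text{for } y<0.$$ Solutions meet $\{y=0\}$ only at crossing points (where the second components of $X_\varepsilon^{+}$ and $X_\varepsilon^{-}$ are nonzero of the same sign), and there they are concatenations of trajectories of $X_\varepsilon^{\pm}$. A limit cycle is a nonconstant periodic solution, with its minimal period, such that some neighbourhood of its orbit contains no other periodic orbit. Put $$\Delta=4(1+e^{\pi})(15a_1b_1-b_1^2-14a_1^2)-5\pi(1-e^{\pi})(b_1^2+10a_1^2),$$ $$A_0=\frac{-80\,b_2(1-e^{\pi})}{\Delta},\qquad A_1=\frac{40\,a_0\big((1+e^{\pi})(b_1-a_1)-a_1\pi(1-e^{\pi})\big)}{\Delta},\qquad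 D=-4A_1^3-27A_0^2 .$$ Second order bifurcation function: in cylindrical coordinates $x=r\cos\theta$, $y=r\sin\theta$, write the system as $\frac{d\rho}{d\theta}=F_0(\theta,\rho)+\varepsilon F_1(\theta,\rho)+\varepsilon^2F_2(\theta,\rho)+O(\varepsilon^3)$ with $\rho=(r,z)$, where $X^+_\varepsilon$ is used for $0\le\theta\le\pi$ and $X^-_\varepsilon$ for $\pi<\theta\le2\pi$. Let $x(\theta,\rho)$ be the solution of the system with $\varepsilon=0$ and $x(0,\rho)=\rho$, let $Y=\partial x/\partial\rho$, and $$y_1(\theta)=Y(\theta)\int_0^\theta Y^{-1}F_1\,ds,\qquad y_2(\theta)=2Y(\theta)\int_0^\theta Y^{-1}\big(F_2+\partial_\rho F_1\,y_1+\tfrac12\partial_\rho^2F_0(y_1,y_1)\big)ds$$ (integrands evaluated along $x(s,\rho)$), $g_1(\rho)=Y(2\pi,\rho)^{-1}y_1(2\pi,\rho)$, $g_2(\rho)=\frac12Y(2\pi,\rho)^{-1}y_2(2\pi,\rho)$. Let $\pi,\pi^\perp$ also denote the projections onto the $r$- and $z$-coordinate, let $z_r=f(r,0)$, let $\delta_r$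 be the lower right entry of $\mathrm{Id}-Y(2\pi,(r,z_r))^{-1}$, and $\gamma_1(r)=-\delta_r^{-1}\,\pi^\perp g_1(r,z_r)$. Then $$f_2(r)=\frac{\partial\,\pi g_1}{\partial z}(r,z_r)\,\gamma_1(r)+\pi g_2(r,z_r).$$ Then $\Delta\ne0$, and for all $r>0$ $$f_2(r)=-\frac{\Delta}{40(e^{\pi}-1)}\,\big(A_0+A_1r+r^3\big).$$ Moreover, for all sufficiently small $|\varepsilon|\ne0$: (i) If $D>0$, then $X_\varepsilon$ has at least one limit cycle. If in addition $A_1<0$ and $A_0>0$, it has at least two limit cycles, with disjoint orbits, associated (as below) with two distinct radii. (ii) If $D\le0$ and $A_0<0$, then $X_\varepsilon$ has at least one limit cycle. Each of these limit cycles $\varphi(\cdot,\varepsilon)$ is associated with a radius $r^*>0$, independent of $\varepsilon$, with $A_0+A_1r^*+(r^*)^3=0$. Its period satisfies $T_\varepsilon=2\pi+O(\varepsilon)$, and $$\varphi(t,\varepsilon)=\big(x^*,y^*,f(x^*,y^*)\big)+O(\varepsilon),\qquad (x^*,y^*)=(r^*\cos t,\,r^*\sin t),$$ uniformly for $t\in[0,T_\varepsilon]$.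 -/

import Mathlib

open Set Filter Topology

noncomputable section

namespace PiecewiseField

/-- The real coefficients of the perturbation. -/
structure Params where
  a0 : ℝ
  a1 : ℝ
  a2 : ℝ
  a3 : ℝ
  b1 : ℝ
  b2 : ℝ
  b3 : ℝ

/-- `g = f + x ∂f/∂y - y ∂f/∂x`. -/
def companion (f : ℝ → ℝ → ℝ) (x y : ℝ) : ℝ :=
  f x y + x * deriv (fun v => f x v) y - y * deriv (fun u => f u y) x

/-- The vector field that acts in the half-space `y > 0`. -/
def fieldPlus (p : Params) (f : ℝ → ℝ → ℝ) (ε : ℝ) : ℝ × ℝ × ℝ → ℝ × ℝ × ℝ :=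
  fun (x, y, z) =>
    (-y + ε * (p.a0 + p.a1 * z) + ε ^ 2 * (p.a2 + p.a3 * z), x, -z + companion f x y)

/-- The vector field that acts in the half-space `y < 0`. -/
def fieldMinus (p : Params) (f : ℝ → ℝ → ℝ) (ε : ℝ) : ℝ × ℝ × ℝ → ℝ × ℝ × ℝ :=
  fun (x, y, z) =>
    (-y, x + ε * (p.b1 * z) + ε ^ 2 * (p.b2 + p.b3 * z), -z + companion f x y)

/-- `φ` is a (global) crossing solution of the piecewise smooth field equal to `Xp` for `y > 0` and
to `Xm` for `y < 0`: off the switching plane `y = 0` it is an ordinary solution, and it meets the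
plane only at crossing points (the normal components of `Xp` and `Xm` have the same strict sign),
where it is the concatenation of a trajectory of the field of the side it leaves and a trajectory
of the field of the side it enters. -/
def IsCrossingSolution (Xp Xm : ℝ × ℝ × ℝ → ℝ × ℝ × ℝ) (φ : ℝ → ℝ × ℝ × ℝ) : Prop :=
  ∀ t : ℝ,
    (0 < (φ t).2.1 → HasDerivAt φ (Xp (φ t)) t) ∧
    ((φ t).2.1 < 0 → HasDerivAt φ (Xm (φ t)) t) ∧
    ((φ t).2.1 = 0 →
      (0 < (Xp (φ t)).2.1 ∧ 0 < (Xm (φ t)).2.1 ∧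
        HasDerivWithinAt φ (Xm (φ t)) (Iic t) t ∧ HasDerivWithinAt φ (Xp (φ t)) (Ici t) t) ∨
      ((Xp (φ t)).2.1 < 0 ∧ (Xm (φ t)).2.1 < 0 ∧
        HasDerivWithinAt φ (Xp (φ t)) (Iic t) t ∧ HasDerivWithinAt φ (Xm (φ t)) (Ici t) t))

/-- `φ` is a nonconstant periodic crossing solution with minimal period `T`. -/
def IsPeriodicSolution (Xp Xm : ℝ × ℝ × ℝ → ℝ × ℝ × ℝ) (φ : ℝ → ℝ × ℝ × ℝ) (T : ℝ) : Prop :=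
  IsCrossingSolution Xp Xm φ ∧ 0 < T ∧ Function.Periodic φ T ∧
    ∀ S : ℝ, 0 < S → S < T → ¬ Function.Periodic φ S

/-- `φ` is a limit cycle of period `T`: an isolated periodic solution, that is, some neighbourhood
of its orbit contains no other periodic orbit. -/
def IsLimitCycle (Xp Xm : ℝ × ℝ × ℝ → ℝ × ℝ × ℝ) (φ : ℝ → ℝ × ℝ × ℝ) (T : ℝ) : Prop :=
  IsPeriodicSolution Xp Xm φ T ∧
    ∃ U : Set (ℝ × ℝ × ℝ), IsOpen U ∧ range φ ⊆ U ∧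
      ∀ (ψ : ℝ → ℝ × ℝ × ℝ) (S : ℝ),
        IsPeriodicSolution Xp Xm ψ S → range ψ ⊆ U → range ψ = range φ

/-- For all sufficiently small `ε ≠ 0`, `φ ε` is a limit cycle of period `T ε = 2π + O(ε)` that is
`O(ε)`-close, uniformly over one period, to the unperturbed periodic solution
`(x, y, f(x, y))`, `(x, y) = (r cos t, r sin t)`, on the circle of radius `r`. -/
def IsLimitCycleFamily (p : Params) (f : ℝ → ℝ → ℝ) (r : ℝ)
    (φ : ℝ → ℝ → ℝ × ℝ × ℝ) (T : ℝ → ℝ) : Prop :=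
  ∃ C : ℝ, ∀ᶠ ε in 𝓝[≠] (0 : ℝ),
    IsLimitCycle (fieldPlus p f ε) (fieldMinus p f ε) (φ ε) (T ε) ∧
    |T ε - 2 * Real.pi| ≤ C * |ε| ∧
    ∀ t ∈ Icc 0 (T ε),
      ‖φ ε t - (r * Real.cos t, r * Real.sin t, f (r * Real.cos t) (r * Real.sin t))‖ ≤ C * |ε|

/-! Second order averaging in cylindrical coordinates `x = r cos θ`, `y = r sin θ`, with `θ` as the
independent variable; points are pairs `ρ = (r, z)`. -/

/-- `(dr/dθ, dz/dθ)`, where `r' = X₁ cos θ + X₂ sin θ`, `θ' = (X₂ cos θ - X₁ sin θ) / r`,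
`z' = X₃`, for `θ ∈ [0, 2π]`. -/
def cylindricalField (p : Params) (f : ℝ → ℝ → ℝ) (θ : ℝ) (ρ : ℝ × ℝ) (ε : ℝ) : ℝ × ℝ :=
  let q : ℝ × ℝ × ℝ := (ρ.1 * Real.cos θ, ρ.1 * Real.sin θ, ρ.2)
  let X : ℝ × ℝ × ℝ := if θ ≤ Real.pi then fieldPlus p f ε q else fieldMinus p f ε q
  let θdot : ℝ := (X.2.1 * Real.cos θ - X.1 * Real.sin θ) / ρ.1
  ((X.1 * Real.cos θ + X.2.1 * Real.sin θ) / θdot, X.2.2 / θdot)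

/-- The coefficient `F_i(θ, ρ)` of `ε ^ i` in the cylindrical field. -/
def fieldCoeff (p : Params) (f : ℝ → ℝ → ℝ) (i : ℕ) (θ : ℝ) (ρ : ℝ × ℝ) : ℝ × ℝ :=
  ((Nat.factorial i : ℝ))⁻¹ • iteratedDeriv i (cylindricalField p f θ ρ) 0

/-- The solution at `θ` of the unperturbed system `r' = 0`, `z' = g(r cos θ, r sin θ) - z`
that starts at `ρ`. -/
def unperturbedFlow (f : ℝ → ℝ → ℝ) (θ : ℝ) (ρ : ℝ × ℝ) : ℝ × ℝ :=
  (ρ.1, Real.exp (-θ) *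
    (ρ.2 + ∫ s in (0 : ℝ)..θ,
      Real.exp s * companion f (ρ.1 * Real.cos s) (ρ.1 * Real.sin s)))

/-- The fundamental matrix `Y(θ, ρ)` of the variational equation along the unperturbed flow. -/
def fundMatrix (f : ℝ → ℝ → ℝ) (θ : ℝ) (ρ : ℝ × ℝ) : ℝ × ℝ →L[ℝ] ℝ × ℝ :=
  fderiv ℝ (unperturbedFlow f θ) ρ

/-- `y₁(θ, ρ)`. -/
def y1 (p : Params) (f : ℝ → ℝ → ℝ) (θ : ℝ) (ρ : ℝ × ℝ) : ℝ × ℝ :=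
  fundMatrix f θ ρ (∫ s in (0 : ℝ)..θ,
    (fundMatrix f s ρ).inverse (fieldCoeff p f 1 s (unperturbedFlow f s ρ)))

/-- `y₂(θ, ρ)`. -/
def y2 (p : Params) (f : ℝ → ℝ → ℝ) (θ : ℝ) (ρ : ℝ × ℝ) : ℝ × ℝ :=
  (2 : ℝ) • fundMatrix f θ ρ (∫ s in (0 : ℝ)..θ,
    (fundMatrix f s ρ).inverse
      (fieldCoeff p f 2 s (unperturbedFlow f s ρ)
        + fderiv ℝ (fieldCoeff p f 1 s) (unperturbedFlow f s ρ) (y1 p f s ρ)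
        + (1 / 2 : ℝ) • fderiv ℝ (fderiv ℝ (fieldCoeff p f 0 s)) (unperturbedFlow f s ρ)
            (y1 p f s ρ) (y1 p f s ρ)))

/-- The averaged function of order one, `g₁ = Y(2π, ·)⁻¹ y₁(2π, ·)`. -/
def g1 (p : Params) (f : ℝ → ℝ → ℝ) (ρ : ℝ × ℝ) : ℝ × ℝ :=
  (fundMatrix f (2 * Real.pi) ρ).inverse (y1 p f (2 * Real.pi) ρ)

/-- The averaged function of order two, `g₂ = Y(2π, ·)⁻¹ y₂(2π, ·) / 2!`. -/
def g2 (p : Params) (f : ℝ → ℝ → ℝ) (ρ : ℝ × ℝ) : ℝ × ℝ :=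
  (1 / 2 : ℝ) • (fundMatrix f (2 * Real.pi) ρ).inverse (y2 p f (2 * Real.pi) ρ)

/-- The lower right entry of `Id - Y(2π, (r, f(r, 0)))⁻¹`. -/
def cornerDelta (f : ℝ → ℝ → ℝ) (r : ℝ) : ℝ :=
  1 - ((fundMatrix f (2 * Real.pi) (r, f r 0)).inverse (0, 1)).2

/-- `γ₁(r) = - Δ_r⁻¹ π^⊥ g₁(r, f(r, 0))`. -/
def gamma1 (p : Params) (f : ℝ → ℝ → ℝ) (r : ℝ) : ℝ :=
  -(cornerDelta f r)⁻¹ * (g1 p f (r, f r 0)).2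

/-- The bifurcation function of order two,
`f₂(r) = ∂_b π g₁(r, z_r) γ₁(r) + π g₂(r, z_r)` with `z_r = f(r, 0)`. -/
def bifurcation2 (p : Params) (f : ℝ → ℝ → ℝ) (r : ℝ) : ℝ :=
  deriv (fun b => (g1 p f (r, b)).1) (f r 0) * gamma1 p f r + (g2 p f (r, f r 0)).1

/-- `f(x, y) = 2 x² - y²`. -/
def quadF (x y : ℝ) : ℝ := 2 * x ^ 2 - y ^ 2

/-- The common denominator of `A₀` and `A₁`. -/
def denom (p : Params) : ℝ :=
  4 * (1 + Real.exp Real.pi) * (15 * p.a1 * p.b1 - p.b1 ^ 2 - 14 * p.a1 ^ 2)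
    - 5 * Real.pi * (1 - Real.exp Real.pi) * (p.b1 ^ 2 + 10 * p.a1 ^ 2)

def A0 (p : Params) : ℝ := -80 * p.b2 * (1 - Real.exp Real.pi) / denom p

def A1 (p : Params) : ℝ :=
  40 * p.a0 * ((1 + Real.exp Real.pi) * (p.b1 - p.a1) - p.a1 * Real.pi * (1 - Real.exp Real.pi))
    / denom p

/-- The discriminant of `A₀ + A₁ r + r³`. -/
def discr (p : Params) : ℝ := -4 * A1 p ^ 3 - 27 * A0 p ^ 2

end PiecewiseField

end

open PiecewiseField

/-! For `ε = 0` the circle rotates rigidly and `f` changes along it at the rate `g - f`, so `z - f`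
decays like `exp (-t)`: the paraboloid `z = f` is invariant, attracting and filled with
`2π`-periodic circles. On the section `y = 0`, `x > 0`, with coordinates `r = x` and `ζ = z - 2 r²`,
the perturbed return map is slow-fast, `(r, ζ) ↦ (r + ε A, l ζ + ε B)` with `l = exp (-2π)`. Here `A
(r, 0, 0) = 0`: to first order nothing drifts on the paraboloid. The fast variable is eliminated by
`ζ = ε Y (r, ε)`, which solves the second fixed point equation. What remains is `W (r, ε) = A (r, ε
Y, ε) = ε D (r) + O(ε²)` with `D = ∂_ζ A · B / (1 - l) + ∂_ε A` evaluated on `ζ = ε = 0`. A simple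
zero of `D` yields a fixed point (`exists_isolated_fixedPoint`), hence a periodic orbit.

A limit cycle must also be isolated from periodic orbits that close only after many turns. Along a
periodic orbit of the return map, the distance to the graph `ζ = ε Y` contracts, while `W` is
multiplied by about `1 + ε² d` with `d = D' ≠ 0`; the largest value of `|W|` can then only be `0`
(`periodic_slow_fast_eq_zero`). A periodic solution in a thin tube around the circle must rotate and
so cross the plane, and its successive crossings form such an orbit (`exists_section_eq`).

The return map comes from no flow theorem. In rotating coordinates, with time rescaled so that a
half turn takes exactly the parameter length `π`, a half orbit is a solution of `e = M (ε e, r, ζ,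
ε)` in a product of spaces `C([0, π])`, and the implicit function theorem gives smooth dependence
(`exists_halfMap`). The lower half-space is reduced to the upper one by a half rotation about the
`z`-axis. Uniqueness for the smooth fields shows that crossing solutions follow these half orbits.

The formula for `f₂` is a separate calculation: the averaged functions are evaluated from their
definition in cylindrical coordinates (`bifurcation2_quadF`), and `D` from the half turns
(`turnBifurcation_eq`). Both equal the same multiple of the cubic, so no general averaging theorem
is invoked. Finally `Δ > 0`, being a positive definite quadratic form in `a1, b1` (`denom_pos`), and
the sign conditions produce simple positive roots of the cubic. -/

/-! ### Slow-fast return maps: fixed points and absence of other periodic points. -/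

/-- The equation `e = M (ε e, p, ε)` has a smooth solution `e (p, ε)` for small `ε`. -/
theorem exists_contDiffAt_fixedPoint {E F : Type*} [NormedAddCommGroup E] [NormedSpace ℝ E]
    [CompleteSpace E] [NormedAddCommGroup F] [NormedSpace ℝ F] [CompleteSpace F]
    (M : E × F × ℝ → E) (p₀ : F) {n : WithTop ℕ∞} (hn : n ≠ 0)
    (hM : ContDiffAt ℝ n M (0, p₀, 0)) :
    ∃ e : F × ℝ → E, ContDiffAt ℝ n e (p₀, 0) ∧
      ∀ᶠ q in 𝓝 (p₀, (0 : ℝ)), e q = M (q.2 • e q, q.1, q.2) := by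
  set e₀ := M (0, p₀, 0) with he₀
  let G : (F × ℝ) × E → E := fun x => x.2 - M (x.1.2 • x.2, x.1.1, x.1.2)
  have hG : ContDiffAt ℝ n G ((p₀, 0), e₀) := by
    have h1 : ContDiffAt ℝ n (fun x : (F × ℝ) × E => M (x.1.2 • x.2, x.1.1, x.1.2))
        ((p₀, 0), e₀) := by
      refine ContDiffAt.comp (g := M) _ ?_ ?_
      · simpa using hM
      · fun_prop
    exact contDiffAt_snd.sub h1
  -- At `ε = 0` the first argument of `M` is `0` whatever `e` is, so on that slice `G` is `e - e₀`
  -- and its partial derivative in `e` is the identity.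
  have hinr : fderiv ℝ G ((p₀, 0), e₀) ∘L .inr ℝ (F × ℝ) E = ContinuousLinearMap.id ℝ E := by
    have h1 : HasFDerivAt (fun e : E => G ((p₀, 0), e))
        (fderiv ℝ G ((p₀, 0), e₀) ∘L .inr ℝ (F × ℝ) E) e₀ := by
      have := (hG.differentiableAt hn).hasFDerivAt
      exact this.comp e₀ (hasFDerivAt_prodMk_right (p₀, (0 : ℝ)) e₀)
    have h2 : HasFDerivAt (fun e : E => G ((p₀, 0), e)) (ContinuousLinearMap.id ℝ E) e₀ := by
      have : (fun e : E => G ((p₀, 0), e)) = fun e => e - e₀ := by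
        funext e; simp [G, he₀]
      rw [this]
      exact (hasFDerivAt_id e₀).sub_const e₀
    exact h1.unique h2
  have hinv : (fderiv ℝ G ((p₀, 0), e₀) ∘L .inr ℝ (F × ℝ) E).IsInvertible := by
    rw [hinr]; exact ⟨ContinuousLinearEquiv.refl ℝ E, rfl⟩
  refine ⟨hG.implicitFunction hn hinv, hG.contDiffAt_implicitFunction hn hinv, ?_⟩
  filter_upwards [hG.eventually_apply_implicitFunction hn hinv] with q hq
  have hz : G ((p₀, 0), e₀) = 0 := by simp [G, he₀]
  rw [hz] at hq
  exact sub_eq_zero.1 hq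

/-- A periodic real sequence attains its largest absolute value. -/
theorem exists_abs_max_of_periodic {a : ℕ → ℝ} {n : ℕ} (hn : 0 < n) (ha : Function.Periodic a n) :
    ∃ j, ∀ k, |a k| ≤ |a j| := by
  obtain ⟨j, -, hj⟩ := Finset.exists_max_image (Finset.range n) (fun k => |a k|) ⟨0, by simpa⟩
  refine ⟨j, fun k => ?_⟩
  rw [← ha.map_mod_nat k]
  exact hj _ (Finset.mem_range.2 (Nat.mod_lt _ hn))

/-- Periodic sequences of a slow-fast recursion with a hyperbolic slow part are trivial. -/
theorem periodic_slow_fast_eq_zero {l d L ε : ℝ} (hd : d ≠ 0) (hL : 0 ≤ L)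
    (hl : 0 ≤ l) (hl0 : l < 1) (hε : ε ≠ 0) (hε1 : |ε| * L + ε ^ 2 * L ^ 2 ≤ (1 - l) / 2)
    (hε2 : 4 * L ^ 2 * ε ^ 2 ≤ 1 - l) (hε3 : ε ^ 2 * (2 * |d|) ≤ 1)
    {R η W : ℕ → ℝ} {n : ℕ} (hn : 0 < n)
    (hη : Function.Periodic η n) (hW : Function.Periodic W n)
    (h1 : ∀ k, |η (k + 1)| ≤ (l + |ε| * L) * |η k| + |ε| * L * |R (k + 1) - R k|)
    (h2 : ∀ k, |R (k + 1) - R k - ε * W k| ≤ |ε| * L * |η k|)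
    (h3 : ∀ k, ∃ m, |m - d| ≤ |d| / 2 ∧ W (k + 1) - W k = ε * m * (R (k + 1) - R k)) :
    ∀ k, W k = 0 ∧ η k = 0 := by
  -- Periodicity supplies a predecessor for every index, including `0`.
  have succ_pred : ∀ {a : ℕ → ℝ}, Function.Periodic a n → ∀ j, ∃ i, a (i + 1) = a j := by
    intro a ha j
    refine ⟨j + (n - 1), ?_⟩
    rw [show j + (n - 1) + 1 = j + n by omega, ha j]
  obtain ⟨jη, hjη⟩ := exists_abs_max_of_periodic hn hη
  obtain ⟨jW, hjW⟩ := exists_abs_max_of_periodic hn hW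
  set N := |η jη| with hN
  set M := |W jW| with hM
  have hN0 : 0 ≤ N := abs_nonneg _
  have hM0 : 0 ≤ M := abs_nonneg _
  have he : 0 < |ε| := abs_pos.2 hε
  have he2 : |ε| * |ε| = ε ^ 2 := by rw [← sq, sq_abs]
  have hR : ∀ k, |R (k + 1) - R k| ≤ |ε| * M + |ε| * L * N := by
    intro k
    have := abs_add_le (R (k + 1) - R k - ε * W k) (ε * W k)
    rw [sub_add_cancel, abs_mul] at this
    have h4 := h2 k
    have h5 : |ε| * L * |η k| ≤ |ε| * L * N := by gcongr; exact hjη k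
    have h6 : |ε| * |W k| ≤ |ε| * M := by gcongr; exact hjW k
    linarith
  -- The contraction is applied at the predecessor of the index where `|η|` is largest; the `η`
  -- terms of order `ε` are absorbed into `(1 - l) / 2`.
  have hNM : (1 - l) * N ≤ 2 * L * ε ^ 2 * M := by
    obtain ⟨i, hi⟩ := succ_pred hη jη
    have h4 := h1 i
    rw [hi, ← hN] at h4
    have h5 : |ε| * L * |R (i + 1) - R i| ≤ |ε| * L * (|ε| * M + |ε| * L * N) := by
      gcongr; exact hR i
    have h5' : |ε| * L * (|ε| * M + |ε| * L * N) = L * ε ^ 2 * M + ε ^ 2 * L ^ 2 * N := by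
      rw [← he2]; ring
    have h6 : (l + |ε| * L) * |η i| ≤ (l + |ε| * L) * N := by gcongr; exact hjη i
    have h7 : (|ε| * L + ε ^ 2 * L ^ 2) * N ≤ (1 - l) / 2 * N := by gcongr
    nlinarith
  -- The error that `η` causes in the slow recursion is at most half of the largest `|W|`, so it
  -- cannot offset the factor `1 + ε² m`.
  have hLN : L * N ≤ M / 2 := by
    have h4 : (1 - l) * (L * N) ≤ (1 - l) * (M / 2) := by
      have h5 : L * ((1 - l) * N) ≤ L * (2 * L * ε ^ 2 * M) := by gcongr
      have h6 : 4 * L ^ 2 * ε ^ 2 * M ≤ (1 - l) * M := by gcongr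
      nlinarith
    exact le_of_mul_le_mul_left h4 (by linarith)
  have key : ∀ k, ∃ m θ, |m - d| ≤ |d| / 2 ∧ |θ| ≤ ε ^ 2 * |m| * (M / 2) ∧
      W (k + 1) = (1 + ε ^ 2 * m) * W k + θ := by
    intro k
    obtain ⟨m, hm, hm'⟩ := h3 k
    refine ⟨m, ε * m * (R (k + 1) - R k - ε * W k), hm, ?_, by linear_combination hm'⟩
    rw [abs_mul, abs_mul]
    calc |ε| * |m| * |R (k + 1) - R k - ε * W k| ≤ |ε| * |m| * (|ε| * L * |η k|) := by
          gcongr; exact h2 k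
      _ ≤ |ε| * |m| * (|ε| * L * N) := by gcongr; exact hjη k
      _ = ε ^ 2 * |m| * (L * N) := by rw [← he2]; ring
      _ ≤ ε ^ 2 * |m| * (M / 2) := by gcongr
  have hMz : M = 0 := by
    by_contra hMne
    have hMpos : 0 < M := lt_of_le_of_ne hM0 (Ne.symm hMne)
    have hε2pos : 0 < ε ^ 2 := by positivity
    -- If `d < 0`, then `|W|` shrinks, and the step into the maximum is impossible; `hε3` keeps the
    -- factor `1 + ε² m` nonnegative. If `d > 0`, then `|W|` grows, and the step out of the maximum
    -- is impossible.
    rcases lt_or_gt_of_ne hd with hdn | hdp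
    · obtain ⟨i, hi⟩ := succ_pred hW jW
      obtain ⟨m, θ, hm, hθ, hWs⟩ := key i
      rw [abs_of_neg hdn] at hm hε3
      have hm2 := abs_le.1 hm
      have hmn : m < 0 := by linarith
      rw [abs_of_neg hmn] at hθ
      have h4 : 0 ≤ 1 + ε ^ 2 * m := by nlinarith
      have h5 : M ≤ (1 + ε ^ 2 * m) * M + ε ^ 2 * -m * (M / 2) := by
        calc M = |W (i + 1)| := by rw [hi]
          _ ≤ |(1 + ε ^ 2 * m) * W i| + |θ| := by rw [hWs]; exact abs_add_le _ _
          _ = (1 + ε ^ 2 * m) * |W i| + |θ| := by rw [abs_mul, abs_of_nonneg h4]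
          _ ≤ _ := by gcongr; exact hjW i
      have h6 : 0 < ε ^ 2 * -m * M := by have := neg_pos.2 hmn; positivity
      nlinarith
    · obtain ⟨m, θ, hm, hθ, hWs⟩ := key jW
      rw [abs_of_pos hdp] at hm
      have hm2 := abs_le.1 hm
      have hmp : 0 < m := by linarith
      rw [abs_of_pos hmp] at hθ
      have h4 : 0 ≤ 1 + ε ^ 2 * m := by positivity
      have h5 := hjW (jW + 1)
      have h6 : (1 + ε ^ 2 * m) * M ≤ |W (jW + 1)| + |θ| := by
        have : (1 + ε ^ 2 * m) * W jW = W (jW + 1) + -θ := by rw [hWs]; ring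
        calc (1 + ε ^ 2 * m) * M = |(1 + ε ^ 2 * m) * W jW| := by
              rw [abs_mul, abs_of_nonneg h4]
          _ ≤ |W (jW + 1)| + |-θ| := by rw [this]; exact abs_add_le _ _
          _ = _ := by rw [abs_neg]
      have h7 : 0 < ε ^ 2 * m * M := by positivity
      nlinarith
  have hNz : N = 0 := by
    rw [hMz, mul_zero] at hNM
    have : 0 < 1 - l := by linarith
    nlinarith
  intro k
  have h4 := hjW k
  have h5 := hjη k
  rw [hMz] at h4
  rw [hNz] at h5
  exact ⟨abs_nonpos_iff.1 h4, abs_nonpos_iff.1 h5⟩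

/-- Slope of a function that vanishes on `ε = 0`, in terms of the mixed second derivative. -/
theorem exists_slope_of_vanishing {W : ℝ × ℝ → ℝ} {ρ d : ℝ} {D : ℝ → ℝ}
    (hW : ContDiffAt ℝ 3 W (ρ, 0)) (h0 : ∀ᶠ r in 𝓝 ρ, W (r, 0) = 0)
    (hD : ∀ᶠ r in 𝓝 ρ, HasDerivAt (fun ε => W (r, ε)) (D r) 0)
    (hDρ : D ρ = 0) (hd : HasDerivAt D d ρ) (hd0 : d ≠ 0) :
    ∃ κ > 0, ∃ C, 0 ≤ C ∧ ∀ ε, |ε| < κ → |W (ρ, ε)| ≤ C * ε ^ 2 ∧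
      ∀ r r', |r - ρ| < κ → |r' - ρ| < κ →
        ∃ m, |m - d| ≤ |d| / 2 ∧ W (r, ε) - W (r', ε) = ε * m * (r - r') := by
  have hWev : ∀ᶠ x in 𝓝 (ρ, (0 : ℝ)), ContDiffAt ℝ 3 W x := hW.eventually (by simp)
  have hF : ContDiffAt ℝ 2 (fderiv ℝ W) (ρ, 0) := hW.fderiv_right (by norm_num)
  have hFd : HasStrictFDerivAt (fderiv ℝ W) (fderiv ℝ (fderiv ℝ W) (ρ, 0)) (ρ, 0) :=
    hF.hasStrictFDerivAt (by norm_num)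
  -- the mixed derivative
  have hr0 : Tendsto (fun r : ℝ => (r, (0 : ℝ))) (𝓝 ρ) (𝓝 (ρ, 0)) :=
    (Continuous.tendsto (by fun_prop) ρ)
  have hmix : fderiv ℝ (fderiv ℝ W) (ρ, 0) (0, 1) (1, 0) = d := by
    have hsymm : IsSymmSndFDerivAt ℝ W (ρ, 0) := hW.isSymmSndFDerivAt (by simp; norm_num)
    rw [hsymm.eq]
    have h1 : HasDerivAt (fun r : ℝ => fderiv ℝ W (r, 0) (0, 1))
        (fderiv ℝ (fderiv ℝ W) (ρ, 0) (1, 0) (0, 1)) ρ := by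
      have h2 : HasDerivAt (fun r : ℝ => (r, (0 : ℝ))) (1, 0) ρ :=
        (hasDerivAt_id ρ).prodMk (hasDerivAt_const ρ 0)
      have h3 := hFd.hasFDerivAt.comp_hasDerivAt ρ h2
      exact h3.clm_apply (hasDerivAt_const ρ ((0 : ℝ), (1 : ℝ))) |>.congr_deriv (by simp)
    refine (h1.congr_of_eventuallyEq ?_).unique hd
    filter_upwards [hD, hr0.eventually hWev] with r hr hr'
    have h2 : HasDerivAt (fun ε : ℝ => (r, ε)) (0, 1) 0 :=
      (hasDerivAt_const 0 r).prodMk (hasDerivAt_id 0)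
    have h3 := (hr'.differentiableAt (by norm_num)).hasFDerivAt.comp_hasDerivAt (0 : ℝ) h2
    exact hr.unique h3
  -- strict differentiability
  have hlip := hFd.isLittleO.def (c := |d| / 2) (by positivity)
  rw [Filter.eventually_iff_exists_mem] at hlip
  obtain ⟨V, hV, hVp⟩ := hlip
  obtain ⟨K, t, ht, hKt⟩ := (hF.of_le (by norm_num)).exists_lipschitzOnWith
  rw [nhds_prod_eq, Filter.mem_prod_self_iff] at hV
  obtain ⟨t', ht', hVt'⟩ := hV
  have hall := (Filter.inter_mem ht ht')
  have hW2 : ∀ᶠ r in 𝓝 ρ, ∀ᶠ s in 𝓝 r, W (s, 0) = 0 := h0.eventually_nhds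
  have hbase : ∀ᶠ x in 𝓝 (ρ, (0 : ℝ)), x ∈ t ∩ t' ∧ ContDiffAt ℝ 3 W x :=
    Filter.Eventually.and hall hWev
  obtain ⟨κ₁, hκ₁, hb⟩ := Metric.eventually_nhds_iff_ball.1 hbase
  obtain ⟨κ₂, hκ₂, hb2⟩ := Metric.eventually_nhds_iff_ball.1 hW2
  have hmem : ∀ r ε, |r - ρ| < min κ₁ κ₂ → |ε| < min κ₁ κ₂ → (r, ε) ∈ Metric.ball (ρ, (0 : ℝ)) κ₁ := by
    intro r ε hr hε
    rw [Metric.mem_ball, Prod.dist_eq, Real.dist_eq, Real.dist_eq, sub_zero]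
    exact max_lt (lt_of_lt_of_le hr (min_le_left _ _)) (lt_of_lt_of_le hε (min_le_left _ _))
  refine ⟨min κ₁ κ₂, lt_min hκ₁ hκ₂, K, K.2, fun ε hε => ⟨?_, fun r r' hr hr' => ?_⟩⟩
  -- `W` and `∂_ε W` vanish at `(ρ, 0)` and the derivative is Lipschitz with constant `K`, hence `|W
  -- (ρ, ε)| ≤ K ε²`.
  · have hρ : |ρ - ρ| < min κ₁ κ₂ := by simpa using lt_min hκ₁ hκ₂
    have hW00 : W (ρ, 0) = 0 := h0.self_of_nhds
    have hz : fderiv ℝ W (ρ, 0) (0, 1) = 0 := by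
      have h2 : HasDerivAt (fun ε : ℝ => (ρ, ε)) (0, 1) 0 :=
        (hasDerivAt_const 0 ρ).prodMk (hasDerivAt_id 0)
      have h3 := (hW.differentiableAt (by norm_num)).hasFDerivAt.comp_hasDerivAt (0 : ℝ) h2
      exact (h3.unique hD.self_of_nhds).trans hDρ
    have hder : ∀ s ∈ Metric.closedBall (0 : ℝ) |ε|,
        HasDerivWithinAt (fun s => W (ρ, s)) (fderiv ℝ W (ρ, s) (0, 1))
          (Metric.closedBall (0 : ℝ) |ε|) s := by
      intro s hs
      have hs' : |s| < min κ₁ κ₂ := by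
        rw [mem_closedBall_zero_iff, Real.norm_eq_abs] at hs; linarith
      have h2 : HasDerivAt (fun ε : ℝ => (ρ, ε)) (0, 1) s :=
        (hasDerivAt_const s ρ).prodMk (hasDerivAt_id s)
      have h3 := ((hb _ (hmem ρ s hρ hs')).2.differentiableAt (by norm_num)).hasFDerivAt
      exact (h3.comp_hasDerivAt s h2).hasDerivWithinAt
    have hbd : ∀ s ∈ Metric.closedBall (0 : ℝ) |ε|, ‖fderiv ℝ W (ρ, s) (0, 1)‖ ≤ K * |ε| := by
      intro s hs
      rw [mem_closedBall_zero_iff, Real.norm_eq_abs] at hs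
      have hs' : |s| < min κ₁ κ₂ := by linarith
      have hm1 := (hb _ (hmem ρ s hρ hs')).1.1
      have hm0 := (hb _ (hmem ρ 0 hρ (by simpa using lt_min hκ₁ hκ₂))).1.1
      have h4 := hKt.dist_le_mul _ hm1 _ hm0
      have h5 : fderiv ℝ W (ρ, s) (0, 1) = (fderiv ℝ W (ρ, s) - fderiv ℝ W (ρ, 0)) (0, 1) := by
        simp [hz]
      rw [h5]
      calc _ ≤ ‖fderiv ℝ W (ρ, s) - fderiv ℝ W (ρ, 0)‖ * ‖((0 : ℝ), (1 : ℝ))‖ :=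
            ContinuousLinearMap.le_opNorm _ _
        _ ≤ K * |s| * 1 := by
            gcongr
            · rw [← dist_eq_norm]; refine h4.trans (le_of_eq ?_)
              simp [Prod.dist_eq]
            · simp [Prod.norm_def]
        _ ≤ K * |ε| := by rw [mul_one]; gcongr
    have h6 := (convex_closedBall (0 : ℝ) |ε|).norm_image_sub_le_of_norm_hasDerivWithin_le
      hder hbd (x := 0) (y := ε) (by simp) (by simp)
    rw [hW00, sub_zero, sub_zero, Real.norm_eq_abs, Real.norm_eq_abs] at h6
    calc _ ≤ _ := h6
      _ = K * ε ^ 2 := by rw [mul_assoc, ← sq, sq_abs]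
  -- `∂_r W (s, ε)` differs from `∂_r W (s, 0) = 0` by `ε d` up to `|d| |ε| / 2`, by strict
  -- differentiability of the derivative. The mean value inequality for `W - ε d s` then bounds the
  -- slope.
  · have hder : ∀ s ∈ Metric.ball ρ (min κ₁ κ₂),
        HasDerivWithinAt (fun s => W (s, ε) - ε * d * s) (fderiv ℝ W (s, ε) (1, 0) - ε * d)
          (Metric.ball ρ (min κ₁ κ₂)) s := by
      intro s hs
      rw [Metric.mem_ball, Real.dist_eq] at hs
      have h2 : HasDerivAt (fun s : ℝ => (s, ε)) (1, 0) s :=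
        (hasDerivAt_id s).prodMk (hasDerivAt_const s ε)
      have h3 := ((hb _ (hmem s ε hs hε)).2.differentiableAt (by norm_num)).hasFDerivAt
      have h4 := (h3.comp_hasDerivAt s h2).sub ((hasDerivAt_id s).const_mul (ε * d))
      rw [mul_one] at h4
      exact h4.hasDerivWithinAt
    have hbd : ∀ s ∈ Metric.ball ρ (min κ₁ κ₂),
        ‖fderiv ℝ W (s, ε) (1, 0) - ε * d‖ ≤ |d| / 2 * |ε| := by
      intro s hs
      rw [Metric.mem_ball, Real.dist_eq] at hs
      have hm1 := (hb _ (hmem s ε hs hε)).1.2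
      have hm00 := hb _ (hmem s 0 hs (by simpa using lt_min hκ₁ hκ₂))
      have hm0 := hm00.1.2
      have h4 := hVp _ (hVt' (Set.mk_mem_prod hm1 hm0))
      have hz : fderiv ℝ W (s, 0) (1, 0) = 0 := by
        have h2 : HasDerivAt (fun s : ℝ => (s, (0 : ℝ))) (1, 0) s :=
          (hasDerivAt_id s).prodMk (hasDerivAt_const s 0)
        have h3 := (hm00.2.differentiableAt (by norm_num)).hasFDerivAt.comp_hasDerivAt s h2
        have h5 : (W ∘ fun s : ℝ => (s, (0 : ℝ))) =ᶠ[𝓝 s] fun _ => 0 := by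
          have : s ∈ Metric.ball ρ κ₂ := by
            rw [Metric.mem_ball, Real.dist_eq]; exact lt_of_lt_of_le hs (min_le_right _ _)
          exact hb2 s this
        exact (h3.congr_of_eventuallyEq h5.symm).unique (hasDerivAt_const s 0)
      have h5 : fderiv ℝ W (s, ε) (1, 0) - ε * d =
          (fderiv ℝ W (s, ε) - fderiv ℝ W (s, 0)
            - fderiv ℝ (fderiv ℝ W) (ρ, 0) ((s, ε) - (s, 0))) (1, 0) := by
        have h6 : ((s, ε) - (s, 0) : ℝ × ℝ) = ε • ((0 : ℝ), (1 : ℝ)) := by simp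
        rw [h6, map_smul]
        simp [hz, hmix]
      rw [h5]
      calc _ ≤ ‖fderiv ℝ W (s, ε) - fderiv ℝ W (s, 0)
            - fderiv ℝ (fderiv ℝ W) (ρ, 0) ((s, ε) - (s, 0))‖ * ‖((1 : ℝ), (0 : ℝ))‖ :=
            ContinuousLinearMap.le_opNorm _ _
        _ ≤ (|d| / 2 * ‖((s, ε) - (s, 0) : ℝ × ℝ)‖) * 1 := by
            refine mul_le_mul h4 ?_ (norm_nonneg _) (by positivity)
            simp [Prod.norm_def]
        _ = |d| / 2 * |ε| := by simp [Prod.norm_def]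
    have h6 := (convex_ball ρ (min κ₁ κ₂)).norm_image_sub_le_of_norm_hasDerivWithin_le
      hder hbd (x := r') (y := r) (by rwa [Metric.mem_ball, Real.dist_eq])
      (by rwa [Metric.mem_ball, Real.dist_eq])
    -- When the quotient defining `m` is degenerate the difference of values is `0`, and `m = d`
    -- serves.
    by_cases hz : ε * (r - r') = 0
    · refine ⟨d, by rw [sub_self, abs_zero]; positivity, ?_⟩
      have h7 : ε * d * (r - r') = 0 := by linear_combination d * hz
      have h8 : |d| / 2 * |ε| * ‖r - r'‖ = 0 := by
        rw [Real.norm_eq_abs, mul_assoc, ← abs_mul, hz]; simp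
      rw [h8] at h6
      have h9 := norm_le_zero_iff.1 h6
      linear_combination h9
    · refine ⟨(W (r, ε) - W (r', ε)) / (ε * (r - r')), ?_, ?_⟩
      · have h9 : (W (r, ε) - W (r', ε)) / (ε * (r - r')) - d
            = (W (r, ε) - ε * d * r - (W (r', ε) - ε * d * r')) / (ε * (r - r')) := by
          rw [eq_div_iff hz, sub_mul, div_mul_cancel₀ _ hz]; ring
        rw [h9, abs_div, div_le_iff₀ (abs_pos.2 hz), abs_mul, ← mul_assoc]
        exact h6
      · rw [mul_right_comm, mul_div_cancel₀ _ hz]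

/-- Intermediate value theorem for a function with prescribed approximate slope `ε d`. -/
theorem exists_zero_of_slope {F : ℝ → ℝ} {ρ d ε C K κ : ℝ} (hK : 0 ≤ K)
    (hKd : |d| / 2 * K = C) (hεK : K * |ε| < κ) (hFρ : |F ρ| ≤ C * ε ^ 2)
    (hcont : ∀ r, |r - ρ| < κ → ContinuousAt F r)
    (hsl : ∀ r, |r - ρ| < κ → ∃ m, |m - d| ≤ |d| / 2 ∧ F r - F ρ = ε * m * (r - ρ)) :
    ∃ r, |r - ρ| ≤ K * |ε| ∧ F r = 0 := by
  have hs0 : 0 ≤ K * |ε| := by positivity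
  have hcont : ContinuousOn F (uIcc (ρ - K * |ε|) (ρ + K * |ε|)) := by
    intro s hs
    rw [uIcc_of_le (by linarith)] at hs
    have h1 : |s - ρ| ≤ K * |ε| := abs_le.2 ⟨by linarith [hs.1], by linarith [hs.2]⟩
    exact (hcont s (by linarith)).continuousWithinAt
  obtain ⟨m, hm, hm'⟩ := hsl (ρ + K * |ε|) (by rwa [add_sub_cancel_left, abs_of_nonneg hs0])
  obtain ⟨m', hmm, hmm'⟩ := hsl (ρ - K * |ε|)
    (by rwa [sub_sub_cancel_left, abs_neg, abs_of_nonneg hs0])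
  -- At distance `K |ε|` from `ρ` a slope of at least `|ε d| / 2` changes `F` by at least `C ε²`,
  -- which is as much as `|F ρ|` can be; the two ends therefore have opposite weak signs.
  have hq : |ε * d| * (K * |ε|) = 2 * C * ε ^ 2 := by
    rw [abs_mul, ← sq_abs ε]; linear_combination 2 * |ε| ^ 2 * hKd
  have hp : |ε * m - ε * d| ≤ |ε * d| / 2 := by
    rw [← mul_sub, abs_mul, abs_mul]; nlinarith [abs_nonneg ε]
  have hp' : |ε * m' - ε * d| ≤ |ε * d| / 2 := by
    rw [← mul_sub, abs_mul, abs_mul]; nlinarith [abs_nonneg ε]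
  have hWb := abs_le.1 hFρ
  have h0 : (0 : ℝ) ∈ uIcc (F (ρ - K * |ε|)) (F (ρ + K * |ε|)) := by
    rw [Set.mem_uIcc]
    rcases le_total 0 (ε * d) with hs | hs
    · left
      rw [abs_of_nonneg hs] at hp hp' hq
      have h1 := mul_le_mul_of_nonneg_right
        (show ε * d / 2 ≤ ε * m by linarith [(abs_le.1 hp).1]) hs0
      have h2 := mul_le_mul_of_nonneg_right
        (show ε * d / 2 ≤ ε * m' by linarith [(abs_le.1 hp').1]) hs0
      constructor <;> linarith [hWb.1, hWb.2]
    · right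
      rw [abs_of_nonpos hs] at hp hp' hq
      have h1 := mul_le_mul_of_nonneg_right
        (show ε * m ≤ ε * d / 2 by linarith [(abs_le.1 hp).2]) hs0
      have h2 := mul_le_mul_of_nonneg_right
        (show ε * m' ≤ ε * d / 2 by linarith [(abs_le.1 hp').2]) hs0
      constructor <;> linarith [hWb.1, hWb.2]
  obtain ⟨r, hr, hr'⟩ := intermediate_value_uIcc hcont h0
  rw [uIcc_of_le (by linarith)] at hr
  exact ⟨r, abs_le.2 ⟨by linarith [hr.1], by linarith [hr.2]⟩, hr'⟩

set_option maxHeartbeats 800000 in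
/-- Slow-fast return maps `(r, ζ) ↦ (r + ε A, l ζ + ε B)`: a simple zero of the second order
bifurcation function yields a fixed point, and there are no other periodic points nearby. -/
theorem exists_isolated_fixedPoint {A B : ℝ × ℝ × ℝ → ℝ} {ρ l d : ℝ} {α β γ : ℝ → ℝ}
    (hA : ContDiffAt ℝ 3 A (ρ, 0, 0)) (hB : ContDiffAt ℝ 3 B (ρ, 0, 0))
    (hl : 0 ≤ l) (hl1 : l < 1) (hA0 : ∀ᶠ r in 𝓝 ρ, A (r, 0, 0) = 0)
    (hα : ∀ᶠ r in 𝓝 ρ, HasDerivAt (fun ζ => A (r, ζ, 0)) (α r) 0)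
    (hβ : ∀ᶠ r in 𝓝 ρ, B (r, 0, 0) = β r)
    (hγ : ∀ᶠ r in 𝓝 ρ, HasDerivAt (fun ε => A (r, 0, ε)) (γ r) 0)
    (hD0 : α ρ * (β ρ / (1 - l)) + γ ρ = 0)
    (hd : HasDerivAt (fun r => α r * (β r / (1 - l)) + γ r) d ρ) (hd0 : d ≠ 0) :
    ∃ κ > 0, ∃ C, 0 ≤ C ∧ ∀ᶠ ε in 𝓝[≠] (0 : ℝ), ∃ r ζ, |r - ρ| ≤ C * |ε| ∧ |ζ| ≤ C * |ε| ∧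
      A (r, ζ, ε) = 0 ∧ l * ζ + ε * B (r, ζ, ε) = ζ ∧
      ∀ (R Z : ℕ → ℝ) (n : ℕ), 0 < n → (∀ k, |R k - ρ| < κ ∧ |Z k| < κ) →
        (∀ k, R (k + 1) = R k + ε * A (R k, Z k, ε) ∧ Z (k + 1) = l * Z k + ε * B (R k, Z k, ε)) →
        R n = R 0 → Z n = Z 0 → R 0 = r ∧ Z 0 = ζ := by
  have hl1' : (1 : ℝ) - l ≠ 0 := by linarith
  -- `ζ = ε Y` solves `l ζ + ε B = ζ`; dividing by `ε` leaves `Y = B (r, ε Y, ε) / (1 - l)`, regular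
  -- at `ε = 0`.
  obtain ⟨Y, hY, hYeq⟩ := exists_contDiffAt_fixedPoint
    (fun x : ℝ × ℝ × ℝ => B (x.2.1, x.1, x.2.2) / (1 - l)) ρ (n := 3) (by norm_num) (by
      refine ContDiffAt.div_const (ContDiffAt.comp (g := B) _ ?_ ?_) _
      · exact hB
      · fun_prop)
  simp only [smul_eq_mul] at hYeq
  let ι : ℝ × ℝ → ℝ × ℝ × ℝ := fun q => (q.1, q.2 * Y q, q.2)
  have hι : ContDiffAt ℝ 3 ι (ρ, 0) := by fun_prop
  have hι0 : ι (ρ, 0) = (ρ, 0, 0) := by simp [ι]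
  have hW : ContDiffAt ℝ 3 (fun q => A (ι q)) (ρ, 0) := by
    refine ContDiffAt.comp (g := A) _ ?_ hι
    rw [hι0]; exact hA
  have hr0 : Tendsto (fun r : ℝ => (r, (0 : ℝ))) (𝓝 ρ) (𝓝 (ρ, 0)) :=
    Continuous.tendsto (by fun_prop) ρ
  have hr00 : Tendsto (fun r : ℝ => (r, (0 : ℝ), (0 : ℝ))) (𝓝 ρ) (𝓝 (ρ, 0, 0)) :=
    Continuous.tendsto (by fun_prop) ρ
  have hW0 : ∀ᶠ r in 𝓝 ρ, A (ι (r, 0)) = 0 := by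
    filter_upwards [hA0] with r hr
    simpa [ι] using hr
  -- The curve `ε ↦ (r, ε Y, ε)` leaves `(r, 0, 0)` with velocity `(0, β / (1 - l), 1)`; this is
  -- where the second order bifurcation function appears.
  have hWD : ∀ᶠ r in 𝓝 ρ, HasDerivAt (fun ε => A (ι (r, ε))) (α r * (β r / (1 - l)) + γ r) 0 := by
    filter_upwards [hα, hβ, hγ, hr0.eventually hYeq, hr0.eventually (hY.eventually (by simp)),
      hr00.eventually (hA.eventually (by simp))] with r h1 h2 h3 h4 h5 h6
    simp only [zero_mul] at h4
    rw [h2] at h4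
    have h7 := (h6.differentiableAt (by norm_num)).hasFDerivAt
    have h8 : fderiv ℝ A (r, 0, 0) (0, 1, 0) = α r := by
      have h9 : HasDerivAt (fun ζ : ℝ => (r, ζ, (0 : ℝ))) (0, 1, 0) 0 :=
        (hasDerivAt_const 0 r).prodMk ((hasDerivAt_id 0).prodMk (hasDerivAt_const 0 0))
      exact (h7.comp_hasDerivAt (0 : ℝ) h9).unique h1
    have h8' : fderiv ℝ A (r, 0, 0) (0, 0, 1) = γ r := by
      have h9 : HasDerivAt (fun ε : ℝ => (r, (0 : ℝ), ε)) (0, 0, 1) 0 :=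
        (hasDerivAt_const 0 r).prodMk ((hasDerivAt_const 0 0).prodMk (hasDerivAt_id 0))
      exact (h7.comp_hasDerivAt (0 : ℝ) h9).unique h3
    have h10 : HasDerivAt (fun ε : ℝ => ι (r, ε)) (0, β r / (1 - l), 1) 0 := by
      have h11 : DifferentiableAt ℝ (fun ε : ℝ => Y (r, ε)) 0 := by
        refine DifferentiableAt.comp (g := Y) (0 : ℝ) (h5.differentiableAt (by norm_num)) ?_
        fun_prop
      have h12 := (hasDerivAt_id (0 : ℝ)).mul h11.hasDerivAt
      refine (hasDerivAt_const 0 r).prodMk (HasDerivAt.prodMk ?_ (hasDerivAt_id 0))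
      refine h12.congr_deriv ?_
      simp [h4]
    have h7' : HasFDerivAt A (fderiv ℝ A (r, 0, 0)) (ι (r, 0)) := by simpa [ι] using h7
    refine (h7'.comp_hasDerivAt (0 : ℝ) h10).congr_deriv ?_
    have h13 : ((0 : ℝ), β r / (1 - l), (1 : ℝ))
        = (β r / (1 - l)) • ((0 : ℝ), (1 : ℝ), (0 : ℝ)) + ((0 : ℝ), (0 : ℝ), (1 : ℝ)) := by simp
    rw [h13, map_add, map_smul, h8, h8', smul_eq_mul]
    ring
  obtain ⟨κ₁, hκ₁, C₁, hC₁, hslope⟩ := exists_slope_of_vanishing hW hW0 hWD hD0 hd hd0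
  obtain ⟨KA, tA, htA, hKA⟩ := (hA.of_le (by norm_num)).exists_lipschitzOnWith
  obtain ⟨KB, tB, htB, hKB⟩ := (hB.of_le (by norm_num)).exists_lipschitzOnWith
  obtain ⟨KY, tY, htY, hKY⟩ := (hY.of_le (by norm_num)).exists_lipschitzOnWith
  set CY := |Y (ρ, 0)| + 1 with hCY
  have hYb : ∀ᶠ q in 𝓝 (ρ, (0 : ℝ)), |Y q| < CY :=
    hY.continuousAt.abs.eventually_lt_const (by rw [hCY]; linarith)
  have hιt : ∀ᶠ q in 𝓝 (ρ, (0 : ℝ)), ι q ∈ tA ∩ tB := by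
    have := hι.continuousAt
    rw [ContinuousAt, hι0] at this
    exact this.eventually (Filter.inter_mem htA htB)
  have hbase1 := hYeq.and (hYb.and (hιt.and ((Filter.Eventually.and htY
    ((hW.eventually (by simp)).mono fun _ h => h.continuousAt)))))
  obtain ⟨κ₂, hκ₂, hb1⟩ := Metric.eventually_nhds_iff_ball.1 hbase1
  obtain ⟨κ₃, hκ₃, hb2⟩ := Metric.mem_nhds_iff.1 (Filter.inter_mem htA htB)
  obtain ⟨κ, hκ, hκ1, hκ2, hκ3⟩ : ∃ κ > 0, κ ≤ κ₁ ∧ κ ≤ κ₂ ∧ κ ≤ κ₃ :=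
    ⟨min κ₁ (min κ₂ κ₃), by positivity, min_le_left _ _,
      (min_le_right _ _).trans (min_le_left _ _), (min_le_right _ _).trans (min_le_right _ _)⟩
  have hmem2 : ∀ {r ε}, |r - ρ| < κ → |ε| < κ → (r, ε) ∈ Metric.ball (ρ, (0 : ℝ)) κ₂ := by
    intro r ε hr hε
    rw [Metric.mem_ball, Prod.dist_eq, Real.dist_eq, Real.dist_eq, sub_zero]
    exact max_lt (by linarith) (by linarith)
  have hmem3 : ∀ {r ζ ε}, |r - ρ| < κ → |ζ| < κ → |ε| < κ → (r, ζ, ε) ∈ tA ∩ tB := by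
    intro r ζ ε hr hζ hε
    refine hb2 ?_
    rw [Metric.mem_ball, Prod.dist_eq, Prod.dist_eq, Real.dist_eq, Real.dist_eq, Real.dist_eq,
      sub_zero, sub_zero]
    exact max_lt (by linarith) (max_lt (by linarith) (by linarith))
  set K := 2 * C₁ / |d| with hK
  have hdpos : 0 < |d| := abs_pos.2 hd0
  have hK0 : 0 ≤ K := by positivity
  have hKd : |d| / 2 * K = C₁ := by rw [hK]; field_simp
  set L : ℝ := KA + KB + KY with hL
  have hL0 : 0 ≤ L := by positivity
  have hLA : (KA : ℝ) ≤ L := by rw [hL]; have := KB.2; have := KY.2; simp only [NNReal.val_eq_coe] at *; linarith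
  have hLB : (KB : ℝ) ≤ L := by rw [hL]; have := KA.2; have := KY.2; simp only [NNReal.val_eq_coe] at *; linarith
  have hLY : (KY : ℝ) ≤ L := by rw [hL]; have := KB.2; have := KA.2; simp only [NNReal.val_eq_coe] at *; linarith
  have small : ∀ {F : ℝ → ℝ} {c : ℝ}, Continuous F → F 0 = 0 → 0 < c →
      ∀ᶠ ε in 𝓝[≠] (0 : ℝ), F ε < c := by
    intro F c hF hF0 hc
    refine (Filter.Tendsto.eventually_lt_const (v := F 0) (by rwa [hF0]) ?_)
    exact (hF.tendsto 0).mono_left nhdsWithin_le_nhds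
  refine ⟨κ, hκ, max K CY, le_max_of_le_left hK0, ?_⟩
  filter_upwards [small (F := fun ε => |ε|) (by fun_prop) (by simp) hκ,
    small (F := fun ε => K * |ε|) (by fun_prop) (by simp) hκ,
    small (F := fun ε => |ε| * L + ε ^ 2 * L ^ 2) (c := (1 - l) / 2) (by fun_prop) (by simp)
      (by linarith),
    small (F := fun ε => 4 * L ^ 2 * ε ^ 2) (c := 1 - l) (by fun_prop) (by simp) (by linarith),
    small (F := fun ε => ε ^ 2 * (2 * |d|)) (c := 1) (by fun_prop) (by simp) (by linarith),
    self_mem_nhdsWithin] with ε hε hεK hε1 hε2 hε3 hε0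
  have hε0 : ε ≠ 0 := hε0
  obtain ⟨hWρ, hsl⟩ := hslope ε (by linarith)
  have hsl' : ∀ r r', |r - ρ| < κ → |r' - ρ| < κ →
        ∃ m, |m - d| ≤ |d| / 2 ∧ A (ι (r, ε)) - A (ι (r', ε)) = ε * m * (r - r') :=
    fun r r' h h' => hsl r r' (by linarith) (by linarith)
  have hρ0 : |ρ - ρ| < κ := by simpa using hκ
  obtain ⟨r, hr, hWr⟩ := exists_zero_of_slope (F := fun r => A (ι (r, ε))) hK0 hKd hεK hWρ
    (fun s hs => ContinuousAt.comp (f := fun s : ℝ => (s, ε)) (hb1 _ (hmem2 hs hε)).2.2.2.2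
      (by fun_prop)) (fun s hs => hsl' s ρ hs hρ0)
  have hrκ : |r - ρ| < κ := by linarith
  have hYfix : ∀ {s}, |s - ρ| < κ →
      l * (ε * Y (s, ε)) + ε * B (s, ε * Y (s, ε), ε) = ε * Y (s, ε) := by
    intro s hs
    have h1 := (hb1 _ (hmem2 hs hε)).1
    simp only at h1
    rw [eq_div_iff hl1'] at h1
    linear_combination -ε * h1
  refine ⟨r, ε * Y (r, ε), hr.trans (by gcongr; exact le_max_left _ _), ?_, hWr, hYfix hrκ, ?_⟩
  · have h1 := (hb1 _ (hmem2 hrκ hε)).2.1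
    rw [abs_mul, mul_comm]
    gcongr
    exact h1.le.trans (le_max_right _ _)
  · intro R Z n hn hbox hrec hRn hZn
    have hper : ∀ k, R (k + n) = R k ∧ Z (k + n) = Z k := by
      intro k
      induction k with
      | zero => simpa using ⟨hRn, hZn⟩
      | succ k ih =>
        have h1 := hrec (k + n)
        rw [ih.1, ih.2, ← (hrec k).1, ← (hrec k).2] at h1
        rwa [show k + 1 + n = k + n + 1 by omega]
    -- `η` measures the distance to the graph of `ε Y`, and `W` is the reduced drift at the same
    -- `r`.
    have hmain := periodic_slow_fast_eq_zero (l := l) (d := d) (L := L) (ε := ε) hd0 hL0 hl hl1 hε0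
      hε1.le hε2.le hε3.le (R := R) (η := fun k => Z k - ε * Y (R k, ε))
      (W := fun k => A (ι (R k, ε))) hn
      (fun k => by simp only [(hper k).1, (hper k).2]) (fun k => by simp only [(hper k).1])
      (fun k => ?_) (fun k => ?_) (fun k => ?_)
    · obtain ⟨h1, h2⟩ := hmain 0
      obtain ⟨m, hm, hm'⟩ := hsl' (R 0) r (hbox 0).1 hrκ
      rw [h1, hWr, sub_zero] at hm'
      -- `W` vanishes both at `R 0` and at `r`, and its slope `ε m` is nonzero since `|m - d| ≤ |d|
      -- / 2`.
      have hm0 : m ≠ 0 := by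
        rintro rfl
        rw [zero_sub, abs_neg] at hm
        linarith
      have h3 : R 0 = r := by
        have := hm'.symm
        rw [mul_eq_zero] at this
        exact sub_eq_zero.1 (this.resolve_left (mul_ne_zero hε0 hm0))
      refine ⟨h3, ?_⟩
      rw [h3] at h2
      linarith
    · have hk := hbox k
      have hk1 := hbox (k + 1)
      have hB1 := hKB.dist_le_mul _ (hmem3 hk.1 hk.2 hε).2 _ (hb1 _ (hmem2 hk.1 hε)).2.2.1.2
      have hY1 := hKY.dist_le_mul _ (hb1 _ (hmem2 hk1.1 hε)).2.2.2.1 _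
        (hb1 _ (hmem2 hk.1 hε)).2.2.2.1
      simp only [ι, Prod.dist_eq, dist_self, Real.dist_eq] at hB1 hY1
      rw [max_eq_left (abs_nonneg (Z k - ε * Y (R k, ε))), max_eq_right (abs_nonneg (Z k - ε * Y (R k, ε)))] at hB1
      rw [max_eq_left (abs_nonneg _)] at hY1
      have h2 : Z (k + 1) - ε * Y (R (k + 1), ε) = l * (Z k - ε * Y (R k, ε))
          + (ε * (B (R k, Z k, ε) - B (R k, ε * Y (R k, ε), ε))
          + -(ε * (Y (R (k + 1), ε) - Y (R k, ε)))) := by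
        rw [(hrec k).2]
        linear_combination hYfix hk.1
      rw [h2]
      refine (abs_add_le _ _).trans ?_
      refine (add_le_add le_rfl (abs_add_le _ _)).trans ?_
      rw [abs_neg, abs_mul, abs_mul, abs_mul, abs_of_nonneg hl]
      have h3 : |ε| * |B (R k, Z k, ε) - B (R k, ε * Y (R k, ε), ε)|
          ≤ |ε| * (L * |Z k - ε * Y (R k, ε)|) := by
        gcongr; exact hB1.trans (by gcongr)
      have h4 : |ε| * |Y (R (k + 1), ε) - Y (R k, ε)| ≤ |ε| * (L * |R (k + 1) - R k|) := by
        gcongr; exact hY1.trans (by gcongr)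
      linarith
    · have hk := hbox k
      have hA1 := hKA.dist_le_mul _ (hmem3 hk.1 hk.2 hε).1 _ (hb1 _ (hmem2 hk.1 hε)).2.2.1.1
      simp only [ι, Prod.dist_eq, dist_self, Real.dist_eq] at hA1
      rw [max_eq_left (abs_nonneg (Z k - ε * Y (R k, ε))), max_eq_right (abs_nonneg (Z k - ε * Y (R k, ε)))] at hA1
      have h2 : R (k + 1) - R k - ε * A (ι (R k, ε))
          = ε * (A (R k, Z k, ε) - A (R k, ε * Y (R k, ε), ε)) := by
        rw [(hrec k).1]; simp only [ι]; ring
      rw [h2, abs_mul, mul_assoc]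
      gcongr
      exact hA1.trans (by gcongr)
    · exact hsl' _ _ (hbox (k + 1)).1 (hbox k).1

/-! ### Half turns as an integral equation in the Banach algebra `C([0, π])`. -/

/-- Continuous functions on a half turn. -/
abbrev HalfTurn := C(Icc (0 : ℝ) Real.pi, ℝ)

namespace HalfTurn

/-- The extension of a function on the half turn to the line, constant outside. -/
noncomputable def ext (f : HalfTurn) : ℝ → ℝ := IccExtend Real.pi_pos.le f

theorem continuous_ext (f : HalfTurn) : Continuous f.ext := f.continuous.Icc_extend'

theorem ext_of_mem (f : HalfTurn) {s : ℝ} (hs : s ∈ Icc 0 Real.pi) : f.ext s = f ⟨s, hs⟩ :=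
  IccExtend_of_mem _ _ hs

theorem abs_ext_le (f : HalfTurn) (s : ℝ) : |f.ext s| ≤ ‖f‖ :=
  f.norm_coe_le_norm _

theorem norm_integral_ext_le (f : HalfTurn) (s t : ℝ) :
    ‖∫ x in s..t, f.ext x‖ ≤ ‖f‖ * |t - s| :=
  intervalIntegral.norm_integral_le_of_norm_le_const fun x _ => f.abs_ext_le x

/-- Because of the constant extension this is a two-sided derivative even at the ends `0` and `π`,
so half orbits solve their equation on a neighbourhood-free closed interval in the sense of
`HasDerivAt`. -/
theorem hasDerivAt_integral_ext (f : HalfTurn) (s : ℝ) :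
    HasDerivAt (fun s => ∫ x in (0 : ℝ)..s, f.ext x) (f.ext s) s :=
  intervalIntegral.integral_hasDerivAt_right (f.continuous_ext.intervalIntegrable _ _)
    (f.continuous_ext.stronglyMeasurableAtFilter _ _) f.continuous_ext.continuousAt

/-- The antiderivative that vanishes at `0`. -/
noncomputable def antideriv : HalfTurn →L[ℝ] HalfTurn :=
  LinearMap.mkContinuous
    { toFun := fun f => ⟨fun s => ∫ x in (0 : ℝ)..s, f.ext x, by
        have : Continuous fun s => ∫ x in (0 : ℝ)..s, f.ext x :=
          continuous_iff_continuousAt.2 fun s => (f.hasDerivAt_integral_ext s).continuousAt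
        exact this.comp continuous_subtype_val⟩
      map_add' := fun f g => by
        ext s
        exact intervalIntegral.integral_add (f.continuous_ext.intervalIntegrable _ _)
          (g.continuous_ext.intervalIntegrable _ _)
      map_smul' := fun c f => by
        ext s
        exact intervalIntegral.integral_const_mul c _ }
    Real.pi (fun f => by
      rw [ContinuousMap.norm_le _ (by positivity)]
      intro s
      refine (f.norm_integral_ext_le 0 s).trans ?_
      rw [sub_zero, abs_of_nonneg s.2.1, mul_comm]
      gcongr
      exact s.2.2)

theorem antideriv_apply (f : HalfTurn) (s : Icc (0 : ℝ) Real.pi) :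
    antideriv f s = ∫ x in (0 : ℝ)..s, f.ext x := rfl

/-- Evaluation at the end of the half turn. -/
noncomputable def evalEnd : HalfTurn →L[ℝ] ℝ :=
  ContinuousMap.evalCLM ℝ ⟨Real.pi, right_mem_Icc.2 Real.pi_pos.le⟩

/-- The integral over the half turn. -/
noncomputable def total : HalfTurn →L[ℝ] ℝ := evalEnd ∘L antideriv

theorem evalEnd_antideriv (f : HalfTurn) : evalEnd (antideriv f) = total f := rfl

theorem total_eq (f : HalfTurn) : total f = ∫ x in (0 : ℝ)..Real.pi, f.ext x := rfl

theorem integral_ext_congr (f : HalfTurn) {g : ℝ → ℝ} {t : ℝ} (ht : t ∈ Icc 0 Real.pi)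
    (h : ∀ s : Icc (0 : ℝ) Real.pi, f s = g s) :
    ∫ x in (0 : ℝ)..t, f.ext x = ∫ x in (0 : ℝ)..t, g x := by
  refine intervalIntegral.integral_congr fun x hx => ?_
  rw [uIcc_of_le ht.1] at hx
  rw [f.ext_of_mem ⟨hx.1, hx.2.trans ht.2⟩]
  exact h ⟨x, _⟩

/-- The restriction of a continuous function to the half turn. -/
noncomputable def restr (g : ℝ → ℝ) (hg : Continuous g) : HalfTurn :=
  ⟨fun s => g s, hg.comp continuous_subtype_val⟩

noncomputable def cosH : HalfTurn := restr Real.cos Real.continuous_cos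
noncomputable def sinH : HalfTurn := restr Real.sin Real.continuous_sin
noncomputable def expH : HalfTurn := restr Real.exp Real.continuous_exp
noncomputable def expNegH : HalfTurn := restr (fun s => Real.exp (-s)) (by fun_prop)

@[simp] theorem cosH_apply (s : Icc (0 : ℝ) Real.pi) : cosH s = Real.cos s := rfl
@[simp] theorem sinH_apply (s : Icc (0 : ℝ) Real.pi) : sinH s = Real.sin s := rfl
@[simp] theorem expH_apply (s : Icc (0 : ℝ) Real.pi) : expH s = Real.exp s := rfl
@[simp] theorem expNegH_apply (s : Icc (0 : ℝ) Real.pi) : expNegH s = Real.exp (-s) := rfl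

end HalfTurn

/-- Coefficients of a perturbation acting on the half-space `y > 0`. -/
structure HalfParams where
  a0 : ℝ
  a1 : ℝ
  a2 : ℝ
  a3 : ℝ
  c1 : ℝ
  c2 : ℝ
  c3 : ℝ

namespace HalfParams

variable (P : HalfParams)

/-- The perturbation of the first component, divided by `ε`. -/
def pert1 (ε z : ℝ) : ℝ := P.a0 + ε * P.a2 + (P.a1 + ε * P.a3) * z

/-- The perturbation of the second component, divided by `ε`. -/
def pert2 (ε z : ℝ) : ℝ := ε * P.c2 + (P.c1 + ε * P.c3) * z

/-- The field on the half-space. -/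
def field (ε : ℝ) : ℝ × ℝ × ℝ → ℝ × ℝ × ℝ := fun (x, y, z) =>
  (-y + ε * P.pert1 ε z, x + ε * P.pert2 ε z, -z + (2 * x ^ 2 - 6 * x * y - y ^ 2))

open HalfTurn

/-- `x` in terms of rotating coordinates. -/
noncomputable def rotX (u v : HalfTurn) : HalfTurn := cosH * u - sinH * v
/-- `y` in terms of rotating coordinates. -/
noncomputable def rotY (u v : HalfTurn) : HalfTurn := sinH * u + cosH * v
/-- `z` in terms of rotating coordinates. -/
noncomputable def rotZ (u v h : HalfTurn) : HalfTurn :=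
  (2 : ℝ) • (rotX u v * rotX u v) - rotY u v * rotY u v + expNegH * h
-- `S1` and `S2` are `pert1` and `pert2` along a whole half turn, with the height given as a
-- function.
noncomputable def S1 (ε : ℝ) (z : HalfTurn) : HalfTurn :=
  (P.a0 + ε * P.a2) • (1 : HalfTurn) + (P.a1 + ε * P.a3) • z
noncomputable def S2 (ε : ℝ) (z : HalfTurn) : HalfTurn :=
  (ε * P.c2) • (1 : HalfTurn) + (P.c1 + ε * P.c3) • z

/-- The radial part of the perturbation. -/
noncomputable def radial (ε : ℝ) (z : HalfTurn) : HalfTurn := cosH * P.S1 ε z + sinH * P.S2 ε z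
/-- The tangential part of the perturbation. -/
noncomputable def tangential (ε : ℝ) (z : HalfTurn) : HalfTurn :=
  cosH * P.S2 ε z - sinH * P.S1 ε z

/-- The relative change of speed for which the half turn ends on the switching plane. -/
noncomputable def speed (ε σ : ℝ) (u v h : HalfTurn) : ℝ :=
  -((1 + σ) * total (P.tangential ε (rotZ u v h)) / total u)

/-- The argument `σ` is the full relative change of speed, `speed` is the same quantity divided by
`ε`; a fixed point of `halfOp` makes the two consistent. The rates are the derivatives of `u`, `v`,
`h` divided by `ε`, and the terms with `speed` come from rotating by `s` while time runs by `(1 + σ)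
s`. -/
noncomputable def rateU (ε σ : ℝ) (u v h : HalfTurn) : HalfTurn :=
  (1 + σ) • P.radial ε (rotZ u v h) - P.speed ε σ u v h • v
noncomputable def rateV (ε σ : ℝ) (u v h : HalfTurn) : HalfTurn :=
  (1 + σ) • P.tangential ε (rotZ u v h) + P.speed ε σ u v h • u
noncomputable def rateH (ε σ : ℝ) (u v h : HalfTurn) : HalfTurn :=
  -((1 + σ) • (expH * ((4 : ℝ) • (rotX u v * P.S1 ε (rotZ u v h))
    - (2 : ℝ) • (rotY u v * P.S2 ε (rotZ u v h)))) + P.speed ε σ u v h • h)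

/-- The space of unknowns: rotating coordinates and speed. -/
abbrev Unknown := HalfTurn × HalfTurn × HalfTurn × ℝ

/-- Evaluate a function of the rotating coordinates at a perturbation of the constant `(r, 0, ζ)`. -/
noncomputable def atPert {X : Type*} (F : ℝ → ℝ → HalfTurn → HalfTurn → HalfTurn → X)
    (q : Unknown × (ℝ × ℝ) × ℝ) : X :=
  F q.2.2 q.1.2.2.2 (q.2.1.1 • 1 + q.1.1) q.1.2.1 (q.2.1.2 • 1 + q.1.2.2.1)

/-- The integral operator whose fixed points are the half turns. -/
noncomputable def halfOp (q : Unknown × (ℝ × ℝ) × ℝ) : Unknown :=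
  (antideriv (atPert P.rateU q), antideriv (atPert P.rateV q), antideriv (atPert P.rateH q),
    atPert P.speed q)

theorem total_const (r : ℝ) : total (r • (1 : HalfTurn)) = Real.pi * r := by
  rw [total_eq, integral_ext_congr (g := fun _ => r) _ (right_mem_Icc.2 Real.pi_pos.le) (by simp)]
  simp

/-- Everything is polynomial in the Banach algebra except the division by `total u`, which equals `π
ρ` at the base point. -/
theorem contDiffAt_speed {ρ : ℝ} (hρ : ρ ≠ 0) :
    ContDiffAt ℝ 3 (atPert P.speed) (0, (ρ, 0), 0) := by
  unfold atPert speed tangential S1 S2 rotZ rotX rotY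
  refine (ContDiffAt.div (by fun_prop) (by fun_prop) ?_).neg
  simp only [Prod.fst_zero, add_zero, total_const]
  exact mul_ne_zero Real.pi_ne_zero hρ

theorem contDiffAt_rateU {ρ : ℝ} (hρ : ρ ≠ 0) :
    ContDiffAt ℝ 3 (atPert P.rateU) (0, (ρ, 0), 0) := by
  have h := P.contDiffAt_speed hρ
  unfold atPert at *
  unfold rateU
  refine ContDiffAt.sub ?_ (h.smul (by fun_prop))
  unfold radial S1 S2 rotZ rotX rotY
  fun_prop

theorem contDiffAt_rateV {ρ : ℝ} (hρ : ρ ≠ 0) :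
    ContDiffAt ℝ 3 (atPert P.rateV) (0, (ρ, 0), 0) := by
  have h := P.contDiffAt_speed hρ
  unfold atPert at *
  unfold rateV
  refine ContDiffAt.add ?_ (h.smul (by fun_prop))
  unfold tangential S1 S2 rotZ rotX rotY
  fun_prop

theorem contDiffAt_rateH {ρ : ℝ} (hρ : ρ ≠ 0) :
    ContDiffAt ℝ 3 (atPert P.rateH) (0, (ρ, 0), 0) := by
  have h := P.contDiffAt_speed hρ
  unfold atPert at *
  unfold rateH
  refine (ContDiffAt.add ?_ (h.smul (by fun_prop))).neg
  unfold S1 S2 rotZ rotX rotY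
  fun_prop

theorem contDiffAt_halfOp {ρ : ℝ} (hρ : ρ ≠ 0) :
    ContDiffAt ℝ 3 P.halfOp (0, (ρ, 0), 0) := by
  have h1 := P.contDiffAt_rateU hρ
  have h2 := P.contDiffAt_rateV hρ
  have h3 := P.contDiffAt_rateH hρ
  have h4 := P.contDiffAt_speed hρ
  unfold halfOp
  exact (antideriv.contDiff.contDiffAt.comp _ h1).prodMk
    ((antideriv.contDiff.contDiffAt.comp _ h2).prodMk
      ((antideriv.contDiff.contDiffAt.comp _ h3).prodMk h4))

end HalfParams

/-! ### From fixed points of the integral operator to trajectories. -/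

namespace HalfParams

open HalfTurn

/-- The unperturbed periodic solution on the circle of radius `r`. -/
noncomputable def circ (r t : ℝ) : ℝ × ℝ × ℝ :=
  (r * Real.cos t, r * Real.sin t, quadF (r * Real.cos t) (r * Real.sin t))

/-- From rotating coordinates to Cartesian ones. -/
noncomputable def unrotate (s u v h : ℝ) : ℝ × ℝ × ℝ :=
  (Real.cos s * u - Real.sin s * v, Real.sin s * u + Real.cos s * v,
    2 * (Real.cos s * u - Real.sin s * v) ^ 2 - (Real.sin s * u + Real.cos s * v) ^ 2
      + Real.exp (-s) * h)

/-- Variation of constants: rotation and decay are built into `unrotate`, so `u`, `v`, `h` carry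
only the perturbation and the change of speed. The third component uses that `-y ∂f/∂x + x ∂f/∂y = g
- f`, with `∂f/∂x = 4x` and `∂f/∂y = -2y`. -/
theorem hasDerivAt_unrotate (P : HalfParams) {u v h : ℝ → ℝ} {s ε σ p₁ p₂ : ℝ}
    (h₁ : p₁ = P.pert1 ε (unrotate s (u s) (v s) (h s)).2.2)
    (h₂ : p₂ = P.pert2 ε (unrotate s (u s) (v s) (h s)).2.2)
    (hu : HasDerivAt u (ε * ((1 + ε * σ) * (Real.cos s * p₁ + Real.sin s * p₂) - σ * v s)) s)
    (hv : HasDerivAt v (ε * ((1 + ε * σ) * (Real.cos s * p₂ - Real.sin s * p₁) + σ * u s)) s)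
    (hh : HasDerivAt h (ε * -((1 + ε * σ) * (Real.exp s *
      (4 * ((Real.cos s * u s - Real.sin s * v s) * p₁)
        - 2 * ((Real.sin s * u s + Real.cos s * v s) * p₂))) + σ * h s)) s) :
    HasDerivAt (fun s => unrotate s (u s) (v s) (h s))
      ((1 + ε * σ) • P.field ε (unrotate s (u s) (v s) (h s))) s := by
  have hc := Real.hasDerivAt_cos s
  have hs := Real.hasDerivAt_sin s
  have he : HasDerivAt (fun s => Real.exp (-s)) (-Real.exp (-s)) s := by
    simpa using (hasDerivAt_id s).neg.exp
  have hX := (hc.mul hu).sub (hs.mul hv)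
  have hY := (hs.mul hu).add (hc.mul hv)
  have hZ := (((hX.pow 2).const_mul 2).sub (hY.pow 2)).add (he.mul hh)
  have h3 := hX.prodMk (hY.prodMk hZ)
  refine h3.congr_deriv ?_
  have hee : Real.exp (-s) * Real.exp s = 1 := by rw [← Real.exp_add]; simp
  have hcs := Real.sin_sq_add_cos_sq s
  simp only [unrotate] at h₁ h₂
  simp only [field, unrotate, ← h₁, ← h₂]
  ext
  · simp
    linear_combination (ε * (1 + ε * σ) * p₁) * hcs
  · simp
    linear_combination (ε * (1 + ε * σ) * p₂) * hcs
  · simp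
    linear_combination
      (-ε * (1 + ε * σ) * (4 * ((Real.cos s * u s - Real.sin s * v s) * p₁)
        - 2 * ((Real.sin s * u s + Real.cos s * v s) * p₂))) * hee
      + (ε * (1 + ε * σ) * (4 * ((Real.cos s * u s - Real.sin s * v s) * p₁)
        - 2 * ((Real.sin s * u s + Real.cos s * v s) * p₂))) * hcs

/-- The errors in `u`, `v` and the phase add up to `r δ` with `r = (2 + ρ) k`. In `z`, three squares
(one of them doubled) contribute `2 r (ρ + r) δ` each, where `δ ≤ 1` linearises the square, and `k
δ` comes from `h`. -/
theorem abs_sub_le_of_close {s t u v h r ρ k δ : ℝ} (hρ : 0 < ρ) (hs : 0 ≤ s) (hk : 1 ≤ k)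
    (hδ0 : 0 ≤ δ) (hδ : δ ≤ 1) (hu : |u - ρ| ≤ k * δ) (hv : |v| ≤ k * δ) (hh : |h| ≤ k * δ)
    (hst : |s - t| ≤ k * δ) (hr : r = (2 + ρ) * k) :
    ‖unrotate s u v h - circ ρ t‖ ≤ (6 * r * (ρ + r) + k + r) * δ := by
  have hx : |(Real.cos s * u - Real.sin s * v) - ρ * Real.cos t| ≤ r * δ := by
    have h1 : (Real.cos s * u - Real.sin s * v) - ρ * Real.cos t
        = Real.cos s * (u - ρ) + (-(Real.sin s * v) + ρ * (Real.cos s - Real.cos t)) := by ring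
    rw [h1]
    refine (abs_add_le _ _).trans ((add_le_add le_rfl (abs_add_le _ _)).trans ?_)
    rw [abs_neg, abs_mul, abs_mul, abs_mul, abs_of_pos hρ]
    have h2 := mul_le_mul (Real.abs_cos_le_one s) hu (abs_nonneg _) zero_le_one
    have h3 := mul_le_mul (Real.abs_sin_le_one s) hv (abs_nonneg _) zero_le_one
    have h4 := mul_le_mul_of_nonneg_left ((Real.abs_cos_sub_cos_le s t).trans hst) hρ.le
    rw [hr]; linarith
  have hy : |(Real.sin s * u + Real.cos s * v) - ρ * Real.sin t| ≤ r * δ := by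
    have h1 : (Real.sin s * u + Real.cos s * v) - ρ * Real.sin t
        = Real.sin s * (u - ρ) + (Real.cos s * v + ρ * (Real.sin s - Real.sin t)) := by ring
    rw [h1]
    refine (abs_add_le _ _).trans ((add_le_add le_rfl (abs_add_le _ _)).trans ?_)
    rw [abs_mul, abs_mul, abs_mul, abs_of_pos hρ]
    have h2 := mul_le_mul (Real.abs_sin_le_one s) hu (abs_nonneg _) zero_le_one
    have h3 := mul_le_mul (Real.abs_cos_le_one s) hv (abs_nonneg _) zero_le_one
    have h4 := mul_le_mul_of_nonneg_left ((Real.abs_sin_sub_sin_le s t).trans hst) hρ.le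
    rw [hr]; linarith
  have hr0 : 0 ≤ r := by rw [hr]; positivity
  have hsq : ∀ a b : ℝ, |a - b| ≤ r * δ → |b| ≤ ρ → |a ^ 2 - b ^ 2| ≤ r * δ * (2 * (ρ + r)) := by
    intro a b hab hb
    have h1 : a ^ 2 - b ^ 2 = (a - b) * ((a - b) + 2 * b) := by ring
    rw [h1, abs_mul]
    refine mul_le_mul hab ?_ (abs_nonneg _) (by positivity)
    refine (abs_add_le _ _).trans ?_
    rw [abs_mul, abs_two]
    nlinarith
  have h5 := hsq _ _ hx (by
    rw [abs_mul, abs_of_pos hρ]; nlinarith [Real.abs_cos_le_one t])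
  have h6 := hsq _ _ hy (by
    rw [abs_mul, abs_of_pos hρ]; nlinarith [Real.abs_sin_le_one t])
  have h7 : |Real.exp (-s) * h| ≤ k * δ := by
    rw [abs_mul, abs_of_pos (Real.exp_pos _)]
    have : Real.exp (-s) ≤ 1 := Real.exp_le_one_iff.2 (by linarith)
    calc _ ≤ 1 * (k * δ) := mul_le_mul this hh (abs_nonneg _) zero_le_one
      _ = _ := one_mul _
  have hbig : r * δ ≤ (6 * r * (ρ + r) + k + r) * δ := by
    have : 0 ≤ (6 * r * (ρ + r) + k) * δ := by positivity
    linarith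
  rw [Prod.norm_def, Prod.norm_def]
  refine max_le (hx.trans hbig) (max_le (hy.trans hbig) ?_)
  rw [Real.norm_eq_abs]
  have h8 : (unrotate s u v h - circ ρ t).2.2
      = 2 * ((Real.cos s * u - Real.sin s * v) ^ 2 - (ρ * Real.cos t) ^ 2)
      + (-((Real.sin s * u + Real.cos s * v) ^ 2 - (ρ * Real.sin t) ^ 2) + Real.exp (-s) * h) := by
    simp [unrotate, circ, quadF]; ring
  rw [h8]
  refine (abs_add_le _ _).trans ((add_le_add le_rfl (abs_add_le _ _)).trans ?_)
  rw [abs_neg, abs_mul, abs_two]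
  have : 0 ≤ r * δ := by positivity
  linarith

/-- `c` is a trajectory in `y > 0` from `(r, 0, 2 r² + ζ)` to `(-r', 0, 2 r'² + ζ')` in time `τ`,
close to half of the circle of radius `ρ`. -/
structure IsHalfOrbit (P : HalfParams) (ρ K ε r ζ r' ζ' τ : ℝ) (c : ℝ → ℝ × ℝ × ℝ) : Prop where
  one_le : 1 ≤ τ
  time : |τ - Real.pi| ≤ K * |ε|
  start : c 0 = (r, 0, 2 * r ^ 2 + ζ)
  finish : c τ = (-r', 0, 2 * r' ^ 2 + ζ')
  deriv : ∀ t ∈ Icc 0 τ, HasDerivAt c (P.field ε (c t)) t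
  pos : ∀ t ∈ Ioo 0 τ, 0 < (c t).2.1
  close : ∀ t ∈ Icc 0 τ, ‖c t - circ ρ t‖ ≤ K * (|r - ρ| + |ζ| + |ε|)

/-- The components of a fixed point, integrated and rotated back, solve the equation after rescaling
time by `1 + ε σ`. The closeness constant is that of `abs_sub_le_of_close` for `k = 1 + 4 K`, where
`4` bounds `π`. -/
theorem exists_isHalfOrbit (P : HalfParams) {ρ K r ζ ε : ℝ} {e : Unknown} (hρ : 0 < ρ) (hK : 0 ≤ K)
    (he : e = P.halfOp (ε • e, (r, ζ), ε))
    (hnd : total (r • 1 + ε • e.1) ≠ 0)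
    (hU : ‖atPert P.rateU (ε • e, (r, ζ), ε)‖ ≤ K) (hV : ‖atPert P.rateV (ε • e, (r, ζ), ε)‖ ≤ K)
    (hH : ‖atPert P.rateH (ε • e, (r, ζ), ε)‖ ≤ K) (hσ : |e.2.2.2| ≤ K)
    (hsm : |r - ρ| + |ζ| + |ε| ≤ 1) (hsm1 : |r - ρ| + |ε| * (4 * K) < ρ / 2)
    (hsm2 : |ε| * (4 * K) < ρ) (hsm3 : |ε| * K ≤ 1 / 2) :
    ∃ c, P.IsHalfOrbit ρ (6 * ((2 + ρ) * (1 + 4 * K)) * (ρ + (2 + ρ) * (1 + 4 * K)) + (1 + 4 * K)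
        + (2 + ρ) * (1 + 4 * K)) ε r ζ
      (r + ε * evalEnd e.1) (Real.exp (-Real.pi) * ζ + ε * (Real.exp (-Real.pi) * evalEnd e.2.2.1))
      (Real.pi * (1 + ε * e.2.2.2)) c := by
  obtain ⟨U, V, H, σ⟩ := e
  simp only [halfOp, Prod.mk.injEq] at he
  obtain ⟨heU, heV, heH, heσ⟩ := he
  simp only at hnd hσ ⊢
  set q : Unknown × (ℝ × ℝ) × ℝ := (ε • (U, V, H, σ), (r, ζ), ε) with hq
  set IU := atPert P.rateU q with hIU
  set IV := atPert P.rateV q with hIV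
  set IH := atPert P.rateH q with hIH
  set u : ℝ → ℝ := fun s => r + ε * ∫ x in (0 : ℝ)..s, IU.ext x with hu
  set v : ℝ → ℝ := fun s => ε * ∫ x in (0 : ℝ)..s, IV.ext x with hv
  set h : ℝ → ℝ := fun s => ζ + ε * ∫ x in (0 : ℝ)..s, IH.ext x with hh
  set T := 1 + ε * σ with hT
  have hεσ : |ε * σ| ≤ 1 / 2 := by
    rw [abs_mul]; exact (mul_le_mul_of_nonneg_left hσ (abs_nonneg _)).trans hsm3
  have hT0 : 1 / 2 ≤ T := by have := (abs_le.1 hεσ).1; rw [hT]; linarith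
  have hTpos : 0 < T := by linarith
  have huH : ∀ s : Icc (0 : ℝ) Real.pi, (r • (1 : HalfTurn) + ε • U) s = u s := by
    intro s; rw [heU]; simp [hu, antideriv_apply]
  have hvH : ∀ s : Icc (0 : ℝ) Real.pi, (ε • V) s = v s := by
    intro s; rw [heV]; simp [hv, antideriv_apply]
  have hhH : ∀ s : Icc (0 : ℝ) Real.pi, (ζ • (1 : HalfTurn) + ε • H) s = h s := by
    intro s; rw [heH]; simp [hh, antideriv_apply]
  have hpi : (Real.pi : ℝ) ∈ Icc 0 Real.pi := right_mem_Icc.2 Real.pi_pos.le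
  -- The choice of `speed` makes the integral of `rateV` vanish, so the half turn ends on the plane
  -- exactly at `s = π`.
  have hvpi : v Real.pi = 0 := by
    have h1 : total IV = 0 := by
      have h2 : IV = (1 + ε * σ) • P.tangential ε (rotZ (r • 1 + ε • U) (ε • V) (ζ • 1 + ε • H))
          + P.speed ε (ε * σ) (r • 1 + ε • U) (ε • V) (ζ • 1 + ε • H) • (r • 1 + ε • U) := rfl
      rw [h2, map_add, map_smul, map_smul, smul_eq_mul, smul_eq_mul, speed, neg_mul,
        div_mul_cancel₀ _ hnd]
      ring
    simp only [hv]
    rw [← total_eq, h1, mul_zero]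
  have hdu : ∀ s, HasDerivAt u (ε * IU.ext s) s := fun s =>
    ((IU.hasDerivAt_integral_ext s).const_mul ε).const_add r
  have hdv : ∀ s, HasDerivAt v (ε * IV.ext s) s := fun s =>
    (IV.hasDerivAt_integral_ext s).const_mul ε
  have hdh : ∀ s, HasDerivAt h (ε * IH.ext s) s := fun s =>
    ((IH.hasDerivAt_integral_ext s).const_mul ε).const_add ζ
  have hzH : ∀ s : Icc (0 : ℝ) Real.pi, rotZ (r • 1 + ε • U) (ε • V) (ζ • 1 + ε • H) s
      = (unrotate s (u s) (v s) (h s)).2.2 := by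
    intro s
    rw [← huH, ← hvH, ← hhH]
    simp [rotZ, rotX, rotY, unrotate]
    ring
  have hderiv : ∀ s ∈ Icc 0 Real.pi, HasDerivAt (fun s => unrotate s (u s) (v s) (h s))
      (T • P.field ε (unrotate s (u s) (v s) (h s))) s := by
    intro s hs
    have hσ' : P.speed ε (ε * σ) (r • 1 + ε • U) (ε • V) (ζ • 1 + ε • H) = σ := heσ.symm
    have hz := hzH ⟨s, hs⟩
    simp only at hz
    have hp1 : P.S1 ε (rotZ (r • 1 + ε • U) (ε • V) (ζ • 1 + ε • H)) ⟨s, hs⟩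
        = P.pert1 ε (unrotate s (u s) (v s) (h s)).2.2 := by
      rw [← hz]; simp [S1, pert1]
    have hp2 : P.S2 ε (rotZ (r • 1 + ε • U) (ε • V) (ζ • 1 + ε • H)) ⟨s, hs⟩
        = P.pert2 ε (unrotate s (u s) (v s) (h s)).2.2 := by
      rw [← hz]; simp [S2, pert2]
    refine P.hasDerivAt_unrotate (σ := σ) hp1 hp2 ?_ ?_ ?_
    · refine (hdu s).congr_deriv ?_
      rw [IU.ext_of_mem hs, ← hvH ⟨s, hs⟩]
      have : IU = (1 + ε * σ) • P.radial ε (rotZ (r • 1 + ε • U) (ε • V) (ζ • 1 + ε • H))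
        - P.speed ε (ε * σ) (r • 1 + ε • U) (ε • V) (ζ • 1 + ε • H) • (ε • V) := rfl
      rw [this, hσ']
      simp [radial, -mul_eq_mul_left_iff]
      ring
    · refine (hdv s).congr_deriv ?_
      rw [IV.ext_of_mem hs, ← huH ⟨s, hs⟩]
      have : IV = (1 + ε * σ) • P.tangential ε (rotZ (r • 1 + ε • U) (ε • V) (ζ • 1 + ε • H))
        + P.speed ε (ε * σ) (r • 1 + ε • U) (ε • V) (ζ • 1 + ε • H) • (r • 1 + ε • U) := rfl
      rw [this, hσ']
      simp [tangential, -mul_eq_mul_left_iff]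
      ring
    · refine (hdh s).congr_deriv ?_
      rw [IH.ext_of_mem hs, ← huH ⟨s, hs⟩, ← hvH ⟨s, hs⟩, ← hhH ⟨s, hs⟩]
      have : IH = -((1 + ε * σ) • (expH * ((4 : ℝ) • (rotX (r • 1 + ε • U) (ε • V)
            * P.S1 ε (rotZ (r • 1 + ε • U) (ε • V) (ζ • 1 + ε • H)))
          - (2 : ℝ) • (rotY (r • 1 + ε • U) (ε • V)
            * P.S2 ε (rotZ (r • 1 + ε • U) (ε • V) (ζ • 1 + ε • H)))))
          + P.speed ε (ε * σ) (r • 1 + ε • U) (ε • V) (ζ • 1 + ε • H) • (ζ • 1 + ε • H)) := rfl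
      rw [this, hσ']
      simp [rotX, rotY, -mul_eq_mul_left_iff]
      ring
  have hint : ∀ (f : HalfTurn), ‖f‖ ≤ K → ∀ s t, |ε * ∫ x in s..t, f.ext x| ≤ |ε| * K * |t - s| := by
    intro f hf s t
    rw [abs_mul, mul_assoc]
    gcongr
    refine (f.norm_integral_ext_le s t).trans ?_
    gcongr
  have hpi4 : Real.pi ≤ 4 := Real.pi_le_four
  have hscale : ∀ t ∈ Icc 0 (Real.pi * T), t / T ∈ Icc 0 Real.pi := fun t ht =>
    ⟨div_nonneg ht.1 hTpos.le, (div_le_iff₀ hTpos).2 ht.2⟩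
  have hubd : ∀ s ∈ Icc 0 Real.pi, |u s - ρ| ≤ |r - ρ| + |ε| * (4 * K) := by
    intro s hs
    have h1 := hint IU hU 0 s
    rw [sub_zero, abs_of_nonneg hs.1] at h1
    have h2 : u s - ρ = (r - ρ) + ε * ∫ x in (0 : ℝ)..s, IU.ext x := by simp only [hu]; ring
    rw [h2]
    refine (abs_add_le _ _).trans (add_le_add le_rfl (h1.trans ?_))
    rw [mul_assoc, mul_comm 4 K]
    gcongr
    exact hs.2.trans hpi4
  refine ⟨fun t => unrotate (t / T) (u (t / T)) (v (t / T)) (h (t / T)), ?_, ?_, ?_, ?_, ?_, ?_, ?_⟩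
  · nlinarith [Real.pi_gt_three]
  · have h1 : Real.pi * T - Real.pi = Real.pi * (ε * σ) := by rw [hT]; ring
    rw [h1, abs_mul, abs_mul, abs_of_pos Real.pi_pos]
    have h2 : Real.pi * (|ε| * |σ|) ≤ 4 * (|ε| * K) := by gcongr
    have h3 : 0 ≤ (6 * ((2 + ρ) * (1 + 4 * K)) * (ρ + (2 + ρ) * (1 + 4 * K)) + 1
        + (2 + ρ) * (1 + 4 * K)) * |ε| := by positivity
    linarith
  · simp [unrotate, hu, hv, hh]
  · have h1 : Real.pi * T / T = Real.pi := mul_div_cancel_right₀ _ hTpos.ne'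
    have h2 : u Real.pi = r + ε * evalEnd U := by
      rw [heU, evalEnd_antideriv, total_eq]
    have h3 : h Real.pi = ζ + ε * evalEnd H := by
      rw [heH, evalEnd_antideriv, total_eq]
    simp only [h1, hvpi, h2, h3]
    simp [unrotate]
    ring
  · intro t ht
    have h1 := hderiv _ (hscale t ht)
    have h2 : HasDerivAt (fun t => t / T) (1 / T) t := (hasDerivAt_id t).div_const T
    have h3 := HasDerivAt.scomp t h1 h2
    refine h3.congr_deriv ?_
    rw [smul_smul, one_div_mul_cancel hTpos.ne', one_smul]
  · intro t ht
    have hs1 : 0 < t / T := div_pos ht.1 hTpos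
    have hs2 : t / T < Real.pi := (div_lt_iff₀ hTpos).2 ht.2
    set s := t / T
    have hus : ρ / 2 < u s := by
      have := (abs_le.1 (hubd s ⟨hs1.le, hs2.le⟩)).1
      linarith
    have hpp := Real.pi_pos
    show 0 < Real.sin s * u s + Real.cos s * v s
    -- `m` is the distance from `s` to the nearer end of `[0, π]`. Both `v` and the sine vanish at
    -- the ends, and `sin s ≥ 2 m / π` wins because `v` is smaller by a factor of order `ε`.
    have hmain : ∀ m, 0 < m → 2 / Real.pi * m ≤ Real.sin s → |v s| ≤ |ε| * K * m →
        0 < Real.sin s * u s + Real.cos s * v s := by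
      intro m hm hsin hvm
      have h1 : -|v s| ≤ Real.cos s * v s := by
        refine (abs_le.1 (?_ : |Real.cos s * v s| ≤ |v s|)).1
        rw [abs_mul]
        exact mul_le_of_le_one_left (abs_nonneg _) (Real.abs_cos_le_one s)
      have h2 : 2 / Real.pi * m * (ρ / 2) < Real.sin s * u s :=
        mul_lt_mul' hsin hus (by positivity) (lt_of_lt_of_le (by positivity) hsin)
      have h3 : |ε| * K * m ≤ 2 / Real.pi * m * (ρ / 2) := by
        have h4 : 2 / Real.pi * m * (ρ / 2) = ρ / Real.pi * m := by ring
        rw [h4]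
        gcongr
        rw [le_div_iff₀ hpp]
        have : |ε| * K * Real.pi ≤ |ε| * K * 4 := by gcongr
        linarith
      linarith
    rcases le_total s (Real.pi / 2) with hsp | hsp
    · refine hmain s hs1 (Real.mul_le_sin hs1.le hsp) ?_
      have h1 := hint IV hV 0 s
      rwa [sub_zero, abs_of_pos hs1] at h1
    · refine hmain (Real.pi - s) (by linarith) ?_ ?_
      · rw [← Real.sin_pi_sub]
        exact Real.mul_le_sin (by linarith) (by linarith)
      · have h1 := hint IV hV s Real.pi
        rw [abs_of_pos (by linarith : 0 < Real.pi - s)] at h1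
        -- As `v π = 0`, the same bound on `v` holds when integrating backwards from `π`.
        have h2 : v s = -(ε * ∫ x in s..Real.pi, IV.ext x) := by
          have h3 := intervalIntegral.integral_add_adjacent_intervals
            (IV.continuous_ext.intervalIntegrable (μ := MeasureTheory.volume) 0 s)
            (IV.continuous_ext.intervalIntegrable (μ := MeasureTheory.volume) s Real.pi)
          have h4 : ε * ∫ x in (0 : ℝ)..Real.pi, IV.ext x = 0 := hvpi
          rw [← h3] at h4
          simp only [hv]
          linarith
        rwa [h2, abs_neg]
  · intro t ht
    have hs := hscale t ht
    set s := t / T with hsd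
    have hts : t = s * T := by rw [hsd, div_mul_cancel₀ _ hTpos.ne']
    have hδ0 : 0 ≤ |r - ρ| + |ζ| + |ε| := by positivity
    have hζ0 := abs_nonneg ζ
    have hr0 := abs_nonneg (r - ρ)
    have he0 := abs_nonneg ε
    have hbd : ∀ f : HalfTurn, ‖f‖ ≤ K → |ε * ∫ x in (0 : ℝ)..s, f.ext x| ≤ |ε| * K * 4 := by
      intro f hf
      refine (hint f hf 0 s).trans ?_
      rw [sub_zero, abs_of_nonneg hs.1]
      gcongr
      exact hs.2.trans hpi4
    have hrK := mul_nonneg hr0 hK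
    have hζK := mul_nonneg hζ0 hK
    refine abs_sub_le_of_close hρ hs.1 (by linarith) hδ0 hsm ?_ ?_ ?_ ?_ rfl
    · refine (hubd s hs).trans ?_
      nlinarith
    · refine (hbd IV hV).trans ?_
      nlinarith
    · refine (abs_add_le _ _).trans ((add_le_add le_rfl (hbd IH hH)).trans ?_)
      nlinarith
    · have h1 : s - t = -(s * (ε * σ)) := by rw [hts, hT]; ring
      rw [h1, abs_neg, abs_mul, abs_mul, abs_of_nonneg hs.1]
      have h2 : s * (|ε| * |σ|) ≤ 4 * (|ε| * K) := by
        gcongr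
        exact hs.2.trans hpi4
      nlinarith

end HalfParams

/-! ### Expansion of the half-turn map to second order. -/

namespace HalfParams

open HalfTurn

/-- `z` along the unperturbed half turn from `(r, 0, 2 r² + ζ)`. -/
noncomputable def zFree (r ζ s : ℝ) : ℝ :=
  2 * (Real.cos s * r) ^ 2 - (Real.sin s * r) ^ 2 + Real.exp (-s) * ζ

/-- First order change of `r` in a half turn. -/
noncomputable def slowDrift (P : HalfParams) (r ζ : ℝ) : ℝ :=
  ∫ s in (0 : ℝ)..Real.pi,
    (Real.cos s * P.pert1 0 (zFree r ζ s) + Real.sin s * P.pert2 0 (zFree r ζ s))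

/-- First order change of speed. -/
noncomputable def speed₀ (P : HalfParams) (r : ℝ) : ℝ :=
  -((∫ s in (0 : ℝ)..Real.pi,
    (Real.cos s * P.pert2 0 (zFree r 0 s) - Real.sin s * P.pert1 0 (zFree r 0 s))) / (Real.pi * r))

/-- `U₀`, `V₀`, `H₀` are the values at `ε = 0`, `ζ = 0` of the fixed point, that is, the first order
variations of `u`, `v`, `h` along a circle on the paraboloid. `H₀` has no term with `speed₀` because
`h = 0` there. -/
noncomputable def U₀ (P : HalfParams) (r t : ℝ) : ℝ :=
  ∫ s in (0 : ℝ)..t, (Real.cos s * P.pert1 0 (zFree r 0 s) + Real.sin s * P.pert2 0 (zFree r 0 s))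

noncomputable def V₀ (P : HalfParams) (r t : ℝ) : ℝ :=
  ∫ s in (0 : ℝ)..t, (Real.cos s * P.pert2 0 (zFree r 0 s) - Real.sin s * P.pert1 0 (zFree r 0 s)
    + P.speed₀ r * r)

noncomputable def H₀ (P : HalfParams) (r t : ℝ) : ℝ :=
  ∫ s in (0 : ℝ)..t, -(Real.exp s * (4 * (Real.cos s * r * P.pert1 0 (zFree r 0 s))
    - 2 * (Real.sin s * r * P.pert2 0 (zFree r 0 s))))

/-- First order change of `z - f` in a half turn. -/
noncomputable def fastShift (P : HalfParams) (r : ℝ) : ℝ := Real.exp (-Real.pi) * P.H₀ r Real.pi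

/-- First order variation of `z`. -/
noncomputable def zVar (P : HalfParams) (r s : ℝ) : ℝ :=
  4 * (Real.cos s * r * (Real.cos s * P.U₀ r s - Real.sin s * P.V₀ r s))
    - 2 * (Real.sin s * r * (Real.sin s * P.U₀ r s + Real.cos s * P.V₀ r s))
    + Real.exp (-s) * P.H₀ r s

/-- Second order change of `r` in a half turn that starts on the invariant paraboloid. -/
noncomputable def slowDrift₂ (P : HalfParams) (r : ℝ) : ℝ :=
  ∫ s in (0 : ℝ)..Real.pi,
    (Real.cos s * (P.a2 + P.a3 * zFree r 0 s + P.a1 * P.zVar r s)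
      + Real.sin s * (P.c2 + P.c3 * zFree r 0 s + P.c1 * P.zVar r s)
      + P.speed₀ r * (Real.cos s * P.pert1 0 (zFree r 0 s) + Real.sin s * P.pert2 0 (zFree r 0 s))
      - P.speed₀ r * P.V₀ r s)

theorem rotZ_const_apply (r ζ : ℝ) (s : Icc (0 : ℝ) Real.pi) :
    rotZ (r • 1) 0 (ζ • 1) s = zFree r ζ s := by
  simp [rotZ, rotX, rotY, zFree]; ring

theorem S1_const_apply (P : HalfParams) (ε r ζ : ℝ) (s : Icc (0 : ℝ) Real.pi) :
    P.S1 ε (rotZ (r • 1) 0 (ζ • 1)) s = P.pert1 ε (zFree r ζ s) := by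
  rw [← rotZ_const_apply]; simp [S1, pert1]

theorem S2_const_apply (P : HalfParams) (ε r ζ : ℝ) (s : Icc (0 : ℝ) Real.pi) :
    P.S2 ε (rotZ (r • 1) 0 (ζ • 1)) s = P.pert2 ε (zFree r ζ s) := by
  rw [← rotZ_const_apply]; simp [S2, pert2]

theorem pi_mem : (Real.pi : ℝ) ∈ Icc 0 Real.pi := right_mem_Icc.2 Real.pi_pos.le

theorem halfOp_zero (P : HalfParams) (r ζ : ℝ) :
    P.halfOp (0, (r, ζ), 0) = (antideriv (P.rateU 0 0 (r • 1) 0 (ζ • 1)),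
      antideriv (P.rateV 0 0 (r • 1) 0 (ζ • 1)), antideriv (P.rateH 0 0 (r • 1) 0 (ζ • 1)),
      P.speed 0 0 (r • 1) 0 (ζ • 1)) := by
  simp [halfOp, atPert]

theorem speed_zero (P : HalfParams) (r : ℝ) :
    P.speed 0 0 (r • 1) 0 ((0 : ℝ) • 1) = P.speed₀ r := by
  rw [speed, speed₀, total_const, total_eq, integral_ext_congr (g := fun s =>
    Real.cos s * P.pert2 0 (zFree r 0 s) - Real.sin s * P.pert1 0 (zFree r 0 s)) _ pi_mem]
  · ring
  · intro s
    simp only [tangential, ContinuousMap.sub_apply, ContinuousMap.mul_apply, cosH_apply, sinH_apply,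
      S1_const_apply, S2_const_apply]

theorem antideriv_rateU_zero (P : HalfParams) (r ζ : ℝ) (t : Icc (0 : ℝ) Real.pi) :
    antideriv (P.rateU 0 0 (r • 1) 0 (ζ • 1)) t = ∫ s in (0 : ℝ)..t,
      (Real.cos s * P.pert1 0 (zFree r ζ s) + Real.sin s * P.pert2 0 (zFree r ζ s)) := by
  rw [antideriv_apply]
  refine integral_ext_congr _ t.2 fun s => ?_
  simp [rateU, radial, S1_const_apply, S2_const_apply]

theorem antideriv_rateV_zero (P : HalfParams) (r : ℝ) (t : Icc (0 : ℝ) Real.pi) :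
    antideriv (P.rateV 0 0 (r • 1) 0 ((0 : ℝ) • 1)) t = P.V₀ r t := by
  rw [antideriv_apply]
  refine integral_ext_congr _ t.2 fun s => ?_
  rw [rateV, speed_zero]
  simp only [tangential, ContinuousMap.add_apply, ContinuousMap.sub_apply, ContinuousMap.mul_apply,
    ContinuousMap.smul_apply, cosH_apply, sinH_apply, S1_const_apply, S2_const_apply,
    ContinuousMap.one_apply, smul_eq_mul]
  ring

theorem antideriv_rateH_zero (P : HalfParams) (r : ℝ) (t : Icc (0 : ℝ) Real.pi) :
    antideriv (P.rateH 0 0 (r • 1) 0 ((0 : ℝ) • 1)) t = P.H₀ r t := by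
  rw [antideriv_apply]
  refine integral_ext_congr _ t.2 fun s => ?_
  rw [rateH, speed_zero]
  simp only [rotX, rotY, ContinuousMap.add_apply, ContinuousMap.sub_apply, ContinuousMap.mul_apply,
    ContinuousMap.neg_apply, expH_apply,
    ContinuousMap.smul_apply, cosH_apply, sinH_apply, S1_const_apply, S2_const_apply,
    ContinuousMap.one_apply, ContinuousMap.zero_apply, smul_eq_mul]
  ring

/-- Derivative of the total radial rate along a curve of rotating coordinates. -/
theorem hasDerivAt_total_radial (P : HalfParams) {r σ' : ℝ} {σ : ℝ → ℝ} {u v h : ℝ → HalfTurn}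
    {U V H : HalfTurn} (hu : HasDerivAt u U 0) (hv : HasDerivAt v V 0) (hh : HasDerivAt h H 0)
    (hσ : HasDerivAt σ σ' 0) (hσ0 : σ 0 = P.speed₀ r)
    (hu0 : u 0 = r • 1) (hv0 : v 0 = 0) (hh0 : h 0 = (0 : ℝ) • 1)
    (hU : ∀ s, U s = P.U₀ r s) (hV : ∀ s, V s = P.V₀ r s) (hH : ∀ s, H s = P.H₀ r s) :
    HasDerivAt (fun ε => total ((1 + ε * σ ε) • P.radial ε (rotZ (u ε) (v ε) (h ε)) - σ ε • v ε))
      (P.slowDrift₂ r) 0 := by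
  have hX : HasDerivAt (fun ε => rotX (u ε) (v ε)) (cosH * U - sinH * V) 0 :=
    (hu.const_mul cosH).sub (hv.const_mul sinH)
  have hY : HasDerivAt (fun ε => rotY (u ε) (v ε)) (sinH * U + cosH * V) 0 :=
    (hu.const_mul sinH).add (hv.const_mul cosH)
  have hZ : HasDerivAt (fun ε => rotZ (u ε) (v ε) (h ε)) _ 0 :=
    (((hX.mul hX).const_smul (2 : ℝ)).sub (hY.mul hY)).add (hh.const_mul expNegH)
  have hlin : ∀ a b : ℝ, HasDerivAt (fun ε : ℝ => a + ε * b) b 0 := fun a b => by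
    simpa using ((hasDerivAt_id (0 : ℝ)).mul_const b).const_add a
  have hlin' : ∀ b : ℝ, HasDerivAt (fun ε : ℝ => ε * b) b 0 := fun b => by
    simpa using ((hasDerivAt_id (0 : ℝ)).mul_const b)
  have h1 : HasDerivAt (fun ε => P.S1 ε (rotZ (u ε) (v ε) (h ε))) _ 0 :=
    ((hlin P.a0 P.a2).smul_const (1 : HalfTurn)).add ((hlin P.a1 P.a3).smul hZ)
  have h2 : HasDerivAt (fun ε => P.S2 ε (rotZ (u ε) (v ε) (h ε))) _ 0 :=
    ((hlin' P.c2).smul_const (1 : HalfTurn)).add ((hlin P.c1 P.c3).smul hZ)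
  have h3 : HasDerivAt (fun ε => P.radial ε (rotZ (u ε) (v ε) (h ε))) _ 0 :=
    (h1.const_mul cosH).add (h2.const_mul sinH)
  have h4 : HasDerivAt (fun ε => 1 + ε * σ ε) (P.speed₀ r) 0 := by
    have := ((hasDerivAt_id (0 : ℝ)).mul hσ).const_add 1
    simpa [hσ0] using this
  have h5 := (h4.smul h3).sub (hσ.smul hv)
  have h6 := total.hasFDerivAt.comp_hasDerivAt (0 : ℝ) h5
  refine h6.congr_deriv ?_
  rw [total_eq, slowDrift₂]
  refine integral_ext_congr _ pi_mem fun s => ?_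
  simp only [hu0, hv0, hh0, hσ0, radial, ContinuousMap.add_apply, ContinuousMap.sub_apply,
    ContinuousMap.mul_apply, ContinuousMap.smul_apply, cosH_apply, sinH_apply, expNegH_apply,
    S1_const_apply, S2_const_apply, rotZ_const_apply, rotX, rotY, hU, hV, hH,
    ContinuousMap.one_apply, ContinuousMap.zero_apply, smul_eq_mul, zVar]
  ring

/-- The fixed point depends smoothly on `(r, ζ, ε)`; `A` is the end value of its `u` component, and
`B` that of `h` times `exp (-π)`, since `z - f = exp (-s) h`. -/
theorem exists_halfMap (P : HalfParams) {ρ : ℝ} (hρ : 0 < ρ) :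
    ∃ (A B T : ℝ × ℝ × ℝ → ℝ) (c : ℝ × ℝ × ℝ → ℝ → ℝ × ℝ × ℝ) (K : ℝ), 0 ≤ K ∧
      ContDiffAt ℝ 3 A (ρ, 0, 0) ∧ ContDiffAt ℝ 3 B (ρ, 0, 0) ∧
      (∀ᶠ r in 𝓝 ρ, ∀ᶠ ζ in 𝓝 0, A (r, ζ, 0) = P.slowDrift r ζ) ∧
      (∀ᶠ r in 𝓝 ρ, B (r, 0, 0) = P.fastShift r) ∧
      (∀ᶠ r in 𝓝 ρ, HasDerivAt (fun ε => A (r, 0, ε)) (P.slowDrift₂ r) 0) ∧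
      ∀ᶠ x in 𝓝 (ρ, (0 : ℝ), (0 : ℝ)), P.IsHalfOrbit ρ K x.2.2 x.1 x.2.1 (x.1 + x.2.2 * A x)
        (Real.exp (-Real.pi) * x.2.1 + x.2.2 * B x) (T x) (c x) := by
  obtain ⟨e, he, heq⟩ := exists_contDiffAt_fixedPoint P.halfOp (ρ, (0 : ℝ)) (n := 3) (by norm_num)
    (P.contDiffAt_halfOp hρ.ne')
  let j : ℝ × ℝ × ℝ → (ℝ × ℝ) × ℝ := fun x => ((x.1, x.2.1), x.2.2)
  have hj : ContDiff ℝ 3 j := by fun_prop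
  have hej : ContDiffAt ℝ 3 (fun x => e (j x)) (ρ, 0, 0) :=
    ContDiffAt.comp (g := e) _ he hj.contDiffAt
  -- bounds
  have hι : ContDiffAt ℝ 3 (fun q : (ℝ × ℝ) × ℝ => (q.2 • e q, q.1, q.2)) ((ρ, 0), 0) := by fun_prop
  have hcont : ∀ {X : Type} [NormedAddCommGroup X] [NormedSpace ℝ X]
      {G : Unknown × (ℝ × ℝ) × ℝ → X}, ContDiffAt ℝ 3 G (0, (ρ, 0), 0) →
      ContinuousAt (fun q : (ℝ × ℝ) × ℝ => G (q.2 • e q, q.1, q.2)) ((ρ, 0), 0) := by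
    intro X _ _ G hG
    refine ContinuousAt.comp (g := G) ?_ hι.continuousAt
    simpa using hG.continuousAt
  have hbdd : ∀ {X : Type} [NormedAddCommGroup X] {G : (ℝ × ℝ) × ℝ → X},
      ContinuousAt G ((ρ, 0), 0) → ∃ C, 0 ≤ C ∧ ∀ᶠ q in 𝓝 ((ρ, (0 : ℝ)), (0 : ℝ)), ‖G q‖ ≤ C := by
    intro X _ G hG
    refine ⟨‖G ((ρ, 0), 0)‖ + 1, by positivity, ?_⟩
    exact (hG.norm.eventually_lt_const (by linarith)).mono fun _ h => h.le
  obtain ⟨C₁, hC₁, hb₁⟩ := hbdd (hcont (P.contDiffAt_rateU hρ.ne'))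
  obtain ⟨C₂, hC₂, hb₂⟩ := hbdd (hcont (P.contDiffAt_rateV hρ.ne'))
  obtain ⟨C₃, hC₃, hb₃⟩ := hbdd (hcont (P.contDiffAt_rateH hρ.ne'))
  obtain ⟨C₄, hC₄, hb₄⟩ := hbdd (G := fun q => (e q).2.2.2) (by
    have := he.continuousAt; fun_prop)
  have hnd : ∀ᶠ q in 𝓝 ((ρ, (0 : ℝ)), (0 : ℝ)), total (q.1.1 • 1 + q.2 • (e q).1) ≠ 0 := by
    have : ContinuousAt (fun q : (ℝ × ℝ) × ℝ => total (q.1.1 • 1 + q.2 • (e q).1)) ((ρ, 0), 0) := by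
      have := he.continuousAt
      fun_prop
    refine this.eventually_ne ?_
    simp only [zero_smul, add_zero, total_const]
    exact mul_ne_zero Real.pi_ne_zero hρ.ne'
  set K := C₁ + C₂ + C₃ + C₄ with hK
  have hK0 : 0 ≤ K := by positivity
  have hsm : ∀ {F : ℝ × ℝ × ℝ → ℝ} {a : ℝ}, Continuous F → F (ρ, 0, 0) < a →
      ∀ᶠ x in 𝓝 (ρ, (0 : ℝ), (0 : ℝ)), F x < a := fun hF ha =>
    hF.continuousAt.eventually_lt_const ha
  have hjt : Tendsto j (𝓝 (ρ, 0, 0)) (𝓝 ((ρ, 0), 0)) := hj.continuous.tendsto _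
  have horb : ∀ᶠ x in 𝓝 (ρ, (0 : ℝ), (0 : ℝ)), ∃ c, P.IsHalfOrbit ρ
      (6 * ((2 + ρ) * (1 + 4 * K)) * (ρ + (2 + ρ) * (1 + 4 * K)) + (1 + 4 * K)
        + (2 + ρ) * (1 + 4 * K)) x.2.2 x.1 x.2.1 (x.1 + x.2.2 * evalEnd (e (j x)).1)
        (Real.exp (-Real.pi) * x.2.1 + x.2.2 * (Real.exp (-Real.pi) * evalEnd (e (j x)).2.2.1))
        (Real.pi * (1 + x.2.2 * (e (j x)).2.2.2)) c := by
    filter_upwards [hjt.eventually heq, hjt.eventually hb₁, hjt.eventually hb₂, hjt.eventually hb₃,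
      hjt.eventually hb₄, hjt.eventually hnd,
      hsm (F := fun x => |x.1 - ρ| + |x.2.1| + |x.2.2|) (a := 1) (by fun_prop) (by simp),
      hsm (F := fun x => |x.1 - ρ| + |x.2.2| * (4 * K)) (a := ρ / 2) (by fun_prop) (by simpa),
      hsm (F := fun x => |x.2.2| * (4 * K)) (a := ρ) (by fun_prop) (by simpa),
      hsm (F := fun x => |x.2.2| * K) (a := 1 / 2) (by fun_prop) (by simp)]
      with x h1 h2 h3 h4 h5 h6 h7 h8 h9 h10
    exact P.exists_isHalfOrbit hρ hK0 h1 h6 (h2.trans (by linarith)) (h3.trans (by linarith))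
      (h4.trans (by linarith)) (h5.trans (by linarith)) h7.le h8 h9 h10.le
  -- The properties are needed on a neighbourhood of each `(r, 0, 0)` with `r` near `ρ`, so that
  -- they can be differentiated there.
  have hgood : ∀ᶠ r in 𝓝 ρ, ∀ᶠ q in 𝓝 ((r, (0 : ℝ)), (0 : ℝ)),
      ContDiffAt ℝ 3 e q ∧ e q = P.halfOp (q.2 • e q, q.1, q.2) := by
    have h1 := ((he.eventually (by simp)).and heq).eventually_nhds
    have h2 : Tendsto (fun r : ℝ => ((r, (0 : ℝ)), (0 : ℝ))) (𝓝 ρ) (𝓝 ((ρ, 0), 0)) :=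
      Continuous.tendsto (by fun_prop) ρ
    exact h2.eventually h1
  -- Half orbits exist only for parameters near the base point; elsewhere `Classical.epsilon`
  -- returns an arbitrary curve.
  refine ⟨fun x => evalEnd (e (j x)).1, fun x => Real.exp (-Real.pi) * evalEnd (e (j x)).2.2.1,
    fun x => Real.pi * (1 + x.2.2 * (e (j x)).2.2.2), fun x => Classical.epsilon fun c =>
      P.IsHalfOrbit ρ
      (6 * ((2 + ρ) * (1 + 4 * K)) * (ρ + (2 + ρ) * (1 + 4 * K)) + (1 + 4 * K)
        + (2 + ρ) * (1 + 4 * K)) x.2.2 x.1 x.2.1 (x.1 + x.2.2 * evalEnd (e (j x)).1)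
        (Real.exp (-Real.pi) * x.2.1 + x.2.2 * (Real.exp (-Real.pi) * evalEnd (e (j x)).2.2.1))
        (Real.pi * (1 + x.2.2 * (e (j x)).2.2.2)) c, _, by positivity, ?_, ?_, ?_, ?_, ?_,
    horb.mono fun x hx => Classical.epsilon_spec hx⟩
  · exact evalEnd.contDiff.contDiffAt.comp _ hej.fst
  · exact contDiffAt_const.mul (evalEnd.contDiff.contDiffAt.comp _ hej.snd.snd.fst)
  · filter_upwards [hgood] with r hr
    have h2 : Tendsto (fun ζ : ℝ => ((r, ζ), (0 : ℝ))) (𝓝 0) (𝓝 ((r, 0), 0)) :=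
      Continuous.tendsto (by fun_prop) 0
    filter_upwards [h2.eventually hr] with ζ hζ
    have h3 := hζ.2
    rw [zero_smul, halfOp_zero] at h3
    simp only [j]
    rw [h3]
    exact P.antideriv_rateU_zero r ζ _
  · filter_upwards [hgood] with r hr
    have h3 := hr.self_of_nhds.2
    rw [zero_smul, halfOp_zero] at h3
    simp only [j]
    rw [h3, fastShift]
    congr 1
    exact P.antideriv_rateH_zero r _
  · filter_upwards [hgood] with r hr
    have h3 := hr.self_of_nhds.2
    rw [zero_smul, halfOp_zero] at h3
    have h2 : Tendsto (fun ε : ℝ => ((r, (0 : ℝ)), ε)) (𝓝 0) (𝓝 ((r, 0), 0)) :=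
      Continuous.tendsto (by fun_prop) 0
    have hed : HasDerivAt (fun ε : ℝ => e ((r, 0), ε)) (deriv (fun ε : ℝ => e ((r, 0), ε)) 0) 0 := by
      refine DifferentiableAt.hasDerivAt ?_
      exact DifferentiableAt.comp (g := e) (0 : ℝ) (hr.self_of_nhds.1.differentiableAt (by norm_num))
        (by fun_prop)
    set e' := deriv (fun ε : ℝ => e ((r, 0), ε)) 0
    -- The unknowns enter the rates as `ε e`, whose derivative at `0` is the value `e (0)`. Hence
    -- the second order term needs only `U₀`, `V₀`, `H₀` and `speed₀`, never the derivative of `e`.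
    have hm : ∀ {g : ℝ → HalfTurn} {g' : HalfTurn}, HasDerivAt g g' 0 →
        HasDerivAt (fun ε : ℝ => ε • g ε) (g 0) 0 := by
      intro g g' hg
      exact ((hasDerivAt_id (0 : ℝ)).smul hg).congr_deriv (by simp)
    have hdU := hm hed.fst
    have hdV := hm hed.snd.fst
    have hdH := hm hed.snd.snd.fst
    have hmain := P.hasDerivAt_total_radial (r := r) (hdU.const_add (r • (1 : HalfTurn))) hdV
      (hdH.const_add ((0 : ℝ) • (1 : HalfTurn))) hed.snd.snd.snd
      (by rw [h3]; exact P.speed_zero r) (by simp) (by simp) (by simp)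
      (fun s => by rw [h3]; exact P.antideriv_rateU_zero r 0 s)
      (fun s => by rw [h3]; exact P.antideriv_rateV_zero r s)
      (fun s => by rw [h3]; exact P.antideriv_rateH_zero r s)
    refine hmain.congr_of_eventuallyEq ?_
    filter_upwards [h2.eventually hr] with ε hε
    have h4 := hε.2
    have h5 : (e ((r, 0), ε)).2.2.2 = P.speed ε (ε * (e ((r, 0), ε)).2.2.2)
        (r • 1 + ε • (e ((r, 0), ε)).1) (ε • (e ((r, 0), ε)).2.1)
        ((0 : ℝ) • 1 + ε • (e ((r, 0), ε)).2.2.1) := congrArg (fun x : Unknown => x.2.2.2) h4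
    have h6 : (e ((r, 0), ε)).1 = antideriv (P.rateU ε (ε * (e ((r, 0), ε)).2.2.2)
        (r • 1 + ε • (e ((r, 0), ε)).1) (ε • (e ((r, 0), ε)).2.1)
        ((0 : ℝ) • 1 + ε • (e ((r, 0), ε)).2.2.1)) := congrArg (fun x : Unknown => x.1) h4
    rw [rateU, ← h5] at h6
    simp only [j]
    conv_lhs => rw [h6]
    rfl

end HalfParams

/-! ### Crossing solutions follow half orbits. -/

namespace PiecewiseField

/-- Two trajectories of a locally Lipschitz field that start at the same point agree. -/
theorem eqOn_of_right_trajectories {E : Type*} [NormedAddCommGroup E] [NormedSpace ℝ E] {X : E → E}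
    (hX : ∀ q, ∃ K, ∃ s ∈ 𝓝 q, LipschitzOnWith K X s) {f g : ℝ → E} {a b : ℝ}
    (hf : Continuous f) (hg : ContinuousOn g (Icc a b)) (ha : f a = g a)
    (hg' : ∀ t ∈ Ico a b, HasDerivWithinAt g (X (g t)) (Ici t) t)
    (hf' : ∀ t ∈ Ico a b, f t = g t →
      ∀ᶠ s in 𝓝[≥] t, HasDerivWithinAt f (X (f s)) (Ici s) s) : EqOn f g (Icc a b) := by
  rcases lt_or_ge b a with hab | hab
  · rw [Icc_eq_empty (not_le.2 hab)]; exact eqOn_empty _ _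
  have hcl : IsClosed ({t | f t = g t} ∩ Icc a b) := by
    have : {t | f t = g t} ∩ Icc a b = {t | t ∈ Icc a b ∧ f t = g t} := by
      ext t; simp [and_comm]
    rw [this]
    exact isClosed_Icc.isClosed_eq hf.continuousOn hg
  -- Continuous induction: the set of agreement is closed, and local uniqueness to the right of each
  -- of its points extends it. The equation for `f` is therefore needed only just after times at
  -- which `f` already agrees with `g`.
  refine hcl.Icc_subset_of_forall_exists_gt ha ?_
  rintro x ⟨hx, hxab⟩ y hy
  have hx : f x = g x := hx
  obtain ⟨K, s, hs, hK⟩ := hX (f x)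
  have h1 : ∀ᶠ t in 𝓝[≥] x, f t ∈ s := (hf.continuousAt.eventually hs).filter_mono nhdsWithin_le_nhds
  have hgx : ContinuousWithinAt g (Ici x) x := (hg' x hxab).continuousWithinAt
  have h2 : ∀ᶠ t in 𝓝[≥] x, g t ∈ s := hgx.eventually (by rw [← hx]; exact hs)
  obtain ⟨u, hu, hus⟩ := mem_nhdsGE_iff_exists_Ico_subset.1 (h1.and (h2.and (hf' x hxab hx)))
  set w := min u (min y b) with hw
  have hxw : x < w := lt_min hu (lt_min hy hxab.2)
  have hwb : w ≤ b := (min_le_right _ _).trans (min_le_right _ _)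
  have hsub : ∀ t ∈ Ico x w, t ∈ Ico x u ∧ t ∈ Ico a b := fun t ht =>
    ⟨⟨ht.1, ht.2.trans_le (min_le_left _ _)⟩, hxab.1.trans ht.1, ht.2.trans_le hwb⟩
  have := ODE_solution_unique_of_mem_Icc_right (v := fun _ => X) (s := fun _ => s) (K := K)
    (f := f) (g := g) (a := x) (b := w) (fun _ _ => hK) hf.continuousOn
    (fun t ht => (hus (hsub t ht).1).2.2) (fun t ht => (hus (hsub t ht).1).1)
    (hg.mono (Icc_subset_Icc hxab.1 hwb)) (fun t ht => hg' t (hsub t ht).2)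
    (fun t ht => (hus (hsub t ht).1).2.1) hx
  exact ⟨w, this (right_mem_Icc.2 hxw.le), hxw, (min_le_right _ _).trans (min_le_left _ _)⟩

theorem eventually_pos_right {f : ℝ → ℝ} {a f' : ℝ} (h : HasDerivWithinAt f f' (Ici a) a)
    (ha : f a = 0) (hf' : 0 < f') : ∀ᶠ t in 𝓝[>] a, 0 < f t := by
  have h1 := (hasDerivWithinAt_iff_tendsto_slope' (notMem_Ioi.2 le_rfl)).1 h.Ioi_of_Ici
  filter_upwards [h1.eventually_const_lt hf', self_mem_nhdsWithin] with t ht hta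
  rw [slope_def_field, ha, sub_zero] at ht
  exact (div_pos_iff_of_pos_right (sub_pos.2 hta)).1 ht

/-- Rotation by a half turn about the `z`-axis. -/
noncomputable def rotHalf : ℝ × ℝ × ℝ →L[ℝ] ℝ × ℝ × ℝ :=
  (-ContinuousLinearMap.fst ℝ ℝ (ℝ × ℝ)).prod
    ((-(ContinuousLinearMap.fst ℝ ℝ ℝ ∘L ContinuousLinearMap.snd ℝ ℝ (ℝ × ℝ))).prod
      (ContinuousLinearMap.snd ℝ ℝ ℝ ∘L ContinuousLinearMap.snd ℝ ℝ (ℝ × ℝ)))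

@[simp] theorem rotHalf_apply (q : ℝ × ℝ × ℝ) : rotHalf q = (-q.1, -q.2.1, q.2.2) := rfl

theorem rotHalf_rotHalf (q : ℝ × ℝ × ℝ) : rotHalf (rotHalf q) = q := by simp

/-- The perturbation in `y > 0`. -/
def upper (p : Params) : HalfParams := ⟨p.a0, p.a1, p.a2, p.a3, 0, 0, 0⟩

/-- The perturbation in `y < 0`, rotated into `y > 0`. -/
def lower (p : Params) : HalfParams := ⟨0, 0, 0, 0, -p.b1, -p.b2, -p.b3⟩

theorem companion_quadF (x y : ℝ) : companion quadF x y = 2 * x ^ 2 - 6 * x * y - y ^ 2 := by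
  have h1 : HasDerivAt (fun v => quadF x v) (-(2 * y)) y := by
    have := ((hasDerivAt_id y).pow 2).const_sub (2 * x ^ 2)
    refine this.congr_deriv ?_
    simp
  have h2 : HasDerivAt (fun u => quadF u y) (4 * x) x := by
    have := (((hasDerivAt_id x).pow 2).const_mul 2).sub_const (y ^ 2)
    refine this.congr_deriv ?_
    simp; ring
  rw [companion, h1.deriv, h2.deriv, quadF]; ring

theorem fieldPlus_eq (p : Params) (ε : ℝ) (q : ℝ × ℝ × ℝ) :
    fieldPlus p quadF ε q = (upper p).field ε q := by
  obtain ⟨x, y, z⟩ := q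
  simp only [fieldPlus, HalfParams.field, HalfParams.pert1, HalfParams.pert2, upper, companion_quadF]
  ext <;> simp
  ring

/-- `f`, and with it `g`, is invariant under `(x, y) ↦ (-x, -y)`, so the half rotation carries the
lower field to a field of the same kind on `y > 0`, with the signs of the `b` coefficients reversed.
-/
theorem fieldMinus_eq (p : Params) (ε : ℝ) (q : ℝ × ℝ × ℝ) :
    fieldMinus p quadF ε q = rotHalf ((lower p).field ε (rotHalf q)) := by
  obtain ⟨x, y, z⟩ := q
  simp only [fieldMinus, HalfParams.field, HalfParams.pert1, HalfParams.pert2, lower,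
    companion_quadF, rotHalf_apply]
  ext <;> simp
  ring

theorem lipschitz_field (P : HalfParams) (ε : ℝ) (q : ℝ × ℝ × ℝ) :
    ∃ K, ∃ s ∈ 𝓝 q, LipschitzOnWith K (P.field ε) s := by
  have : ContDiff ℝ 1 (P.field ε) := by
    unfold HalfParams.field HalfParams.pert1 HalfParams.pert2
    fun_prop
  exact this.contDiffAt.exists_lipschitzOnWith

/-- A curve that solves the equation in `y > 0` and enters `y > 0` follows the half orbit. -/
theorem follow_halfOrbit {P : HalfParams} {ρ K ε r ζ r' ζ' τ t₀ : ℝ} {c ψ : ℝ → ℝ × ℝ × ℝ}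
    (hc : P.IsHalfOrbit ρ K ε r ζ r' ζ' τ c) (hψc : Continuous ψ)
    (hψ : ∀ t, 0 < (ψ t).2.1 → HasDerivAt ψ (P.field ε (ψ t)) t)
    (h0 : ψ t₀ = (r, 0, 2 * r ^ 2 + ζ)) (hpos : 0 < (P.field ε (ψ t₀)).2.1)
    (hR : HasDerivWithinAt ψ (P.field ε (ψ t₀)) (Ici t₀) t₀) :
    ∀ t ∈ Icc 0 τ, ψ (t₀ + t) = c t := by
  refine eqOn_of_right_trajectories (lipschitz_field P ε) (f := fun t => ψ (t₀ + t))
    (by fun_prop) (fun t ht => (hc.deriv t ht).continuousAt.continuousWithinAt)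
    (by simp only [add_zero]; rw [h0, hc.start])
    (fun t ht => (hc.deriv t (Ico_subset_Icc_self ht)).hasDerivWithinAt) ?_
  intro t ht hft
  have hshift : ∀ s, HasDerivWithinAt ψ (P.field ε (ψ (t₀ + s))) (Ici (t₀ + s)) (t₀ + s) →
      HasDerivWithinAt (fun t => ψ (t₀ + t)) (P.field ε (ψ (t₀ + s))) (Ici s) s := by
    intro s hs
    have h1 : HasDerivWithinAt (fun t => t₀ + t) 1 (Ici s) s :=
      ((hasDerivAt_id s).const_add t₀).hasDerivWithinAt
    have h2 : MapsTo (fun t => t₀ + t) (Ici s) (Ici (t₀ + s)) := fun x hx => by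
      simpa using hx
    exact (HasDerivWithinAt.scomp s hs h1 h2).congr_deriv (one_smul _ _)
  have hy0 : ∀ s, 0 < (ψ (t₀ + s)).2.1 →
      HasDerivWithinAt (fun t => ψ (t₀ + t)) (P.field ε (ψ (t₀ + s))) (Ici s) s := fun s hs =>
    hshift s (hψ _ hs).hasDerivWithinAt
  -- At time `0` the positive normal component pushes the curve into `y > 0`. At later times it
  -- coincides with the half orbit, which lies in `y > 0`.
  rcases eq_or_lt_of_le ht.1 with h | h
  · subst h
    have hd : HasDerivWithinAt (fun t => (ψ (t₀ + t)).2.1) (P.field ε (ψ t₀)).2.1 (Ici 0) 0 := by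
      have := hshift 0 (by rwa [add_zero])
      rw [add_zero] at this
      exact this.snd.fst
    have hev := eventually_pos_right hd (by simp [h0]) hpos
    rw [eventually_nhdsWithin_iff] at hev ⊢
    filter_upwards [hev] with s hs hs0
    rcases eq_or_lt_of_le (mem_Ici.1 hs0) with h | h
    · subst h
      exact hshift 0 (by rwa [add_zero])
    · exact hy0 s (hs h)
  · have h1 : 0 < (ψ (t₀ + t)).2.1 := by rw [hft]; exact hc.pos t ⟨h, ht.2⟩
    have h2 : Continuous fun s => (ψ (t₀ + s)).2.1 := by fun_prop
    exact ((h2.continuousAt.eventually_const_lt h1).filter_mono nhdsWithin_le_nhds).mono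
      fun s hs => hy0 s hs

section Crossing

variable {p : Params} {ε : ℝ} {ψ : ℝ → ℝ × ℝ × ℝ}

theorem IsCrossingSolution.continuous {Xp Xm : ℝ × ℝ × ℝ → ℝ × ℝ × ℝ}
    (h : IsCrossingSolution Xp Xm ψ) : Continuous ψ := by
  rw [continuous_iff_continuousAt]
  intro t
  obtain ⟨h1, h2, h3⟩ := h t
  rcases lt_trichotomy (ψ t).2.1 0 with hy | hy | hy
  · exact (h2 hy).continuousAt
  · rw [continuousAt_iff_continuous_left_right]
    rcases h3 hy with ⟨_, _, hl, hr⟩ | ⟨_, _, hl, hr⟩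
    · exact ⟨hl.continuousWithinAt, hr.continuousWithinAt⟩
    · exact ⟨hl.continuousWithinAt, hr.continuousWithinAt⟩
  · exact (h1 hy).continuousAt

theorem fieldPlus_snd (p : Params) (ε : ℝ) (q : ℝ × ℝ × ℝ) : (fieldPlus p quadF ε q).2.1 = q.1 :=
  rfl

theorem follow_upper {ρ K r ζ r' ζ' τ t₀ : ℝ} {c : ℝ → ℝ × ℝ × ℝ}
    (hψ : IsCrossingSolution (fieldPlus p quadF ε) (fieldMinus p quadF ε) ψ)
    (hc : (upper p).IsHalfOrbit ρ K ε r ζ r' ζ' τ c) (hr : 0 < r)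
    (h0 : ψ t₀ = (r, 0, 2 * r ^ 2 + ζ)) : ∀ t ∈ Icc 0 τ, ψ (t₀ + t) = c t := by
  have hX : (fieldPlus p quadF ε (ψ t₀)).2.1 = r := by rw [fieldPlus_snd, h0]
  refine follow_halfOrbit hc hψ.continuous (fun t ht => ?_) h0 ?_ ?_
  · rw [← fieldPlus_eq]; exact (hψ t).1 ht
  · rw [← fieldPlus_eq, hX]; exact hr
  · rw [← fieldPlus_eq]
    rcases (hψ t₀).2.2 (by rw [h0]) with ⟨_, _, _, h⟩ | ⟨h, _⟩
    · exact h
    · rw [hX] at h; linarith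

theorem follow_lower {ρ K r ζ r' ζ' τ t₀ : ℝ} {c : ℝ → ℝ × ℝ × ℝ}
    (hψ : IsCrossingSolution (fieldPlus p quadF ε) (fieldMinus p quadF ε) ψ)
    (hc : (lower p).IsHalfOrbit ρ K ε r ζ r' ζ' τ c) (hr : 0 < r)
    (h0 : ψ t₀ = (-r, 0, 2 * r ^ 2 + ζ)) : ∀ t ∈ Icc 0 τ, ψ (t₀ + t) = rotHalf (c t) := by
  have hX : (fieldPlus p quadF ε (ψ t₀)).2.1 = -r := by rw [fieldPlus_snd, h0]
  have hcl := (hψ t₀).2.2 (by rw [h0])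
  rw [hX] at hcl
  have hcl := hcl.resolve_left (fun h => by linarith [h.1])
  have hf : ∀ q, (lower p).field ε (rotHalf q) = rotHalf (fieldMinus p quadF ε q) := by
    intro q; rw [fieldMinus_eq, rotHalf_rotHalf]
  have hmain := follow_halfOrbit (ψ := fun t => rotHalf (ψ t)) (t₀ := t₀) hc
    (rotHalf.continuous.comp hψ.continuous) (fun t ht => ?_) (by simp [h0]) ?_ ?_
  · intro t ht
    rw [← hmain t ht, rotHalf_rotHalf]
  · rw [hf]
    exact rotHalf.hasFDerivAt.comp_hasDerivAt t ((hψ t).2.1 (by simpa using ht))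
  · rw [hf]
    simpa using hcl.2.1
  · rw [hf]
    exact rotHalf.hasFDerivAt.comp_hasDerivWithinAt t₀ hcl.2.2.2

end Crossing

/-! ### Full turns and their periodic extension. -/

/-- A full turn: an upper and a lower half orbit, with crossing points in between. -/
structure Turn (p : Params) (ρ K ε r ζ r' ζ' : ℝ) where
  r₁ : ℝ
  ζ₁ : ℝ
  τ₁ : ℝ
  τ₂ : ℝ
  c₁ : ℝ → ℝ × ℝ × ℝ
  c₂ : ℝ → ℝ × ℝ × ℝ
  up : (upper p).IsHalfOrbit ρ K ε r ζ r₁ ζ₁ τ₁ c₁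
  low : (lower p).IsHalfOrbit ρ K ε r₁ ζ₁ r' ζ' τ₂ c₂
  pos : 0 < r
  pos₁ : 0 < r₁
  pos' : 0 < r'
  cross₁ : 0 < ((lower p).field ε (r₁, 0, 2 * r₁ ^ 2 + ζ₁)).2.1
  cross' : ((lower p).field ε (-r', 0, 2 * r' ^ 2 + ζ')).2.1 < 0

namespace Turn

variable {p : Params} {ρ K ε r ζ r' ζ' : ℝ} (A : Turn p ρ K ε r ζ r' ζ')

/-- The duration of a turn. -/
def period : ℝ := A.τ₁ + A.τ₂

/-- The trajectory of a turn. -/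
noncomputable def curve (t : ℝ) : ℝ × ℝ × ℝ :=
  if t ≤ A.τ₁ then A.c₁ t else rotHalf (A.c₂ (t - A.τ₁))

theorem τ₁_pos : 0 < A.τ₁ := zero_lt_one.trans_le A.up.one_le

theorem τ₂_pos : 0 < A.τ₂ := zero_lt_one.trans_le A.low.one_le

theorem two_le_period : 2 ≤ A.period := by
  have := A.up.one_le; have := A.low.one_le; unfold period; linarith

theorem period_pos : 0 < A.period := by linarith [A.two_le_period]

theorem curve_upper {t : ℝ} (ht : t ≤ A.τ₁) : A.curve t = A.c₁ t := if_pos ht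

theorem rotHalf_c₂_zero : rotHalf (A.c₂ 0) = A.c₁ A.τ₁ := by
  rw [A.low.start, A.up.finish]; simp

theorem curve_lower {t : ℝ} (ht : A.τ₁ ≤ t) : A.curve t = rotHalf (A.c₂ (t - A.τ₁)) := by
  rcases eq_or_lt_of_le ht with h | h
  · rw [← h, sub_self, A.curve_upper le_rfl, A.rotHalf_c₂_zero]
  · exact if_neg (not_le.2 h)

theorem curve_zero : A.curve 0 = (r, 0, 2 * r ^ 2 + ζ) := by
  rw [A.curve_upper A.τ₁_pos.le, A.up.start]

theorem curve_mid : A.curve A.τ₁ = (-A.r₁, 0, 2 * A.r₁ ^ 2 + A.ζ₁) := by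
  rw [A.curve_upper le_rfl, A.up.finish]

theorem curve_period : A.curve A.period = (r', 0, 2 * r' ^ 2 + ζ') := by
  have h : A.period - A.τ₁ = A.τ₂ := by unfold period; ring
  rw [A.curve_lower (by linarith [A.τ₂_pos]), h, A.low.finish]
  simp

theorem curve_pos {t : ℝ} (h0 : 0 < t) (h1 : t < A.τ₁) : 0 < (A.curve t).2.1 := by
  rw [A.curve_upper h1.le]; exact A.up.pos t ⟨h0, h1⟩

theorem curve_neg {t : ℝ} (h0 : A.τ₁ < t) (h1 : t < A.period) : (A.curve t).2.1 < 0 := by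
  rw [A.curve_lower h0.le]
  have := A.low.pos (t - A.τ₁) ⟨by linarith, by unfold period at h1; linarith⟩
  simpa using this

/-- The only crossing inside a turn is the downward one. This gives both minimality of the period
and the fact that a turn ends at the first return to the section. -/
theorem not_section {t : ℝ} (h0 : 0 < t) (h1 : t < A.period) (hy : (A.curve t).2.1 = 0) :
    (A.curve t).1 < 0 := by
  rcases lt_trichotomy t A.τ₁ with h | h | h
  · exact absurd hy (A.curve_pos h0 h).ne'
  · rw [h, A.curve_mid]; simpa using A.pos₁
  · exact absurd hy (A.curve_neg h h1).ne

/-- A crossing solution that starts at the initial point follows the turn. -/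
theorem follow {ψ : ℝ → ℝ × ℝ × ℝ} {t₀ : ℝ}
    (hψ : IsCrossingSolution (fieldPlus p quadF ε) (fieldMinus p quadF ε) ψ)
    (h0 : ψ t₀ = (r, 0, 2 * r ^ 2 + ζ)) : ∀ t ∈ Icc 0 A.period, ψ (t₀ + t) = A.curve t := by
  have h1 := follow_upper hψ A.up A.pos h0
  have h2 : ψ (t₀ + A.τ₁) = (-A.r₁, 0, 2 * A.r₁ ^ 2 + A.ζ₁) := by
    rw [h1 _ ⟨A.τ₁_pos.le, le_rfl⟩, A.up.finish]
  have h3 := follow_lower hψ A.low A.pos₁ h2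
  intro t ht
  rcases le_total t A.τ₁ with h | h
  · rw [A.curve_upper h, h1 t ⟨ht.1, h⟩]
  · have := h3 (t - A.τ₁) ⟨by linarith, by have := ht.2; unfold period at this; linarith⟩
    rw [A.curve_lower h, ← this]
    congr 1; ring

theorem follow_period {ψ : ℝ → ℝ × ℝ × ℝ} {t₀ : ℝ}
    (hψ : IsCrossingSolution (fieldPlus p quadF ε) (fieldMinus p quadF ε) ψ)
    (h0 : ψ t₀ = (r, 0, 2 * r ^ 2 + ζ)) : ψ (t₀ + A.period) = (r', 0, 2 * r' ^ 2 + ζ') := by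
  rw [A.follow hψ h0 _ ⟨A.period_pos.le, le_rfl⟩, A.curve_period]

end Turn

namespace Turn

variable {p : Params} {ρ K ε r ζ : ℝ} (A : Turn p ρ K ε r ζ r ζ)

/-- The periodic extension of a closed turn. -/
noncomputable def orbit (t : ℝ) : ℝ × ℝ × ℝ := A.curve (t - ⌊t / A.period⌋ * A.period)

/-- Both end points are allowed because a closed turn ends where it starts; at the right end the
floor jumps to `n + 1`. -/
theorem orbit_eq (n : ℤ) {t : ℝ} (h0 : n * A.period ≤ t) (h1 : t ≤ (n + 1) * A.period) :
    A.orbit t = A.curve (t - n * A.period) := by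
  have hT := A.period_pos
  rcases eq_or_lt_of_le h1 with h | h
  · have hf : ⌊t / A.period⌋ = n + 1 := by
      rw [h, mul_div_cancel_right₀ _ hT.ne']
      exact_mod_cast Int.floor_intCast (n + 1)
    have e1 : t - n * A.period = A.period := by rw [h]; ring
    have e2 : t - ((n + 1 : ℤ) : ℝ) * A.period = 0 := by rw [h]; push_cast; ring
    rw [orbit, hf, e1, e2, A.curve_zero, A.curve_period]
  · have hf : ⌊t / A.period⌋ = n := by
      rw [Int.floor_eq_iff]
      exact ⟨(le_div_iff₀ hT).2 h0, (div_lt_iff₀ hT).2 h⟩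
    rw [orbit, hf]

theorem orbit_of_mem {t : ℝ} (ht : t ∈ Icc 0 A.period) : A.orbit t = A.curve t := by
  have := A.orbit_eq 0 (t := t) (by simpa using ht.1) (by simpa using ht.2)
  simpa using this

theorem periodic_orbit : Function.Periodic A.orbit A.period := by
  intro t
  have hT := A.period_pos
  have hf : ⌊(t + A.period) / A.period⌋ = ⌊t / A.period⌋ + 1 := by
    rw [add_div, div_self hT.ne', Int.floor_add_one]
  rw [orbit, orbit, hf]
  congr 1
  push_cast
  ring

theorem isCrossingSolution_orbit :
    IsCrossingSolution (fieldPlus p quadF ε) (fieldMinus p quadF ε) A.orbit := by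
  intro t
  set T := A.period with hTdef
  have hT : 0 < T := A.period_pos
  set n := ⌊t / T⌋ with hn
  have hn0 : n * T ≤ t := (le_div_iff₀ hT).1 (Int.floor_le _)
  have hn1 : t < (n + 1) * T := (div_lt_iff₀ hT).1 (Int.lt_floor_add_one _)
  have hφt : A.orbit t = A.curve (t - n * T) := A.orbit_eq n hn0 hn1.le
  have hτ₁ := A.τ₁_pos
  have hτ₂ := A.τ₂_pos
  have hTe : T = A.τ₁ + A.τ₂ := rfl
  have dU : ∀ a, t - a ∈ Icc 0 A.τ₁ →
      HasDerivAt (fun s => A.c₁ (s - a)) (fieldPlus p quadF ε (A.c₁ (t - a))) t := by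
    intro a ha
    rw [fieldPlus_eq]
    exact (A.up.deriv _ ha).comp_sub_const t a
  have dL : ∀ a, t - a ∈ Icc 0 A.τ₂ → HasDerivAt (fun s => rotHalf (A.c₂ (s - a)))
      (fieldMinus p quadF ε (rotHalf (A.c₂ (t - a)))) t := by
    intro a ha
    rw [fieldMinus_eq, rotHalf_rotHalf]
    exact rotHalf.hasFDerivAt.comp_hasDerivAt t ((A.low.deriv _ ha).comp_sub_const t a)
  have eU : ∀ s, n * T ≤ s → s ≤ n * T + A.τ₁ → A.orbit s = A.c₁ (s - n * T) := by
    intro s h1 h2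
    rw [A.orbit_eq n h1 (by linarith), A.curve_upper (by linarith)]
  have eL : ∀ s, n * T + A.τ₁ ≤ s → s ≤ (n + 1) * T →
      A.orbit s = rotHalf (A.c₂ (s - (n * T + A.τ₁))) := by
    intro s h1 h2
    rw [A.orbit_eq n (by linarith) h2, A.curve_lower (by linarith)]
    congr 2; ring
  rcases eq_or_lt_of_le hn0 with h0 | h0
  · -- the upward crossing
    have hval : A.orbit t = (r, 0, 2 * r ^ 2 + ζ) := by
      rw [hφt, ← h0, sub_self, A.curve_zero]
    refine ⟨fun h => ?_, fun h => ?_, fun _ => Or.inl ⟨?_, ?_, ?_, ?_⟩⟩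
    · rw [hval] at h; exact absurd h (lt_irrefl _)
    · rw [hval] at h; exact absurd h (lt_irrefl _)
    · rw [hval, fieldPlus_snd]; exact A.pos
    · rw [hval, fieldMinus_eq]
      have := A.cross'
      simpa using this
    -- To the left of an upward crossing the orbit is the lower half orbit of the preceding period,
    -- hence the index `n - 1`.
    · have h2 : t - (t - A.τ₂) = A.τ₂ := by ring
      have h1 := dL (t - A.τ₂) (by rw [h2]; exact ⟨hτ₂.le, le_rfl⟩)
      have hv : rotHalf (A.c₂ (t - (t - A.τ₂))) = A.orbit t := by
        rw [h2, A.low.finish, hval]; simp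
      rw [hv] at h1
      refine h1.hasDerivWithinAt.congr_of_eventuallyEq ?_ hv.symm
      have : Ioc (t - A.τ₂) t ∈ 𝓝[≤] t := Ioc_mem_nhdsLE (by linarith)
      filter_upwards [this] with s hs
      have hc : ((n - 1 : ℤ) : ℝ) = n - 1 := by push_cast; ring
      rw [A.orbit_eq (n - 1) (by rw [hc, ← hTdef]; linarith [hs.1])
        (by rw [hc, ← hTdef]; linarith [hs.2]), A.curve_lower (by rw [hc, ← hTdef]; linarith [hs.1])]
      congr 2
      rw [hc, ← hTdef]; linarith
    · have h1 := dU (n * T) (by rw [h0, sub_self]; exact ⟨le_rfl, hτ₁.le⟩)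
      rw [← eU t hn0 (by linarith)] at h1
      refine h1.hasDerivWithinAt.congr_of_eventuallyEq ?_ (eU t hn0 (by linarith))
      have : Ico t (t + A.τ₁) ∈ 𝓝[≥] t := Ico_mem_nhdsGE (by linarith)
      filter_upwards [this] with s hs
      exact eU s (by linarith [hs.1]) (by linarith [hs.2])
  rcases lt_trichotomy t (n * T + A.τ₁) with h1 | h1 | h1
  · -- inside the upper half
    have hy : 0 < (A.orbit t).2.1 := by
      rw [hφt]; exact A.curve_pos (by linarith) (by linarith)
    refine ⟨fun _ => ?_, fun h => absurd h hy.not_gt, fun h => absurd h hy.ne'⟩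
    have h2 := dU (n * T) ⟨by linarith, by linarith⟩
    rw [← eU t hn0 h1.le] at h2
    refine h2.congr_of_eventuallyEq ?_
    filter_upwards [Ioo_mem_nhds h0 h1] with s hs
    exact eU s hs.1.le hs.2.le
  · -- the downward crossing
    have hval : A.orbit t = (-A.r₁, 0, 2 * A.r₁ ^ 2 + A.ζ₁) := by
      rw [hφt, ← A.curve_mid]; congr 1; linarith
    refine ⟨fun h => ?_, fun h => ?_, fun _ => Or.inr ⟨?_, ?_, ?_, ?_⟩⟩
    · rw [hval] at h; exact absurd h (lt_irrefl _)
    · rw [hval] at h; exact absurd h (lt_irrefl _)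
    · rw [hval, fieldPlus_snd]; simpa using A.pos₁
    · rw [hval, fieldMinus_eq]
      have := A.cross₁
      simpa using this
    · have h2 := dU (n * T) ⟨by linarith, by linarith⟩
      rw [← eU t hn0 h1.le] at h2
      refine h2.hasDerivWithinAt.congr_of_eventuallyEq ?_ (eU t hn0 h1.le)
      have : Ioc (t - A.τ₁) t ∈ 𝓝[≤] t := Ioc_mem_nhdsLE (by linarith)
      filter_upwards [this] with s hs
      exact eU s (by linarith [hs.1]) (by linarith [hs.2])
    · have h2 := dL (n * T + A.τ₁) ⟨by linarith, by linarith⟩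
      rw [← eL t h1.ge hn1.le] at h2
      refine h2.hasDerivWithinAt.congr_of_eventuallyEq ?_ (eL t h1.ge hn1.le)
      have : Ico t (t + A.τ₂) ∈ 𝓝[≥] t := Ico_mem_nhdsGE (by linarith)
      filter_upwards [this] with s hs
      exact eL s (by linarith [hs.1]) (by linarith [hs.2])
  · -- inside the lower half
    have hy : (A.orbit t).2.1 < 0 := by
      rw [hφt]; exact A.curve_neg (by linarith) (by linarith)
    refine ⟨fun h => absurd h hy.not_gt, fun _ => ?_, fun h => absurd h hy.ne⟩
    have h2 := dL (n * T + A.τ₁) ⟨by linarith, by linarith⟩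
    rw [← eL t h1.le hn1.le] at h2
    refine h2.congr_of_eventuallyEq ?_
    filter_upwards [Ioo_mem_nhds h1 hn1] with s hs
    exact eL s hs.1.le hs.2.le

/-- A shorter period would bring the orbit back to its starting point, a section point with `x > 0`,
strictly inside a turn. -/
theorem isPeriodicSolution_orbit :
    IsPeriodicSolution (fieldPlus p quadF ε) (fieldMinus p quadF ε) A.orbit A.period := by
  refine ⟨A.isCrossingSolution_orbit, A.period_pos, A.periodic_orbit, fun S hS hST hper => ?_⟩
  have h1 : A.orbit S = A.orbit 0 := by simpa using hper 0
  rw [A.orbit_of_mem ⟨hS.le, hST.le⟩, A.orbit_of_mem ⟨le_rfl, A.period_pos.le⟩, A.curve_zero] at h1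
  have h2 := A.not_section hS hST (by rw [h1])
  rw [h1] at h2
  exact absurd h2 A.pos.not_gt

/-- A periodic crossing solution through the initial point of a closed turn has the same range. -/
theorem range_eq {ψ : ℝ → ℝ × ℝ × ℝ} {S t₀ : ℝ}
    (hψ : IsPeriodicSolution (fieldPlus p quadF ε) (fieldMinus p quadF ε) ψ S)
    (h0 : ψ t₀ = (r, 0, 2 * r ^ 2 + ζ)) : range ψ = range A.orbit := by
  obtain ⟨hc, hS, hper, -⟩ := hψ
  have hT := A.period_pos
  have hk : ∀ k : ℕ, ψ (t₀ + k * A.period) = (r, 0, 2 * r ^ 2 + ζ) := by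
    intro k
    induction k with
    | zero => simpa using h0
    | succ k ih =>
      have := A.follow_period hc ih
      rw [← this]; congr 1; push_cast; ring
  have key : ∀ t, 0 ≤ t → ψ (t₀ + t) = A.orbit t := by
    intro t ht
    set k := ⌊t / A.period⌋₊
    have h1 : k * A.period ≤ t := (le_div_iff₀ hT).1 (Nat.floor_le (by positivity))
    have h2 : t < (k + 1) * A.period := (div_lt_iff₀ hT).1 (Nat.lt_floor_add_one _)
    have h3 := A.follow hc (hk k) (t - k * A.period) ⟨by linarith, by linarith⟩
    have h4 := A.orbit_eq (k : ℤ) (t := t) (by exact_mod_cast h1) (by exact_mod_cast h2.le)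
    rw [Int.cast_natCast] at h4
    rw [h4, ← h3]; congr 1; ring
  apply Subset.antisymm
  · rintro _ ⟨s, rfl⟩
    -- Agreement is known only in forward time from `t₀`; periodicity moves earlier times forward.
    obtain ⟨m, hm⟩ := exists_nat_gt ((t₀ - s) / S)
    rw [div_lt_iff₀ hS] at hm
    refine ⟨s + m * S - t₀, ?_⟩
    rw [← key _ (by linarith), add_sub_cancel]
    exact (hper.nat_mul m) s
  · rintro _ ⟨s, rfl⟩
    obtain ⟨m, hm⟩ := exists_nat_gt ((0 - s) / A.period)
    rw [div_lt_iff₀ hT] at hm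
    refine ⟨t₀ + (s + m * A.period), ?_⟩
    rw [key _ (by linarith)]
    exact (A.periodic_orbit.nat_mul m) s

end Turn

/-! ### Periodic solutions in a tube around the circle. -/

/-- The annular tube around the circle of radius `ρ` on the paraboloid. -/
def tube (ρ κ : ℝ) : Set (ℝ × ℝ × ℝ) :=
  {q | |Real.sqrt (q.1 ^ 2 + q.2.1 ^ 2) - ρ| < κ ∧ |q.2.2 - quadF q.1 q.2.1| < κ}

theorem isOpen_tube (ρ κ : ℝ) : IsOpen (tube ρ κ) := by
  have h1 : Continuous fun q : ℝ × ℝ × ℝ => |Real.sqrt (q.1 ^ 2 + q.2.1 ^ 2) - ρ| := by fun_prop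
  have h2 : Continuous fun q : ℝ × ℝ × ℝ => |q.2.2 - quadF q.1 q.2.1| := by
    unfold quadF; fun_prop
  exact (isOpen_lt h1 continuous_const).inter (isOpen_lt h2 continuous_const)

theorem rotHalf_mem_tube {ρ κ : ℝ} {q : ℝ × ℝ × ℝ} (hq : q ∈ tube ρ κ) : rotHalf q ∈ tube ρ κ := by
  simpa [tube, quadF] using hq

theorem circ_mem_tube {ρ κ : ℝ} (hρ : 0 < ρ) (hκ : 0 < κ) (t : ℝ) :
    HalfParams.circ ρ t ∈ tube ρ κ := by
  have h : (ρ * Real.cos t) ^ 2 + (ρ * Real.sin t) ^ 2 = ρ ^ 2 := by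
    linear_combination ρ ^ 2 * Real.sin_sq_add_cos_sq t
  simp only [tube, HalfParams.circ, mem_ofPred_eq, h, Real.sqrt_sq hρ.le, sub_self, abs_zero]
  exact ⟨hκ, hκ⟩

theorem section_of_mem_tube {ρ κ : ℝ} {q : ℝ × ℝ × ℝ} (hq : q ∈ tube ρ κ) (hy : q.2.1 = 0)
    (hx : 0 < q.1) : |q.1 - ρ| < κ ∧ |q.2.2 - 2 * q.1 ^ 2| < κ ∧
      q = (q.1, 0, 2 * q.1 ^ 2 + (q.2.2 - 2 * q.1 ^ 2)) := by
  obtain ⟨x, y, z⟩ := q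
  simp only at hy hx
  subst hy
  simp only [tube, quadF, mem_ofPred_eq] at hq
  have h1 : x ^ 2 + 0 ^ 2 = x ^ 2 := by ring
  have h2 : z - (2 * x ^ 2 - 0 ^ 2) = z - 2 * x ^ 2 := by ring
  rw [h1, h2, Real.sqrt_sq hx.le] at hq
  exact ⟨hq.1, hq.2, by simp⟩

/-- A periodic solution that rotates cannot stay in `y > 0`. -/
theorem not_periodic_of_pos {P : HalfParams} {ε S : ℝ} {ψ : ℝ → ℝ × ℝ × ℝ} (hS : 0 < S)
    (hper : Function.Periodic ψ S) (hpos : ∀ t, 0 < (ψ t).2.1)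
    (hd : ∀ t, HasDerivAt ψ (P.field ε (ψ t)) t)
    (hrot : ∀ t, ε * (P.pert1 ε (ψ t).2.2 * (ψ t).2.1 - P.pert2 ε (ψ t).2.2 * (ψ t).1)
      < (ψ t).1 ^ 2 + (ψ t).2.1 ^ 2) : False := by
  have hq : ∀ t, HasDerivAt (fun t => (ψ t).1 / (ψ t).2.1)
      (((P.field ε (ψ t)).1 * (ψ t).2.1 - (ψ t).1 * (P.field ε (ψ t)).2.1) / (ψ t).2.1 ^ 2) t :=
    fun t => by
      have h1 : HasDerivAt (fun t => (ψ t).1) (P.field ε (ψ t)).1 t := (hd t).fst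
      have h2 : HasDerivAt (fun t => (ψ t).2.1) (P.field ε (ψ t)).2.1 t := (hd t).snd.fst
      exact h1.div h2 (hpos t).ne'
  -- `x / y` is the cotangent of the polar angle, and the angle increases strictly.
  have hanti : StrictAnti fun t => (ψ t).1 / (ψ t).2.1 := by
    refine strictAnti_of_deriv_neg fun t => ?_
    rw [(hq t).deriv]
    refine div_neg_of_neg_of_pos ?_ (pow_pos (hpos t) 2)
    have := hrot t
    simp only [HalfParams.field]
    linarith
  have h1 := hanti hS
  have h2 : ψ S = ψ 0 := by simpa using hper 0
  simp only [h2] at h1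
  exact lt_irrefl _ h1

/-- Every periodic solution in the tube meets the switching plane. -/
theorem exists_mem_plane {p : Params} {ε S ρ κ : ℝ} {ψ : ℝ → ℝ × ℝ × ℝ}
    (hψ : IsPeriodicSolution (fieldPlus p quadF ε) (fieldMinus p quadF ε) ψ S)
    (hU : range ψ ⊆ tube ρ κ)
    (hrot : ∀ P ∈ ({upper p, lower p} : Set HalfParams), ∀ q ∈ tube ρ κ,
      ε * (P.pert1 ε q.2.2 * q.2.1 - P.pert2 ε q.2.2 * q.1) < q.1 ^ 2 + q.2.1 ^ 2) :
    ∃ t, (ψ t).2.1 = 0 := by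
  obtain ⟨hc, hS, hper, -⟩ := hψ
  have hcont : Continuous fun t => (ψ t).2.1 := by have := hc.continuous; fun_prop
  by_contra! hne
  have hmem : ∀ t, ψ t ∈ tube ρ κ := fun t => hU (mem_range_self t)
  by_cases hall : ∀ t, 0 < (ψ t).2.1
  · refine not_periodic_of_pos (P := upper p) (ε := ε) hS hper hall (fun t => ?_) fun t => ?_
    · rw [← fieldPlus_eq]; exact (hc t).1 (hall t)
    · exact hrot _ (by simp) _ (hmem t)
  · push Not at hall
    obtain ⟨t₁, ht₁⟩ := hall
    have hneg : ∀ t, (ψ t).2.1 < 0 := by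
      intro t
      by_contra! ht
      obtain ⟨s, hs⟩ := mem_range_of_exists_le_of_exists_ge hcont ⟨t₁, ht₁⟩ ⟨t, ht⟩
      exact hne s hs
    refine not_periodic_of_pos (P := lower p) (ε := ε) (ψ := fun t => rotHalf (ψ t)) hS
      (fun t => by simp only [hper t]) (fun t => by simpa using hneg t) (fun t => ?_) fun t => ?_
    · have h1 := rotHalf.hasFDerivAt.comp_hasDerivAt t ((hc t).2.1 (hneg t))
      rw [fieldMinus_eq, rotHalf_rotHalf] at h1
      exact h1
    · exact hrot _ (by simp) _ (rotHalf_mem_tube (hmem t))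

/-- Periodic solutions in the tube pass through the only periodic point of the return map. -/
theorem exists_section_eq {p : Params} {ε S ρ κ K r ζ : ℝ} {ψ : ℝ → ℝ × ℝ × ℝ} {F G : ℝ → ℝ → ℝ}
    (hψ : IsPeriodicSolution (fieldPlus p quadF ε) (fieldMinus p quadF ε) ψ S)
    (hU : range ψ ⊆ tube ρ κ)
    (hrot : ∀ P ∈ ({upper p, lower p} : Set HalfParams), ∀ q ∈ tube ρ κ,
      ε * (P.pert1 ε q.2.2 * q.2.1 - P.pert2 ε q.2.2 * q.1) < q.1 ^ 2 + q.2.1 ^ 2)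
    (hκ : κ < ρ)
    (hturn : ∀ r ζ, |r - ρ| < κ → |ζ| < κ → Nonempty (Turn p ρ K ε r ζ (F r ζ) (G r ζ)))
    (hlow : ∀ r ζ, |r - ρ| < κ → |ζ| < κ → ∃ r' ζ' τ c, 0 < r' ∧
      (lower p).IsHalfOrbit ρ K ε r ζ r' ζ' τ c)
    (hiso : ∀ (R Z : ℕ → ℝ) (n : ℕ), 0 < n → (∀ k, |R k - ρ| < κ ∧ |Z k| < κ) →
      (∀ k, R (k + 1) = F (R k) (Z k) ∧ Z (k + 1) = G (R k) (Z k)) →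
      R n = R 0 → Z n = Z 0 → R 0 = r ∧ Z 0 = ζ) :
    ∃ t, ψ t = (r, 0, 2 * r ^ 2 + ζ) := by
  have hmem : ∀ t, ψ t ∈ tube ρ κ := fun t => hU (mem_range_self t)
  have hstart := exists_mem_plane hψ hU hrot
  obtain ⟨hc, hS, hper, -⟩ := hψ
  -- Since `κ < ρ`, the tube avoids the axis, so a point on the plane has `x ≠ 0`. If `x < 0`,
  -- following the lower half orbit leads to an upward crossing.
  obtain ⟨t₀, hy₀, hx₀⟩ : ∃ t, (ψ t).2.1 = 0 ∧ 0 < (ψ t).1 := by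
    obtain ⟨t, ht⟩ := hstart
    have hne : (ψ t).1 ≠ 0 := by
      intro h0
      have := (hmem t).1
      rw [h0, ht] at this
      simp only [ne_eq, OfNat.ofNat_ne_zero, not_false_eq_true, zero_pow, add_zero,
        Real.sqrt_zero, zero_sub, abs_neg] at this
      exact absurd (le_abs_self ρ) (by linarith)
    rcases lt_or_gt_of_ne hne with h | h
    · have h1 := section_of_mem_tube (rotHalf_mem_tube (hmem t)) (by simp [ht]) (by simpa using h)
      obtain ⟨r', ζ', τ, c, hr', hh⟩ := hlow _ _ h1.1 h1.2.1
      have h2 : ψ t = (-(rotHalf (ψ t)).1, 0, 2 * (rotHalf (ψ t)).1 ^ 2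
          + ((rotHalf (ψ t)).2.2 - 2 * (rotHalf (ψ t)).1 ^ 2)) := by
        conv_lhs => rw [← rotHalf_rotHalf (ψ t), h1.2.2]
        simp
      have h3 := follow_lower hc hh (by simpa using h) h2 τ
        ⟨zero_le_one.trans hh.one_le, le_rfl⟩
      refine ⟨t + τ, ?_⟩
      rw [h3, hh.finish]
      simpa using hr'
    · exact ⟨t, ht, h⟩
  have hnext : ∀ t, ((ψ t).2.1 = 0 ∧ 0 < (ψ t).1) → ∃ t', t + 2 ≤ t' ∧
      ((ψ t').2.1 = 0 ∧ 0 < (ψ t').1) ∧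
      (ψ t').1 = F (ψ t).1 ((ψ t).2.2 - 2 * (ψ t).1 ^ 2) ∧
      (ψ t').2.2 - 2 * (ψ t').1 ^ 2 = G (ψ t).1 ((ψ t).2.2 - 2 * (ψ t).1 ^ 2) ∧
      ∀ s, t < s → s < t' → ¬ ((ψ s).2.1 = 0 ∧ 0 < (ψ s).1) := by
    rintro t ⟨hy, hx⟩
    obtain ⟨h1, h2, h3⟩ := section_of_mem_tube (hmem t) hy hx
    obtain ⟨A⟩ := hturn _ _ h1 h2
    have h4 := A.follow_period hc h3
    refine ⟨t + A.period, by linarith [A.two_le_period], ?_, ?_, ?_, ?_⟩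
    · rw [h4]; exact ⟨rfl, A.pos'⟩
    · rw [h4]
    · rw [h4]; ring
    · rintro s hs1 hs2 ⟨hsy, hsx⟩
      have h5 := A.follow hc h3 (s - t) ⟨by linarith, by linarith⟩
      rw [add_sub_cancel] at h5
      rw [h5] at hsy hsx
      exact absurd (A.not_section (by linarith) (by linarith) hsy) hsx.not_gt
  choose! next hn1 hn2 hn3 hn4 hn5 using hnext
  let T : ℕ → ℝ := fun k => next^[k] t₀
  have hTs : ∀ k, T (k + 1) = next (T k) := fun k => Function.iterate_succ_apply' _ _ _
  have hsec : ∀ k, (ψ (T k)).2.1 = 0 ∧ 0 < (ψ (T k)).1 := by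
    intro k
    induction k with
    | zero => exact ⟨hy₀, hx₀⟩
    | succ k ih => rw [hTs]; exact hn2 _ ih
  have hgrow : ∀ k : ℕ, t₀ + 2 * k ≤ T k := by
    intro k
    induction k with
    | zero => simp [T]
    | succ k ih =>
      have := hn1 _ (hsec k)
      rw [hTs]; push_cast; linarith
  have hexists : ∃ k, t₀ + S ≤ T k := by
    obtain ⟨k, hk⟩ := exists_nat_gt S
    exact ⟨k, by have := hgrow k; have : (0 : ℝ) ≤ k := Nat.cast_nonneg k; linarith⟩
  classical
  -- The section times grow by at least `2` per turn, so a first one reaches `t₀ + S`.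
  obtain ⟨n, hn, hmin⟩ : ∃ n, t₀ + S ≤ T n ∧ ∀ m < n, T m < t₀ + S :=
    ⟨Nat.find hexists, Nat.find_spec hexists, fun m hm => not_le.1 (Nat.find_min hexists hm)⟩
  have hn0 : 0 < n := by
    rcases Nat.eq_zero_or_pos n with h | h
    · subst h
      have : t₀ + S ≤ t₀ := hn
      linarith
    · exact h
  have hψS : ψ (t₀ + S) = ψ t₀ := hper t₀
  -- The point at `t₀ + S` is itself on the section, and no section point lies strictly between
  -- consecutive section times. Thus the sequence of crossings closes after exactly `n` turns.
  have hTn : T n = t₀ + S := by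
    obtain ⟨m, rfl⟩ : ∃ m, n = m + 1 := ⟨n - 1, by omega⟩
    rcases eq_or_lt_of_le hn with h | h
    · exact h.symm
    · exfalso
      rw [hTs] at h
      refine hn5 (T m) (hsec m) (t₀ + S) (hmin m (Nat.lt_succ_self m)) h ?_
      rw [hψS]; exact ⟨hy₀, hx₀⟩
  have hbox := fun k => section_of_mem_tube (hmem (T k)) (hsec k).1 (hsec k).2
  have hres := hiso (fun k => (ψ (T k)).1) (fun k => (ψ (T k)).2.2 - 2 * (ψ (T k)).1 ^ 2) n hn0
    (fun k => ⟨(hbox k).1, (hbox k).2.1⟩)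
    (fun k => by simp only [hTs]; exact ⟨hn3 _ (hsec k), hn4 _ (hsec k)⟩)
    (by simp only [hTn, hψS]; rfl) (by simp only [hTn, hψS]; rfl)
  refine ⟨T 0, ?_⟩
  rw [(hbox 0).2.2]
  rw [hres.2, hres.1]

theorem norm_rotHalf (q : ℝ × ℝ × ℝ) : ‖rotHalf q‖ = ‖q‖ := by
  simp [Prod.norm_def]

theorem rotHalf_circ (ρ t : ℝ) : rotHalf (HalfParams.circ ρ t) = HalfParams.circ ρ (t + Real.pi) := by
  simp [HalfParams.circ, quadF, Real.cos_add_pi, Real.sin_add_pi]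

theorem circ_lipschitz {ρ : ℝ} (hρ : 0 < ρ) (s t : ℝ) :
    ‖HalfParams.circ ρ s - HalfParams.circ ρ t‖ ≤ (ρ + 6 * ρ ^ 2) * |s - t| := by
  have hc := Real.abs_cos_sub_cos_le s t
  have hs := Real.abs_sin_sub_sin_le s t
  have h0 := abs_nonneg (s - t)
  have hsq : ∀ a b : ℝ, |a| ≤ 1 → |b| ≤ 1 → |a - b| ≤ |s - t| → |a ^ 2 - b ^ 2| ≤ 2 * |s - t| := by
    intro a b ha hb hab
    have h1 : a ^ 2 - b ^ 2 = (a + b) * (a - b) := by ring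
    rw [h1, abs_mul]
    exact mul_le_mul ((abs_add_le _ _).trans (by linarith)) hab (abs_nonneg _) (by norm_num)
  have h1 := hsq _ _ (Real.abs_cos_le_one s) (Real.abs_cos_le_one t) hc
  have h2 := hsq _ _ (Real.abs_sin_le_one s) (Real.abs_sin_le_one t) hs
  have hρ2 : 0 ≤ 6 * ρ ^ 2 * |s - t| := by positivity
  have hρ1 : 0 ≤ ρ * |s - t| := by positivity
  rw [Prod.norm_def, Prod.norm_def]
  refine max_le ?_ (max_le ?_ ?_)
  · have : (HalfParams.circ ρ s - HalfParams.circ ρ t).1 = ρ * (Real.cos s - Real.cos t) := by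
      simp [HalfParams.circ]; ring
    rw [this, Real.norm_eq_abs, abs_mul, abs_of_pos hρ]
    have := mul_le_mul_of_nonneg_left hc hρ.le
    linarith
  · have : (HalfParams.circ ρ s - HalfParams.circ ρ t).2.1 = ρ * (Real.sin s - Real.sin t) := by
      simp [HalfParams.circ]; ring
    rw [this, Real.norm_eq_abs, abs_mul, abs_of_pos hρ]
    have := mul_le_mul_of_nonneg_left hs hρ.le
    linarith
  · have : (HalfParams.circ ρ s - HalfParams.circ ρ t).2.2
        = ρ ^ 2 * (2 * (Real.cos s ^ 2 - Real.cos t ^ 2) - (Real.sin s ^ 2 - Real.sin t ^ 2)) := by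
      simp [HalfParams.circ, quadF]; ring
    rw [this, Real.norm_eq_abs, abs_mul, abs_of_nonneg (sq_nonneg ρ)]
    have h3 : |2 * (Real.cos s ^ 2 - Real.cos t ^ 2) - (Real.sin s ^ 2 - Real.sin t ^ 2)|
        ≤ 6 * |s - t| := by
      refine (abs_sub _ _).trans ?_
      rw [abs_mul, abs_two]
      linarith
    have := mul_le_mul_of_nonneg_left h3 (sq_nonneg ρ)
    linarith

theorem Turn.period_close {p : Params} {ρ K ε r ζ r' ζ' : ℝ} (A : Turn p ρ K ε r ζ r' ζ') :
    |A.period - 2 * Real.pi| ≤ 2 * K * |ε| := by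
  have h1 : A.period - 2 * Real.pi = (A.τ₁ - Real.pi) + (A.τ₂ - Real.pi) := by
    unfold Turn.period; ring
  rw [h1]
  refine (abs_add_le _ _).trans ?_
  linarith [A.up.time, A.low.time]

/-- The lower half orbit starts at time `τ₁` instead of `π`; this phase error of at most `K |ε|` is
multiplied by the Lipschitz constant `ρ + 6 ρ²` of the circle. -/
theorem Turn.curve_close {p : Params} {ρ K ε r ζ r' ζ' M : ℝ} (A : Turn p ρ K ε r ζ r' ζ')
    (hρ : 0 < ρ) (hM : K * (|r - ρ| + |ζ| + |ε|) ≤ M * |ε|)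
    (hM₁ : K * (|A.r₁ - ρ| + |A.ζ₁| + |ε|) + (ρ + 6 * ρ ^ 2) * (K * |ε|) ≤ M * |ε|)
    {t : ℝ} (ht : t ∈ Icc 0 A.period) : ‖A.curve t - HalfParams.circ ρ t‖ ≤ M * |ε| := by
  rcases le_total t A.τ₁ with h | h
  · rw [A.curve_upper h]
    exact (A.up.close t ⟨ht.1, h⟩).trans hM
  · rw [A.curve_lower h]
    have h1 := A.low.close (t - A.τ₁)
      ⟨by linarith, by have := ht.2; unfold Turn.period at this; linarith⟩
    have h2 := circ_lipschitz hρ (t - A.τ₁ + Real.pi) t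
    have h3 : |t - A.τ₁ + Real.pi - t| ≤ K * |ε| := by
      have : t - A.τ₁ + Real.pi - t = -(A.τ₁ - Real.pi) := by ring
      rw [this, abs_neg]; exact A.up.time
    rw [← rotHalf_circ] at h2
    have h4 : rotHalf (A.c₂ (t - A.τ₁)) - HalfParams.circ ρ t
        = rotHalf (A.c₂ (t - A.τ₁) - HalfParams.circ ρ (t - A.τ₁))
          + (rotHalf (HalfParams.circ ρ (t - A.τ₁)) - HalfParams.circ ρ t) := by
      rw [map_sub]; abel
    rw [h4]
    refine (norm_add_le _ _).trans ?_
    rw [norm_rotHalf]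
    have h5 : (ρ + 6 * ρ ^ 2) * |t - A.τ₁ + Real.pi - t| ≤ (ρ + 6 * ρ ^ 2) * (K * |ε|) := by gcongr
    linarith

/-- In a bounded tube, small perturbations do not affect the sense of rotation. -/
theorem eventually_rotates (P : HalfParams) {ρ κ : ℝ} (hκ : κ < ρ) :
    ∀ᶠ ε in 𝓝 (0 : ℝ), ∀ q ∈ tube ρ κ,
      ε * (P.pert1 ε q.2.2 * q.2.1 - P.pert2 ε q.2.2 * q.1) < q.1 ^ 2 + q.2.1 ^ 2 := by
  -- `M` bounds `|x|`, `|y|` and `|z|` on the tube, so that compactness bounds the perturbation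
  -- there.
  set M := 3 * (ρ + κ) ^ 2 + (ρ + κ) + κ with hM
  let Q : Set (ℝ × ℝ × ℝ × ℝ) := Icc (-1) 1 ×ˢ Icc (-M) M ×ˢ Icc (-M) M ×ˢ Icc (-M) M
  have hQ : IsCompact Q := isCompact_Icc.prod (isCompact_Icc.prod (isCompact_Icc.prod isCompact_Icc))
  have hcont : Continuous fun w : ℝ × ℝ × ℝ × ℝ =>
      P.pert1 w.1 w.2.2.2 * w.2.2.1 - P.pert2 w.1 w.2.2.2 * w.2.1 := by
    unfold HalfParams.pert1 HalfParams.pert2; fun_prop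
  obtain ⟨C, hC⟩ := hQ.exists_bound_of_continuousOn hcont.continuousOn
  have h1 : ∀ᶠ ε in 𝓝 (0 : ℝ), |ε| * |C| < (ρ - κ) ^ 2 :=
    Filter.Tendsto.eventually_lt_const (pow_pos (sub_pos.2 hκ) 2)
      (Continuous.tendsto' (by fun_prop) 0 0 (by simp))
  have h2 : ∀ᶠ ε in 𝓝 (0 : ℝ), |ε| < 1 :=
    Filter.Tendsto.eventually_lt_const one_pos (Continuous.tendsto' (by fun_prop) 0 0 (by simp))
  filter_upwards [h1, h2] with ε hε1 hε2
  rintro ⟨x, y, z⟩ ⟨hr, hz⟩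
  simp only at hr hz ⊢
  have hκ0 : 0 < κ := lt_of_le_of_lt (abs_nonneg _) hr
  set s := Real.sqrt (x ^ 2 + y ^ 2) with hs
  have hs2 : s ^ 2 = x ^ 2 + y ^ 2 := Real.sq_sqrt (by positivity)
  have hr' := abs_lt.1 hr
  have hs0 : 0 ≤ s := Real.sqrt_nonneg _
  have hsM : s ^ 2 ≤ (ρ + κ) ^ 2 := by gcongr; linarith
  have hsm : (ρ - κ) ^ 2 < s ^ 2 := by gcongr; linarith
  have hx : |x| ≤ ρ + κ := abs_le_of_sq_le_sq (by nlinarith [sq_nonneg y]) (by linarith)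
  have hy : |y| ≤ ρ + κ := abs_le_of_sq_le_sq (by nlinarith [sq_nonneg x]) (by linarith)
  have hsqp : 0 ≤ (ρ + κ) ^ 2 := sq_nonneg _
  have hx' := abs_le.1 hx
  have hy' := abs_le.1 hy
  have hz' := abs_lt.1 hz
  unfold quadF at hz'
  have hmem : (ε, x, y, z) ∈ Q := by
    refine ⟨⟨(abs_lt.1 hε2).1.le, (abs_lt.1 hε2).2.le⟩, ⟨?_, ?_⟩, ⟨?_, ?_⟩, ⟨?_, ?_⟩⟩ <;>
      simp only <;> nlinarith [sq_nonneg x, sq_nonneg y]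
  have h3 := hC _ hmem
  simp only [Real.norm_eq_abs] at h3
  calc _ ≤ |ε * (P.pert1 ε z * y - P.pert2 ε z * x)| := le_abs_self _
    _ = |ε| * |P.pert1 ε z * y - P.pert2 ε z * x| := abs_mul _ _
    _ ≤ |ε| * |C| := mul_le_mul_of_nonneg_left (h3.trans (le_abs_self C)) (abs_nonneg ε)
    _ < _ := hε1.trans (by rwa [hs2] at hsm)

theorem HalfParams.IsHalfOrbit.mono {P : HalfParams} {ρ K K' ε r ζ r' ζ' τ : ℝ}
    {c : ℝ → ℝ × ℝ × ℝ} (h : P.IsHalfOrbit ρ K ε r ζ r' ζ' τ c) (hK : K ≤ K') :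
    P.IsHalfOrbit ρ K' ε r ζ r' ζ' τ c :=
  { h with
    time := h.time.trans (by gcongr)
    close := fun t ht => (h.close t ht).trans (by gcongr) }

/-! ### The return map of the section and the resulting limit cycles. -/

/-- The bifurcation function in terms of the half turns. -/
noncomputable def turnBifurcation (P Q : HalfParams) (k₁ k₂ r : ℝ) : ℝ :=
  (k₁ + k₂ * Real.exp (-Real.pi)) *
      ((Real.exp (-Real.pi) * P.fastShift r + Q.fastShift r) / (1 - Real.exp (-Real.pi) ^ 2))
    + (P.slowDrift₂ r + (k₂ * P.fastShift r + Q.slowDrift₂ r))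

/-- The return map in the coordinates `(r, ζ)` of the section, with its orbits. -/
theorem exists_returnMap (p : Params) {ρ k₁ k₂ : ℝ} (hρ : 0 < ρ)
    (hk₁ : ∀ r ζ, (upper p).slowDrift r ζ = k₁ * ζ)
    (hk₂ : ∀ r ζ, (lower p).slowDrift r ζ = k₂ * ζ) :
    ∃ (A B : ℝ × ℝ × ℝ → ℝ) (K : ℝ), 0 ≤ K ∧
      ContDiffAt ℝ 3 A (ρ, 0, 0) ∧ ContDiffAt ℝ 3 B (ρ, 0, 0) ∧
      (∀ᶠ r in 𝓝 ρ, A (r, 0, 0) = 0) ∧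
      (∀ᶠ r in 𝓝 ρ, HasDerivAt (fun ζ => A (r, ζ, 0)) (k₁ + k₂ * Real.exp (-Real.pi)) 0) ∧
      (∀ᶠ r in 𝓝 ρ, B (r, 0, 0) =
        Real.exp (-Real.pi) * (upper p).fastShift r + (lower p).fastShift r) ∧
      (∀ᶠ r in 𝓝 ρ, HasDerivAt (fun ε => A (r, 0, ε)) ((upper p).slowDrift₂ r
        + (k₂ * (upper p).fastShift r + (lower p).slowDrift₂ r)) 0) ∧
      ∀ᶠ x in 𝓝 (ρ, (0 : ℝ), (0 : ℝ)),
        (∃ T : Turn p ρ K x.2.2 x.1 x.2.1 (x.1 + x.2.2 * A x)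
          (Real.exp (-Real.pi) ^ 2 * x.2.1 + x.2.2 * B x),
          |T.r₁ - ρ| + |T.ζ₁| ≤ |x.1 - ρ| + |x.2.1| + K * |x.2.2|) ∧
        ∃ r' ζ' τ c, 0 < r' ∧ (lower p).IsHalfOrbit ρ K x.2.2 x.1 x.2.1 r' ζ' τ c := by
  obtain ⟨A₁, B₁, T₁, c₁, K₁, hK₁, hA₁, hB₁, hA₁v, hB₁v, hA₁d, ho₁⟩ :=
    (upper p).exists_halfMap hρ
  obtain ⟨A₂, B₂, T₂, c₂, K₂, hK₂, hA₂, hB₂, hA₂v, hB₂v, hA₂d, ho₂⟩ :=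
    (lower p).exists_halfMap hρ
  set μ := Real.exp (-Real.pi) with hμ
  have hμ0 : 0 < μ := Real.exp_pos _
  have hμ1 : μ < 1 := Real.exp_lt_one_iff.2 (by linarith [Real.pi_pos])
  -- `H` is the upper half map with `ε` carried along, so the return map uses `A₁ + A₂ ∘ H` and `μ
  -- B₁ + B₂ ∘ H`.
  let H : ℝ × ℝ × ℝ → ℝ × ℝ × ℝ := fun x =>
    (x.1 + x.2.2 * A₁ x, μ * x.2.1 + x.2.2 * B₁ x, x.2.2)
  have hH : ContDiffAt ℝ 3 H (ρ, 0, 0) := by fun_prop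
  have hH0 : ∀ r, H (r, 0, 0) = (r, 0, 0) := fun r => by simp [H]
  have hHt : Tendsto H (𝓝 (ρ, 0, 0)) (𝓝 (ρ, 0, 0)) := by
    have := hH.continuousAt
    rwa [ContinuousAt, hH0] at this
  have hA₂H : ContDiffAt ℝ 3 (fun x => A₂ (H x)) (ρ, 0, 0) :=
    ContDiffAt.comp (g := A₂) _ (by rwa [hH0]) hH
  have hB₂H : ContDiffAt ℝ 3 (fun x => B₂ (H x)) (ρ, 0, 0) :=
    ContDiffAt.comp (g := B₂) _ (by rwa [hH0]) hH
  have hr00 : Tendsto (fun r : ℝ => (r, (0 : ℝ), (0 : ℝ))) (𝓝 ρ) (𝓝 (ρ, 0, 0)) :=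
    Continuous.tendsto (by fun_prop) ρ
  have hA₁0 : ∀ᶠ r in 𝓝 ρ, A₁ (r, 0, 0) = 0 := by
    filter_upwards [hA₁v] with r hr
    rw [hr.self_of_nhds, hk₁, mul_zero]
  have hA₂0 : ∀ᶠ r in 𝓝 ρ, A₂ (r, 0, 0) = 0 := by
    filter_upwards [hA₂v] with r hr
    rw [hr.self_of_nhds, hk₂, mul_zero]
  set C := |A₁ (ρ, 0, 0)| + |B₁ (ρ, 0, 0)| + 1 with hC
  refine ⟨fun x => A₁ x + A₂ (H x), fun x => μ * B₁ x + B₂ (H x), K₁ + K₂ + C, by positivity,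
    hA₁.add hA₂H, (contDiffAt_const.mul hB₁).add hB₂H, ?_, ?_, ?_, ?_, ?_⟩
  · filter_upwards [hA₁0, hA₂0] with r h1 h2
    rw [hH0, h1, h2, add_zero]
  · filter_upwards [hA₁v, hA₂v] with r h1 h2
    have h3 : Tendsto (fun ζ : ℝ => μ * ζ) (𝓝 0) (𝓝 0) :=
      Continuous.tendsto' (by fun_prop) 0 0 (by simp)
    have h4 : HasDerivAt (fun ζ : ℝ => (k₁ + k₂ * μ) * ζ) (k₁ + k₂ * μ) 0 := by
      simpa using (hasDerivAt_id (0 : ℝ)).const_mul (k₁ + k₂ * μ)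
    refine h4.congr_of_eventuallyEq ?_
    filter_upwards [h1, h3.eventually h2] with ζ h5 h6
    have h7 : H (r, ζ, 0) = (r, μ * ζ, 0) := by simp [H]
    rw [h7, h5, h6, hk₁, hk₂]; ring
  · filter_upwards [hB₁v, hB₂v] with r h1 h2
    rw [hH0, h1, h2]
  · filter_upwards [hA₁d, hA₁0, hA₂v, hA₂d, hB₁v, hA₂0.eventually_nhds,
      hr00.eventually (hA₁.eventually (by simp)), hr00.eventually (hB₁.eventually (by simp)),
      hr00.eventually (hA₂.eventually (by simp))] with r h1 h2 h3 h4 h5 h6 h7 h8 h9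
    refine h1.add ?_
    have hf := (h9.differentiableAt (by norm_num)).hasFDerivAt
    -- In the chain rule for `A₂ ∘ H` the `r` direction contributes nothing, because `A₂` vanishes
    -- on `ζ = ε = 0`; the `ζ` direction contributes `k₂` times the fast shift of the upper half
    -- turn.
    have e1 : fderiv ℝ A₂ (r, 0, 0) (1, 0, 0) = 0 := by
      have h10 : HasDerivAt (fun s : ℝ => (s, (0 : ℝ), (0 : ℝ))) (1, 0, 0) r :=
        (hasDerivAt_id r).prodMk (hasDerivAt_const r (0, 0))
      exact ((hf.comp_hasDerivAt r h10).congr_of_eventuallyEq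
        (h6.mono fun s hs => hs.symm)).unique (hasDerivAt_const r 0)
    have e2 : fderiv ℝ A₂ (r, 0, 0) (0, 1, 0) = k₂ := by
      have h10 : HasDerivAt (fun ζ : ℝ => (r, ζ, (0 : ℝ))) (0, 1, 0) 0 :=
        (hasDerivAt_const 0 r).prodMk ((hasDerivAt_id 0).prodMk (hasDerivAt_const 0 0))
      have h11 : HasDerivAt (fun ζ : ℝ => k₂ * ζ) k₂ 0 := by
        simpa using (hasDerivAt_id (0 : ℝ)).const_mul k₂
      refine (hf.comp_hasDerivAt (0 : ℝ) h10).unique (h11.congr_of_eventuallyEq ?_)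
      filter_upwards [h3] with ζ hζ
      rw [← hk₂ r, ← hζ]; rfl
    have e3 : fderiv ℝ A₂ (r, 0, 0) (0, 0, 1) = (lower p).slowDrift₂ r := by
      have h10 : HasDerivAt (fun ε : ℝ => (r, (0 : ℝ), ε)) (0, 0, 1) 0 :=
        (hasDerivAt_const 0 r).prodMk ((hasDerivAt_const 0 0).prodMk (hasDerivAt_id 0))
      exact (hf.comp_hasDerivAt (0 : ℝ) h10).unique h4
    have hm : ∀ {g : ℝ × ℝ × ℝ → ℝ}, ContDiffAt ℝ 3 g (r, 0, 0) → ∀ a : ℝ,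
        HasDerivAt (fun ε : ℝ => a + ε * g (r, 0, ε)) (g (r, 0, 0)) 0 := by
      intro g hg a
      have h10 : DifferentiableAt ℝ (fun ε : ℝ => g (r, 0, ε)) 0 :=
        DifferentiableAt.comp (g := g) (0 : ℝ) (hg.differentiableAt (by norm_num)) (by fun_prop)
      exact (((hasDerivAt_id (0 : ℝ)).mul h10.hasDerivAt).const_add a).congr_deriv (by simp)
    have hcurve : HasDerivAt (fun ε : ℝ => H (r, 0, ε)) (0, (upper p).fastShift r, 1) 0 := by
      refine HasDerivAt.prodMk ((hm h7 r).congr_deriv h2) (HasDerivAt.prodMk ?_ (hasDerivAt_id 0))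
      exact (hm h8 (μ * 0)).congr_deriv h5
    have hf' : HasFDerivAt A₂ (fderiv ℝ A₂ (r, 0, 0)) (H (r, 0, 0)) := by rwa [hH0]
    refine (hf'.comp_hasDerivAt (0 : ℝ) hcurve).congr_deriv ?_
    have h13 : ((0 : ℝ), (upper p).fastShift r, (1 : ℝ))
        = (upper p).fastShift r • ((0 : ℝ), (1 : ℝ), (0 : ℝ)) + ((0 : ℝ), (0 : ℝ), (1 : ℝ)) := by
      simp
    rw [h13, map_add, map_smul, e2, e3, smul_eq_mul, mul_comm]
  · have hlt : ∀ {G : ℝ × ℝ × ℝ → ℝ}, ContinuousAt G (ρ, 0, 0) → 0 < G (ρ, 0, 0) →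
        ∀ᶠ x in 𝓝 (ρ, (0 : ℝ), (0 : ℝ)), 0 < G x := fun hG h => hG.eventually_const_lt h
    have c1 := hA₁.continuousAt
    have c2 := hA₂.continuousAt
    have c3 := hB₁.continuousAt
    have c4 := hA₂H.continuousAt
    have c5 := hB₂H.continuousAt
    have cH := hH.continuousAt
    have cR : ContinuousAt (fun x => (H x).1 + x.2.2 * A₂ (H x)) (ρ, 0, 0) := by
      have := (continuous_snd.comp continuous_snd : Continuous fun x : ℝ × ℝ × ℝ => x.2.2)
      exact cH.fst.add (this.continuousAt.mul c4)
    have cZ : ContinuousAt (fun x => μ * (H x).2.1 + x.2.2 * B₂ (H x)) (ρ, 0, 0) := by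
      have := (continuous_snd.comp continuous_snd : Continuous fun x : ℝ × ℝ × ℝ => x.2.2)
      exact (continuousAt_const.mul cH.snd.fst).add (this.continuousAt.mul c5)
    have hC0 : 0 ≤ C := by positivity
    have cfield : Continuous fun w : ℝ × ℝ × ℝ × ℝ => ((lower p).field w.1 w.2).2.1 := by
      unfold HalfParams.field HalfParams.pert2; fun_prop
    have g1 := hlt (G := fun x => x.1) (by fun_prop) hρ
    have g2 := hlt (G := fun x => (H x).1) (by fun_prop) (by rw [hH0]; exact hρ)
    have g3 := hlt (G := fun x => (H x).1 + x.2.2 * A₂ (H x)) cR (by simpa [hH0] using hρ)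
    have g4 := hlt (G := fun x => x.1 + x.2.2 * A₂ x) (by fun_prop) (by simpa using hρ)
    have g5 := hlt (G := fun x => ((lower p).field x.2.2
        ((H x).1, 0, 2 * (H x).1 ^ 2 + (H x).2.1)).2.1)
      (cfield.continuousAt.comp (f := fun x => (x.2.2, (H x).1, (0 : ℝ), 2 * (H x).1 ^ 2 + (H x).2.1))
        (by fun_prop)) (by simpa [hH0, HalfParams.field] using hρ)
    have g6 := hlt (G := fun x => -((lower p).field x.2.2 (-((H x).1 + x.2.2 * A₂ (H x)), 0,
        2 * ((H x).1 + x.2.2 * A₂ (H x)) ^ 2 + (μ * (H x).2.1 + x.2.2 * B₂ (H x)))).2.1)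
      ((cfield.continuousAt.comp (f := fun x => (x.2.2, -((H x).1 + x.2.2 * A₂ (H x)), (0 : ℝ),
        2 * ((H x).1 + x.2.2 * A₂ (H x)) ^ 2 + (μ * (H x).2.1 + x.2.2 * B₂ (H x))))
        (ContinuousAt.prodMk (by fun_prop) (cR.neg.prodMk
          (continuousAt_const.prodMk ((continuousAt_const.mul (cR.pow 2)).add cZ))))).neg)
      (by simpa [hH0, HalfParams.field] using hρ)
    have g7 := hlt (G := fun x => C - (|A₁ x| + |B₁ x|)) (by fun_prop) (by rw [hC]; linarith)
    filter_upwards [ho₁, hHt.eventually ho₂, ho₂, g1, g2, g3, g4, g5, g6, g7]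
      with x x1 x2 x3 y1 y2 y3 y4 y5 y6 y7
    have e1 : (H x).1 + x.2.2 * A₂ (H x) = x.1 + x.2.2 * (A₁ x + A₂ (H x)) := by
      simp only [H]; ring
    have e2 : μ * (H x).2.1 + x.2.2 * B₂ (H x) = μ ^ 2 * x.2.1 + x.2.2 * (μ * B₁ x + B₂ (H x)) := by
      simp only [H]; ring
    -- The additional lower half orbit starting from `x` itself serves periodic solutions for which
    -- the first known crossing is a downward one.
    refine ⟨?_, _, _, _, _, y4, x3.mono (by linarith)⟩
    rw [← e1, ← e2]
    refine ⟨⟨(H x).1, (H x).2.1, T₁ x, T₂ (H x), c₁ x, c₂ (H x), x1.mono (by linarith),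
      x2.mono (by linarith), y1, y2, y3, y5, by linarith⟩, ?_⟩
    simp only [H]
    have h1 : x.1 + x.2.2 * A₁ x - ρ = (x.1 - ρ) + x.2.2 * A₁ x := by ring
    have h2 := abs_add_le (x.1 - ρ) (x.2.2 * A₁ x)
    have h3 := abs_add_le (μ * x.2.1) (x.2.2 * B₁ x)
    rw [abs_mul] at h2
    rw [abs_mul, abs_mul, abs_of_pos hμ0] at h3
    have h4 : μ * |x.2.1| ≤ 1 * |x.2.1| := by gcongr
    have h5 : |x.2.2| * (|A₁ x| + |B₁ x|) ≤ |x.2.2| * (K₁ + K₂ + C) :=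
      mul_le_mul_of_nonneg_left (by linarith) (abs_nonneg _)
    rw [h1]
    linarith

/-- A simple positive zero of the bifurcation function yields a family of limit cycles. -/
theorem exists_limitCycleFamily (p : Params) {ρ k₁ k₂ d : ℝ} {D : ℝ → ℝ} (hρ : 0 < ρ)
    (hk₁ : ∀ r ζ, (upper p).slowDrift r ζ = k₁ * ζ)
    (hk₂ : ∀ r ζ, (lower p).slowDrift r ζ = k₂ * ζ)
    (hD : ∀ r, 0 < r → turnBifurcation (upper p) (lower p) k₁ k₂ r = D r)
    (hDρ : D ρ = 0) (hd : HasDerivAt D d ρ) (hd0 : d ≠ 0) :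
    ∃ φ T, IsLimitCycleFamily p quadF ρ φ T := by
  obtain ⟨A, B, K, hK, hA, hB, hA0, hAζ, hB0, hAε, hgood⟩ := exists_returnMap p hρ hk₁ hk₂
  have hμ0 : 0 < Real.exp (-Real.pi) := Real.exp_pos _
  have hμ1 : Real.exp (-Real.pi) < 1 := Real.exp_lt_one_iff.2 (by linarith [Real.pi_pos])
  obtain ⟨κ₁, hκ₁, C, hC, hfix⟩ := exists_isolated_fixedPoint (l := Real.exp (-Real.pi) ^ 2)
    hA hB (by positivity) (pow_lt_one₀ hμ0.le hμ1 two_ne_zero) hA0 hAζ hB0 hAε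
    (by rw [← hDρ, ← hD ρ hρ]; rfl)
    (hd.congr_of_eventuallyEq ((eventually_gt_nhds hρ).mono fun r hr => hD r hr)) hd0
  obtain ⟨κ₂, hκ₂, hg⟩ := Metric.eventually_nhds_iff_ball.1 hgood
  obtain ⟨κ, hκ, hκ1, hκ2, hκρ⟩ : ∃ κ > 0, κ ≤ κ₁ ∧ κ ≤ κ₂ ∧ κ < ρ :=
    ⟨min κ₁ (min κ₂ (ρ / 2)), by positivity, min_le_left _ _,
      (min_le_right _ _).trans (min_le_left _ _),
      ((min_le_right _ _).trans (min_le_right _ _)).trans_lt (by linarith)⟩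
  have hg' : ∀ {r ζ ε}, |r - ρ| < κ → |ζ| < κ → |ε| < κ → _ := fun {r ζ ε} hr hζ hε =>
    hg (r, ζ, ε) (by
      rw [Metric.mem_ball, Prod.dist_eq, Prod.dist_eq, Real.dist_eq, Real.dist_eq, Real.dist_eq,
        sub_zero, sub_zero]
      exact max_lt (by linarith) (max_lt (by linarith) (by linarith)))
  -- a neighbourhood of the circle inside the tube
  have hcirc : Continuous (HalfParams.circ ρ) := by
    unfold HalfParams.circ quadF; fun_prop
  -- The parameter interval `[0, 8]` contains a whole period, since the period stays below `2π + 1`.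
  obtain ⟨δ, hδ, hδU⟩ := (isCompact_Icc.image hcirc : IsCompact (HalfParams.circ ρ '' Icc 0 8)
    ).exists_thickening_subset_open (isOpen_tube ρ κ) (by
      rintro _ ⟨t, -, rfl⟩; exact circ_mem_tube hρ hκ t)
  -- `2 C` comes from the start at `|r - ρ|, |ζ| ≤ C |ε|`, the extra `K` from the displacement at
  -- mid-turn, and the last summand from the phase error of the lower half.
  set M := K * (2 * C + K + 1) + (ρ + 6 * ρ ^ 2) * K with hM
  have hM0 : 0 ≤ M := by positivity
  have small : ∀ {c b : ℝ}, 0 < b → ∀ᶠ ε in 𝓝[≠] (0 : ℝ), c * |ε| < b := by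
    intro c b hb
    refine (Filter.Tendsto.eventually_lt_const (v := 0) hb ?_)
    exact ((Continuous.tendsto' (by fun_prop) 0 0 (by simp)).mono_left nhdsWithin_le_nhds)
  have hmain : ∀ᶠ ε in 𝓝[≠] (0 : ℝ), ∃ x : (ℝ → ℝ × ℝ × ℝ) × ℝ,
      IsLimitCycle (fieldPlus p quadF ε) (fieldMinus p quadF ε) x.1 x.2 ∧
      |x.2 - 2 * Real.pi| ≤ max (2 * K) M * |ε| ∧
      ∀ t ∈ Icc 0 x.2, ‖x.1 t - HalfParams.circ ρ t‖ ≤ max (2 * K) M * |ε| := by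
    filter_upwards [hfix, small (c := C) hκ, small (c := 1) hκ, small (c := M) hδ,
      small (c := 2 * K) one_pos, (eventually_rotates (upper p) hκρ).filter_mono nhdsWithin_le_nhds,
      (eventually_rotates (lower p) hκρ).filter_mono nhdsWithin_le_nhds]
      with ε ⟨r, ζ, hr, hζ, hAz, hBz, hiso⟩ h1 h2 h3 h4 h5 h6
    rw [one_mul] at h2
    have hO := (hg' (lt_of_le_of_lt hr h1) (lt_of_le_of_lt hζ h1) h2).1
    dsimp only at hO
    rw [hAz, hBz, mul_zero, add_zero] at hO
    obtain ⟨O, hO⟩ := hO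
    have hclose : ∀ t ∈ Icc 0 O.period, ‖O.orbit t - HalfParams.circ ρ t‖ ≤ M * |ε| := by
      intro t ht
      rw [O.orbit_of_mem ht]
      have hε := abs_nonneg ε
      have hK1 : K * (|r - ρ| + |ζ| + |ε|) ≤ K * (2 * (C * |ε|) + |ε|) := by gcongr; linarith
      have hK2 : K * (|O.r₁ - ρ| + |O.ζ₁| + |ε|) ≤ K * (2 * (C * |ε|) + K * |ε| + |ε|) :=
        mul_le_mul_of_nonneg_left (by linarith) hK
      refine O.curve_close hρ (hK1.trans ?_) ((add_le_add hK2 le_rfl).trans (le_of_eq ?_)) ht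
      · have e1 : M * |ε| = K * (2 * (C * |ε|) + |ε|) + (K * K + (ρ + 6 * ρ ^ 2) * K) * |ε| := by
          rw [hM]; ring
        have : 0 ≤ (K * K + (ρ + 6 * ρ ^ 2) * K) * |ε| := by positivity
        linarith
      · rw [hM]; ring
    refine ⟨(O.orbit, O.period), ⟨O.isPeriodicSolution_orbit, tube ρ κ, isOpen_tube ρ κ, ?_, ?_⟩,
      O.period_close.trans (by gcongr; exact le_max_left _ _),
      fun t ht => (hclose t ht).trans (by gcongr; exact le_max_right _ _)⟩
    · rintro _ ⟨t, rfl⟩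
      obtain ⟨s, hs, hst⟩ := O.periodic_orbit.exists_mem_Ico₀ O.period_pos t
      change O.orbit t ∈ _
      rw [hst]
      have hs' := Ico_subset_Icc_self hs
      refine hδU (Metric.mem_thickening_iff.2 ⟨HalfParams.circ ρ s, ⟨s, ⟨hs.1, ?_⟩, rfl⟩, ?_⟩)
      · have h7 := (abs_le.1 O.period_close).2
        have h8 := hs.2
        have h9 : 2 * K * |ε| < 1 := h4
        linarith [Real.pi_lt_d2]
      · rw [dist_eq_norm]
        exact (hclose s hs').trans_lt h3
    · intro ψ S hψ hψU
      obtain ⟨t, ht⟩ := exists_section_eq (r := r) (ζ := ζ) (K := K)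
        (F := fun r ζ => r + ε * A (r, ζ, ε))
        (G := fun r ζ => Real.exp (-Real.pi) ^ 2 * ζ + ε * B (r, ζ, ε)) hψ hψU
        (by
          intro P hP
          rcases hP with rfl | rfl
          · exact h5
          · exact h6) hκρ
        (fun r ζ hr hζ => ⟨(hg' hr hζ h2).1.choose⟩) (fun r ζ hr hζ => (hg' hr hζ h2).2)
        (fun R Z n hn hbox hrec hR hZ => hiso R Z n hn
          (fun k => ⟨(hbox k).1.trans_le hκ1, (hbox k).2.trans_le hκ1⟩) hrec hR hZ)
      exact O.range_eq hψ ht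
  -- The orbit and its period are chosen separately for each `ε`, with arbitrary values where the
  -- property fails; only small `ε ≠ 0` matter.
  refine ⟨fun ε => (Classical.epsilon fun x : (ℝ → ℝ × ℝ × ℝ) × ℝ =>
      IsLimitCycle (fieldPlus p quadF ε) (fieldMinus p quadF ε) x.1 x.2 ∧
      |x.2 - 2 * Real.pi| ≤ max (2 * K) M * |ε| ∧
      ∀ t ∈ Icc 0 x.2, ‖x.1 t - HalfParams.circ ρ t‖ ≤ max (2 * K) M * |ε|).1,
    fun ε => (Classical.epsilon fun x : (ℝ → ℝ × ℝ × ℝ) × ℝ =>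
      IsLimitCycle (fieldPlus p quadF ε) (fieldMinus p quadF ε) x.1 x.2 ∧
      |x.2 - 2 * Real.pi| ≤ max (2 * K) M * |ε| ∧
      ∀ t ∈ Icc 0 x.2, ‖x.1 t - HalfParams.circ ρ t‖ ≤ max (2 * K) M * |ε|).2,
    max (2 * K) M, ?_⟩
  filter_upwards [hmain] with ε hε
  exact Classical.epsilon_spec hε

/-! ### Closed forms of the half-turn integrals. -/

theorem integral_eq_of_antideriv {F f : ℝ → ℝ} (h : ∀ s, HasDerivAt F (f s) s) (hf : Continuous f)
    (a b : ℝ) : ∫ s in a..b, f s = F b - F a :=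
  intervalIntegral.integral_eq_sub_of_hasDerivAt (fun s _ => h s) (hf.intervalIntegrable a b)

theorem deriv_exp_neg' (s : ℝ) : deriv (fun s => Real.exp (-s)) s = -Real.exp (-s) :=
  (hasDerivAt_neg s).exp.deriv.trans (by ring)

theorem deriv_const_hMul (a s : ℝ) : deriv (HMul.hMul a) s = a := by
  simp

set_option linter.unusedSimpArgs false

/-- The drift has no part independent of `ζ`: this is why the first order theory is degenerate and
second order is needed. Here and below an explicit antiderivative, a polynomial in `cos`, `sin`,
exponentials and `s`, is checked by differentiation; it differs from the integrand by a multiple of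
`sin² + cos² - 1`. -/
theorem slowDrift_upper (p : Params) (r ζ : ℝ) :
    (upper p).slowDrift r ζ = p.a1 * (1 + Real.exp (-Real.pi)) / 2 * ζ := by
  rw [HalfParams.slowDrift]
  refine (integral_eq_of_antideriv (F := fun s => -(1 / 2) * Real.cos s * Real.exp (-s) * p.a1 * ζ + Real.cos s ^ 2 * Real.sin s * p.a1 * r ^
      2 + (1 / 2) * Real.exp (-s) * Real.sin s * p.a1 * ζ + Real.sin s * p.a0 + Real.sin s * p.a1
      * r ^ 2 + (1 / 2) * p.a1 * ζ)
    (fun s => HasDerivAt.congr_deriv (DifferentiableAt.hasDerivAt (by fun_prop)) ?_)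
    (by simp only [HalfParams.pert1, HalfParams.pert2, HalfParams.zFree, upper]; fun_prop) _ _).trans ?_
  · simp (disch := fun_prop) only [deriv_fun_add, deriv_fun_sub, deriv_fun_mul, deriv_fun_pow,
      deriv.fun_neg', deriv_const', deriv_id'', Real.deriv_cos', Real.deriv_sin, Real.deriv_exp,
      deriv_exp_neg', deriv_const_hMul]
    simp only [HalfParams.pert1, HalfParams.pert2, HalfParams.zFree, upper]
    linear_combination (-Real.cos s * p.a1 * r ^ 2) * Real.sin_sq_add_cos_sq s
  · simp only [Real.cos_pi, Real.sin_pi, Real.cos_zero, Real.sin_zero, Real.exp_zero, neg_zero]; ring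

theorem speed₀_upper (p : Params) (r : ℝ) :
    (upper p).speed₀ r = 2 * p.a0 / (Real.pi * r) := by
  rw [HalfParams.speed₀, neg_eq_iff_eq_neg, ← neg_div]
  congr 1
  refine (integral_eq_of_antideriv (F := fun s => Real.cos s * p.a0 - Real.cos s * p.a1 * r ^ 2 + Real.cos s ^ 3 * p.a1 * r ^ 2 - p.a0)
    (fun s => HasDerivAt.congr_deriv (DifferentiableAt.hasDerivAt (by fun_prop)) ?_)
    (by simp only [HalfParams.pert1, HalfParams.pert2, HalfParams.zFree, upper]; fun_prop) _ _).trans ?_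
  · simp (disch := fun_prop) only [deriv_fun_add, deriv_fun_sub, deriv_fun_mul, deriv_fun_pow,
      deriv.fun_neg', deriv_const', deriv_id'', Real.deriv_cos', Real.deriv_sin, Real.deriv_exp,
      deriv_exp_neg', deriv_const_hMul]
    simp only [HalfParams.pert1, HalfParams.pert2, HalfParams.zFree, upper]
    linear_combination (-Real.sin s * p.a1 * r ^ 2) * Real.sin_sq_add_cos_sq s
  · simp only [Real.cos_pi, Real.sin_pi, Real.cos_zero, Real.sin_zero, Real.exp_zero, neg_zero]; ring

theorem U₀_upper (p : Params) (r t : ℝ) : (upper p).U₀ r t =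
    Real.cos t ^ 2 * Real.sin t * p.a1 * r ^ 2 + Real.sin t * p.a0 + Real.sin t * p.a1 * r ^ 2 := by
  rw [HalfParams.U₀]
  refine (integral_eq_of_antideriv (F := fun s => Real.cos s ^ 2 * Real.sin s * p.a1 * r ^ 2 + Real.sin s * p.a0 + Real.sin s * p.a1 * r ^ 2)
    (fun s => HasDerivAt.congr_deriv (DifferentiableAt.hasDerivAt (by fun_prop)) ?_)
    (by simp only [HalfParams.pert1, HalfParams.pert2, HalfParams.zFree, upper]; fun_prop) _ _).trans ?_
  · simp (disch := fun_prop) only [deriv_fun_add, deriv_fun_sub, deriv_fun_mul, deriv_fun_pow,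
      deriv.fun_neg', deriv_const', deriv_id'', Real.deriv_cos', Real.deriv_sin, Real.deriv_exp,
      deriv_exp_neg', deriv_const_hMul]
    simp only [HalfParams.pert1, HalfParams.pert2, HalfParams.zFree, upper]
    linear_combination (-Real.cos s * p.a1 * r ^ 2) * Real.sin_sq_add_cos_sq s
  · simp only [Real.cos_zero, Real.sin_zero, Real.exp_zero, neg_zero]; ring

theorem V₀_upper (p : Params) (r t : ℝ) : (upper p).V₀ r t =
    Real.cos t * p.a0 - Real.cos t * p.a1 * r ^ 2 + Real.cos t ^ 3 * p.a1 * r ^ 2 - p.a0 + r * t *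
    (upper p).speed₀ r := by
  rw [HalfParams.V₀]
  generalize (upper p).speed₀ r = v
  refine (integral_eq_of_antideriv (F := fun s => Real.cos s * p.a0 - Real.cos s * p.a1 * r ^ 2 + Real.cos s ^ 3 * p.a1 * r ^ 2 - p.a0 + r * s
      * v)
    (fun s => HasDerivAt.congr_deriv (DifferentiableAt.hasDerivAt (by fun_prop)) ?_)
    (by simp only [HalfParams.pert1, HalfParams.pert2, HalfParams.zFree, upper]; fun_prop) _ _).trans ?_
  · simp (disch := fun_prop) only [deriv_fun_add, deriv_fun_sub, deriv_fun_mul, deriv_fun_pow,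
      deriv.fun_neg', deriv_const', deriv_id'', Real.deriv_cos', Real.deriv_sin, Real.deriv_exp,
      deriv_exp_neg', deriv_const_hMul]
    simp only [HalfParams.pert1, HalfParams.pert2, HalfParams.zFree, upper]
    linear_combination (-Real.sin s * p.a1 * r ^ 2) * Real.sin_sq_add_cos_sq s
  · simp only [Real.cos_zero, Real.sin_zero, Real.exp_zero, neg_zero]; ring

theorem H₀_upper (p : Params) (r t : ℝ) : (upper p).H₀ r t =
    -2 * Real.cos t * Real.exp t * p.a0 * r - (8 / 5) * Real.cos t * Real.exp t * p.a1 * r ^ 3 -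
    (18 / 5) * Real.cos t ^ 2 * Real.exp t * Real.sin t * p.a1 * r ^ 3 - (6 / 5) * Real.cos t ^ 3
    * Real.exp t * p.a1 * r ^ 3 - 2 * Real.exp t * Real.sin t * p.a0 * r - (8 / 5) * Real.exp t *
    Real.sin t * p.a1 * r ^ 3 + 2 * p.a0 * r + (14 / 5) * p.a1 * r ^ 3 := by
  rw [HalfParams.H₀]
  refine (integral_eq_of_antideriv (F := fun s => -2 * Real.cos s * Real.exp s * p.a0 * r - (8 / 5) * Real.cos s * Real.exp s * p.a1 * r ^ 3 -
      (18 / 5) * Real.cos s ^ 2 * Real.exp s * Real.sin s * p.a1 * r ^ 3 - (6 / 5) * Real.cos s ^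
      3 * Real.exp s * p.a1 * r ^ 3 - 2 * Real.exp s * Real.sin s * p.a0 * r - (8 / 5) * Real.exp
      s * Real.sin s * p.a1 * r ^ 3 + 2 * p.a0 * r + (14 / 5) * p.a1 * r ^ 3)
    (fun s => HasDerivAt.congr_deriv (DifferentiableAt.hasDerivAt (by fun_prop)) ?_)
    (by simp only [HalfParams.pert1, HalfParams.pert2, HalfParams.zFree, upper]; fun_prop) _ _).trans ?_
  · simp (disch := fun_prop) only [deriv_fun_add, deriv_fun_sub, deriv_fun_mul, deriv_fun_pow,
      deriv.fun_neg', deriv_const', deriv_id'', Real.deriv_cos', Real.deriv_sin, Real.deriv_exp,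
      deriv_exp_neg', deriv_const_hMul]
    simp only [HalfParams.pert1, HalfParams.pert2, HalfParams.zFree, upper]
    linear_combination ((16 / 5) * Real.cos s * Real.exp s * p.a1 * r ^ 3) * Real.sin_sq_add_cos_sq s
  · simp only [Real.cos_zero, Real.sin_zero, Real.exp_zero, neg_zero]; ring

theorem fastShift_upper (p : Params) (r : ℝ) :
    (upper p).fastShift r = (1 + Real.exp (-Real.pi)) * (2 * p.a0 * r + 14 / 5 * p.a1 * r ^ 3) := by
  rw [HalfParams.fastShift, H₀_upper, Real.exp_neg]
  simp only [Real.cos_pi, Real.sin_pi]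
  field_simp
  ring

theorem zVar_upper (p : Params) (r s : ℝ) : (upper p).zVar r s =
    6 * Real.cos s * Real.sin s * p.a0 * r - 6 * Real.cos s * Real.sin s * r ^ 2 * s * (upper
    p).speed₀ r - 2 * Real.cos s * p.a0 * r - (8 / 5) * Real.cos s * p.a1 * r ^ 3 + (32 / 5) *
    Real.cos s ^ 2 * Real.sin s * p.a1 * r ^ 3 - (6 / 5) * Real.cos s ^ 3 * p.a1 * r ^ 3 + 2 *
    Real.exp (-s) * p.a0 * r + (14 / 5) * Real.exp (-s) * p.a1 * r ^ 3 - 4 * Real.sin s * p.a0 * r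
    - (18 / 5) * Real.sin s * p.a1 * r ^ 3 := by
  have he : Real.exp (-s) * Real.exp s = 1 := by rw [← Real.exp_add, neg_add_cancel, Real.exp_zero]
  rw [HalfParams.zVar, U₀_upper, V₀_upper, H₀_upper]
  linear_combination (-2 * Real.cos s * p.a0 * r - (8 / 5) * Real.cos s * p.a1 * r ^ 3 - (18 / 5) * Real.cos s ^ 2
      * Real.sin s * p.a1 * r ^ 3 - (6 / 5) * Real.cos s ^ 3 * p.a1 * r ^ 3 - 2 * Real.sin s *
      p.a0 * r - (8 / 5) * Real.sin s * p.a1 * r ^ 3) * he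
    + (-2 * Real.cos s ^ 2 * Real.sin s * p.a1 * r ^ 3 - 2 * Real.sin s * p.a0 * r - 2 * Real.sin s
      * p.a1 * r ^ 3) * Real.sin_sq_add_cos_sq s

/-- `a2` and `a3` are multiplied by functions with a factor `sin` after integration, and drop out at
both ends. -/
theorem slowDrift₂_upper (p : Params) {r : ℝ} (hr : r ≠ 0) :
    (upper p).slowDrift₂ r = (1 + Real.exp (-Real.pi) - Real.pi) * p.a0 * p.a1 * r
      + (7 / 5 * (1 + Real.exp (-Real.pi)) - 5 / 4 * Real.pi) * p.a1 ^ 2 * r ^ 3 := by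
  rw [HalfParams.slowDrift₂]
  simp only [zVar_upper, V₀_upper]
  -- The speed is constant in `s`; its value, which contains `1 / r`, is inserted only after the
  -- integration.
  generalize hv : (upper p).speed₀ r = v
  refine (integral_eq_of_antideriv (F := fun s => -Real.cos s * Real.exp (-s) * p.a0 * p.a1 * r - (7 / 5) * Real.cos s * Real.exp (-s) * p.a1
      ^ 2 * r ^ 3 - Real.cos s * Real.sin s * p.a0 * p.a1 * r - (5 / 4) * Real.cos s * Real.sin s
      * p.a1 ^ 2 * r ^ 3 + Real.cos s ^ 2 * Real.sin s * p.a3 * r ^ 2 + 2 * Real.cos s ^ 2 * p.a0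
      * p.a1 * r + (9 / 5) * Real.cos s ^ 2 * p.a1 ^ 2 * r ^ 3 - (3 / 10) * Real.cos s ^ 3 *
      Real.sin s * p.a1 ^ 2 * r ^ 3 - 2 * Real.cos s ^ 3 * p.a0 * p.a1 * r + 2 * Real.cos s ^ 3 *
      p.a1 * r ^ 2 * s * v - (8 / 5) * Real.cos s ^ 4 * p.a1 ^ 2 * r ^ 3 + Real.exp (-s) *
      Real.sin s * p.a0 * p.a1 * r + (7 / 5) * Real.exp (-s) * Real.sin s * p.a1 ^ 2 * r ^ 3 +
      Real.sin s * p.a2 + Real.sin s * p.a3 * r ^ 2 + p.a0 * p.a1 * r - p.a0 * p.a1 * r * s + p.a0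
      * s * v + (6 / 5) * p.a1 ^ 2 * r ^ 3 - (5 / 4) * p.a1 ^ 2 * r ^ 3 * s - (1 / 2) * r * s ^ 2
      * v ^ 2)
    (fun s => HasDerivAt.congr_deriv (DifferentiableAt.hasDerivAt (by fun_prop)) ?_)
    (by simp only [HalfParams.pert1, HalfParams.pert2, HalfParams.zFree, upper]; fun_prop) _ _).trans ?_
  · simp (disch := fun_prop) only [deriv_fun_add, deriv_fun_sub, deriv_fun_mul, deriv_fun_pow,
      deriv.fun_neg', deriv_const', deriv_id'', Real.deriv_cos', Real.deriv_sin, Real.deriv_exp,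
      deriv_exp_neg', deriv_const_hMul]
    simp only [HalfParams.pert1, HalfParams.pert2, HalfParams.zFree, upper]
    linear_combination (Real.cos s * p.a1 * r ^ 2 * v - Real.cos s * p.a3 * r ^ 2 + (9 / 10) * Real.cos s ^ 2 * p.a1
      ^ 2 * r ^ 3 + p.a0 * p.a1 * r + (5 / 4) * p.a1 ^ 2 * r ^ 3) * Real.sin_sq_add_cos_sq s
  · have hv : v = 2 * p.a0 / (Real.pi * r) := by rw [← hv, speed₀_upper]
    simp only [Real.cos_pi, Real.sin_pi, Real.cos_zero, Real.sin_zero, Real.exp_zero, neg_zero]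
    rw [hv]
    field_simp
    ring

theorem slowDrift_lower (p : Params) (r ζ : ℝ) :
    (lower p).slowDrift r ζ = -p.b1 * (1 + Real.exp (-Real.pi)) / 2 * ζ := by
  rw [HalfParams.slowDrift]
  refine (integral_eq_of_antideriv (F := fun s => (1 / 2) * Real.cos s * Real.exp (-s) * p.b1 * ζ - Real.cos s * p.b1 * r ^ 2 + Real.cos s ^ 3
      * p.b1 * r ^ 2 + (1 / 2) * Real.exp (-s) * Real.sin s * p.b1 * ζ - (1 / 2) * p.b1 * ζ)
    (fun s => HasDerivAt.congr_deriv (DifferentiableAt.hasDerivAt (by fun_prop)) ?_)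
    (by simp only [HalfParams.pert1, HalfParams.pert2, HalfParams.zFree, lower]; fun_prop) _ _).trans ?_
  · simp (disch := fun_prop) only [deriv_fun_add, deriv_fun_sub, deriv_fun_mul, deriv_fun_pow,
      deriv.fun_neg', deriv_const', deriv_id'', Real.deriv_cos', Real.deriv_sin, Real.deriv_exp,
      deriv_exp_neg', deriv_const_hMul]
    simp only [HalfParams.pert1, HalfParams.pert2, HalfParams.zFree, lower]
    linear_combination (-Real.sin s * p.b1 * r ^ 2) * Real.sin_sq_add_cos_sq s
  · simp only [Real.cos_pi, Real.sin_pi, Real.cos_zero, Real.sin_zero, Real.exp_zero, neg_zero]; ring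

theorem speed₀_lower (p : Params) (r : ℝ) : (lower p).speed₀ r = 0 := by
  rw [HalfParams.speed₀, neg_eq_zero, div_eq_zero_iff]
  left
  refine (integral_eq_of_antideriv (F := fun s => -Real.cos s ^ 2 * Real.sin s * p.b1 * r ^ 2 - Real.sin s * p.b1 * r ^ 2)
    (fun s => HasDerivAt.congr_deriv (DifferentiableAt.hasDerivAt (by fun_prop)) ?_)
    (by simp only [HalfParams.pert1, HalfParams.pert2, HalfParams.zFree, lower]; fun_prop) _ _).trans ?_
  · simp (disch := fun_prop) only [deriv_fun_add, deriv_fun_sub, deriv_fun_mul, deriv_fun_pow,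
      deriv.fun_neg', deriv_const', deriv_id'', Real.deriv_cos', Real.deriv_sin, Real.deriv_exp,
      deriv_exp_neg', deriv_const_hMul]
    simp only [HalfParams.pert1, HalfParams.pert2, HalfParams.zFree, lower]
    linear_combination (Real.cos s * p.b1 * r ^ 2) * Real.sin_sq_add_cos_sq s
  · simp only [Real.cos_pi, Real.sin_pi, Real.cos_zero, Real.sin_zero, Real.exp_zero, neg_zero]; ring

theorem U₀_lower (p : Params) (r t : ℝ) : (lower p).U₀ r t =
    -Real.cos t * p.b1 * r ^ 2 + Real.cos t ^ 3 * p.b1 * r ^ 2 := by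
  rw [HalfParams.U₀]
  refine (integral_eq_of_antideriv (F := fun s => -Real.cos s * p.b1 * r ^ 2 + Real.cos s ^ 3 * p.b1 * r ^ 2)
    (fun s => HasDerivAt.congr_deriv (DifferentiableAt.hasDerivAt (by fun_prop)) ?_)
    (by simp only [HalfParams.pert1, HalfParams.pert2, HalfParams.zFree, lower]; fun_prop) _ _).trans ?_
  · simp (disch := fun_prop) only [deriv_fun_add, deriv_fun_sub, deriv_fun_mul, deriv_fun_pow,
      deriv.fun_neg', deriv_const', deriv_id'', Real.deriv_cos', Real.deriv_sin, Real.deriv_exp,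
      deriv_exp_neg', deriv_const_hMul]
    simp only [HalfParams.pert1, HalfParams.pert2, HalfParams.zFree, lower]
    linear_combination (-Real.sin s * p.b1 * r ^ 2) * Real.sin_sq_add_cos_sq s
  · simp only [Real.cos_zero, Real.sin_zero, Real.exp_zero, neg_zero]; ring

theorem V₀_lower (p : Params) (r t : ℝ) : (lower p).V₀ r t =
    -Real.cos t ^ 2 * Real.sin t * p.b1 * r ^ 2 - Real.sin t * p.b1 * r ^ 2 := by
  rw [HalfParams.V₀, speed₀_lower]
  refine (integral_eq_of_antideriv (F := fun s => -Real.cos s ^ 2 * Real.sin s * p.b1 * r ^ 2 - Real.sin s * p.b1 * r ^ 2)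
    (fun s => HasDerivAt.congr_deriv (DifferentiableAt.hasDerivAt (by fun_prop)) ?_)
    (by simp only [HalfParams.pert1, HalfParams.pert2, HalfParams.zFree, lower]; fun_prop) _ _).trans ?_
  · simp (disch := fun_prop) only [deriv_fun_add, deriv_fun_sub, deriv_fun_mul, deriv_fun_pow,
      deriv.fun_neg', deriv_const', deriv_id'', Real.deriv_cos', Real.deriv_sin, Real.deriv_exp,
      deriv_exp_neg', deriv_const_hMul]
    simp only [HalfParams.pert1, HalfParams.pert2, HalfParams.zFree, lower]
    linear_combination (Real.cos s * p.b1 * r ^ 2) * Real.sin_sq_add_cos_sq s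
  · simp only [Real.cos_zero, Real.sin_zero, Real.exp_zero, neg_zero]; ring

theorem H₀_lower (p : Params) (r t : ℝ) : (lower p).H₀ r t =
    -(8 / 5) * Real.cos t * Real.exp t * p.b1 * r ^ 3 - (3 / 5) * Real.cos t ^ 2 * Real.exp t *
    Real.sin t * p.b1 * r ^ 3 + (9 / 5) * Real.cos t ^ 3 * Real.exp t * p.b1 * r ^ 3 + (2 / 5) *
    Real.exp t * Real.sin t * p.b1 * r ^ 3 - (1 / 5) * p.b1 * r ^ 3 := by
  rw [HalfParams.H₀]
  refine (integral_eq_of_antideriv (F := fun s => -(8 / 5) * Real.cos s * Real.exp s * p.b1 * r ^ 3 - (3 / 5) * Real.cos s ^ 2 * Real.exp s *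
      Real.sin s * p.b1 * r ^ 3 + (9 / 5) * Real.cos s ^ 3 * Real.exp s * p.b1 * r ^ 3 + (2 / 5) *
      Real.exp s * Real.sin s * p.b1 * r ^ 3 - (1 / 5) * p.b1 * r ^ 3)
    (fun s => HasDerivAt.congr_deriv (DifferentiableAt.hasDerivAt (by fun_prop)) ?_)
    (by simp only [HalfParams.pert1, HalfParams.pert2, HalfParams.zFree, lower]; fun_prop) _ _).trans ?_
  · simp (disch := fun_prop) only [deriv_fun_add, deriv_fun_sub, deriv_fun_mul, deriv_fun_pow,
      deriv.fun_neg', deriv_const', deriv_id'', Real.deriv_cos', Real.deriv_sin, Real.deriv_exp,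
      deriv_exp_neg', deriv_const_hMul]
    simp only [HalfParams.pert1, HalfParams.pert2, HalfParams.zFree, lower]
    linear_combination ((6 / 5) * Real.cos s * Real.exp s * p.b1 * r ^ 3 - 2 * Real.exp s * Real.sin s * p.b1 * r ^
      3) * Real.sin_sq_add_cos_sq s
  · simp only [Real.cos_zero, Real.sin_zero, Real.exp_zero, neg_zero]; ring

theorem fastShift_lower (p : Params) (r : ℝ) :
    (lower p).fastShift r = -(1 + Real.exp (-Real.pi)) * p.b1 * r ^ 3 / 5 := by
  rw [HalfParams.fastShift, H₀_lower, Real.exp_neg]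
  simp only [Real.cos_pi, Real.sin_pi]
  field_simp
  ring

theorem zVar_lower (p : Params) (r s : ℝ) : (lower p).zVar r s =
    (32 / 5) * Real.cos s * p.b1 * r ^ 3 - (3 / 5) * Real.cos s ^ 2 * Real.sin s * p.b1 * r ^ 3 -
    (31 / 5) * Real.cos s ^ 3 * p.b1 * r ^ 3 - (1 / 5) * Real.exp (-s) * p.b1 * r ^ 3 + (2 / 5) *
    Real.sin s * p.b1 * r ^ 3 := by
  have he : Real.exp (-s) * Real.exp s = 1 := by rw [← Real.exp_add, neg_add_cancel, Real.exp_zero]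
  rw [HalfParams.zVar, U₀_lower, V₀_lower, H₀_lower]
  linear_combination (-(8 / 5) * Real.cos s * p.b1 * r ^ 3 - (3 / 5) * Real.cos s ^ 2 * Real.sin s * p.b1 * r ^ 3
      + (9 / 5) * Real.cos s ^ 3 * p.b1 * r ^ 3 + (2 / 5) * Real.sin s * p.b1 * r ^ 3) * he
    + (8 * Real.cos s * p.b1 * r ^ 3 + 4 * Real.cos s ^ 3 * p.b1 * r ^ 3) * Real.sin_sq_add_cos_sq s

/-- `b3` is multiplied by `cos³ - cos` after integration and drops out, while `b2` leaves the
constant term of the cubic. -/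
theorem slowDrift₂_lower (p : Params) (r : ℝ) :
    (lower p).slowDrift₂ r = -2 * p.b2
      + (1 / 10 * (1 + Real.exp (-Real.pi)) - 1 / 8 * Real.pi) * p.b1 ^ 2 * r ^ 3 := by
  rw [HalfParams.slowDrift₂]
  simp only [zVar_lower, V₀_lower, speed₀_lower]
  refine (integral_eq_of_antideriv (F := fun s => -(1 / 10) * Real.cos s * Real.exp (-s) * p.b1 ^ 2 * r ^ 3 + (11 / 40) * Real.cos s *
      Real.sin s * p.b1 ^ 2 * r ^ 3 + Real.cos s * p.b2 - Real.cos s * p.b3 * r ^ 2 + (16 / 5) *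
      Real.cos s ^ 2 * p.b1 ^ 2 * r ^ 3 - (3 / 20) * Real.cos s ^ 3 * Real.sin s * p.b1 ^ 2 * r ^
      3 + Real.cos s ^ 3 * p.b3 * r ^ 2 - (31 / 20) * Real.cos s ^ 4 * p.b1 ^ 2 * r ^ 3 - (1 / 10)
      * Real.exp (-s) * Real.sin s * p.b1 ^ 2 * r ^ 3 - (31 / 20) * p.b1 ^ 2 * r ^ 3 - (1 / 8) *
      p.b1 ^ 2 * r ^ 3 * s - p.b2)
    (fun s => HasDerivAt.congr_deriv (DifferentiableAt.hasDerivAt (by fun_prop)) ?_)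
    (by simp only [HalfParams.pert1, HalfParams.pert2, HalfParams.zFree, lower]; fun_prop) _ _).trans ?_
  · simp (disch := fun_prop) only [deriv_fun_add, deriv_fun_sub, deriv_fun_mul, deriv_fun_pow,
      deriv.fun_neg', deriv_const', deriv_id'', Real.deriv_cos', Real.deriv_sin, Real.deriv_exp,
      deriv_exp_neg', deriv_const_hMul]
    simp only [HalfParams.pert1, HalfParams.pert2, HalfParams.zFree, lower]
    linear_combination (-(3 / 20) * Real.cos s ^ 2 * p.b1 ^ 2 * r ^ 3 - Real.sin s * p.b3 * r ^ 2 + (1 / 8) * p.b1 ^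
      2 * r ^ 3) * Real.sin_sq_add_cos_sq s
  · simp only [Real.cos_pi, Real.sin_pi, Real.cos_zero, Real.sin_zero, Real.exp_zero, neg_zero]; ring

set_option linter.unusedSimpArgs true

theorem one_lt_exp_pi : 1 < Real.exp Real.pi := Real.one_lt_exp_iff.2 Real.pi_pos

/-- The bifurcation function without the division by `denom p`. -/
theorem bifurcation_poly (p : Params) (h : denom p ≠ 0) (r : ℝ) :
    -denom p / (40 * (Real.exp Real.pi - 1)) * (A0 p + A1 p * r + r ^ 3) =
      (80 * p.b2 * (1 - Real.exp Real.pi) - 40 * p.a0 * ((1 + Real.exp Real.pi) * (p.b1 - p.a1)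
        - p.a1 * Real.pi * (1 - Real.exp Real.pi)) * r - denom p * r ^ 3)
        / (40 * (Real.exp Real.pi - 1)) := by
  have h1 : Real.exp Real.pi - 1 ≠ 0 := (sub_pos.2 one_lt_exp_pi).ne'
  unfold A0 A1
  field_simp
  ring

/-- With `exp (-π) = 1 / E` this is an identity of rational functions in `E`. Both fast shifts
contain `1 + 1 / E`, which cancels the factor `E + 1` of `1 - 1 / E²`. -/
theorem turnBifurcation_eq (p : Params) (h : denom p ≠ 0) {r : ℝ} (hr : r ≠ 0) :
    turnBifurcation (upper p) (lower p) (p.a1 * (1 + Real.exp (-Real.pi)) / 2)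
      (-p.b1 * (1 + Real.exp (-Real.pi)) / 2) r =
      -denom p / (40 * (Real.exp Real.pi - 1)) * (A0 p + A1 p * r + r ^ 3) := by
  rw [bifurcation_poly p h, turnBifurcation, fastShift_upper, fastShift_lower,
    slowDrift₂_upper p hr, slowDrift₂_lower, denom, Real.exp_neg]
  have h0 := one_lt_exp_pi
  generalize Real.exp Real.pi = E at h0
  have h1 : E - 1 ≠ 0 := (sub_pos.2 h0).ne'
  have h2 : E ≠ 0 := by positivity
  have h3 : E + 1 ≠ 0 := by positivity
  have h4 : 1 - E⁻¹ ^ 2 = (E - 1) * (E + 1) / E ^ 2 := by field_simp; ring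
  rw [h4]
  field_simp
  ring

/-! ### The averaged functions in cylindrical coordinates. -/

/-- The linear map `(u, v) ↦ (u, a u + b v)`. -/
noncomputable def shear (a b : ℝ) : ℝ × ℝ →L[ℝ] ℝ × ℝ :=
  (ContinuousLinearMap.fst ℝ ℝ ℝ).prod
    (a • ContinuousLinearMap.fst ℝ ℝ ℝ + b • ContinuousLinearMap.snd ℝ ℝ ℝ)

theorem shear_apply (a b : ℝ) (v : ℝ × ℝ) : shear a b v = (v.1, a * v.1 + b * v.2) := rfl

theorem inverse_shear (a : ℝ) {b : ℝ} (hb : b ≠ 0) : (shear a b).inverse = shear (-a / b) b⁻¹ := by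
  refine ContinuousLinearMap.inverse_eq ?_ ?_ <;>
  · ext <;> simp [shear_apply] <;> field_simp <;> ring

/-- `exp s * f` is an antiderivative of `exp s * g` along the circle, because `g` is `f` plus its
angular derivative. -/
theorem unperturbedFlow_quadF (θ : ℝ) (ρ : ℝ × ℝ) :
    unperturbedFlow quadF θ ρ = (ρ.1, HalfParams.zFree ρ.1 (ρ.2 - 2 * ρ.1 ^ 2) θ) := by
  obtain ⟨r, z⟩ := ρ
  have he : Real.exp (-θ) * Real.exp θ = 1 := by rw [← Real.exp_add, neg_add_cancel, Real.exp_zero]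
  have h : ∫ s in (0 : ℝ)..θ, Real.exp s * companion quadF (r * Real.cos s) (r * Real.sin s) =
      Real.exp θ * (2 * (Real.cos θ * r) ^ 2 - (Real.sin θ * r) ^ 2) - 2 * r ^ 2 := by
    simp only [companion_quadF]
    refine (integral_eq_of_antideriv
      (F := fun s => Real.exp s * (2 * (Real.cos s * r) ^ 2 - (Real.sin s * r) ^ 2))
      (fun s => HasDerivAt.congr_deriv (DifferentiableAt.hasDerivAt (by fun_prop)) ?_)
      (by fun_prop) _ _).trans ?_
    · simp (disch := fun_prop) only [deriv_fun_sub, deriv_fun_mul, deriv_fun_pow, deriv_const',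
        Real.deriv_cos', Real.deriv_sin, Real.deriv_exp]
      ring
    · simp
  rw [unperturbedFlow, HalfParams.zFree]
  simp only [h, Prod.mk.injEq, true_and]
  linear_combination (2 * (Real.cos θ * r) ^ 2 - (Real.sin θ * r) ^ 2) * he

theorem fundMatrix_quadF (θ : ℝ) (ρ : ℝ × ℝ) : fundMatrix quadF θ ρ =
    shear (2 * ρ.1 * (2 * Real.cos θ ^ 2 - Real.sin θ ^ 2) - 4 * ρ.1 * Real.exp (-θ))
      (Real.exp (-θ)) := by
  have h : unperturbedFlow quadF θ = fun ρ => (ρ.1, HalfParams.zFree ρ.1 (ρ.2 - 2 * ρ.1 ^ 2) θ) :=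
    funext (unperturbedFlow_quadF θ)
  rw [fundMatrix, h]
  refine HasFDerivAt.fderiv ?_
  have h1 : HasFDerivAt (fun ρ : ℝ × ℝ => ρ.1) (ContinuousLinearMap.fst ℝ ℝ ℝ) ρ := hasFDerivAt_fst
  have h2 : HasFDerivAt (fun ρ : ℝ × ℝ => ρ.2) (ContinuousLinearMap.snd ℝ ℝ ℝ) ρ := hasFDerivAt_snd
  have h3 := (((h1.const_mul (Real.cos θ)).pow 2).const_mul 2).sub ((h1.const_mul (Real.sin θ)).pow 2)
  have h4 := h3.add ((h2.sub ((h1.pow 2).const_mul 2)).const_mul (Real.exp (-θ)))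
  refine (h1.prodMk h4).congr_fderiv ?_
  ext <;> simp [shear_apply] <;> ring

theorem inverse_fundMatrix_quadF (θ : ℝ) (ρ : ℝ × ℝ) : (fundMatrix quadF θ ρ).inverse =
    shear (4 * ρ.1 - Real.exp θ * (2 * ρ.1 * (2 * Real.cos θ ^ 2 - Real.sin θ ^ 2)))
      (Real.exp θ) := by
  rw [fundMatrix_quadF, inverse_shear _ (Real.exp_ne_zero _), Real.exp_neg, inv_inv]
  congr 1
  field_simp
  ring

theorem inverse_fundMatrix_apply (θ : ℝ) (ρ v : ℝ × ℝ) :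
    (fundMatrix quadF θ ρ).inverse (fundMatrix quadF θ ρ v) = v := by
  have he : Real.exp θ * Real.exp (-θ) = 1 := by rw [← Real.exp_add, add_neg_cancel, Real.exp_zero]
  rw [inverse_fundMatrix_quadF, fundMatrix_quadF, shear_apply, shear_apply]
  refine Prod.ext rfl ?_
  linear_combination (v.2 - 4 * ρ.1 * v.1) * he

/-- The common form of the cylindrical field on both sides of the switching plane. -/
noncomputable def polarField (c d α β w ε : ℝ) : ℝ × ℝ :=
  (c * (ε * α + ε ^ 2 * β) / (1 + d * (ε * α + ε ^ 2 * β)), w / (1 + d * (ε * α + ε ^ 2 * β)))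

/-- `(g(r cos θ, r sin θ) - z)`. -/
noncomputable def heightRate (θ : ℝ) (ρ : ℝ × ℝ) : ℝ :=
  (2 * Real.cos θ ^ 2 - 6 * Real.cos θ * Real.sin θ - Real.sin θ ^ 2) * ρ.1 ^ 2 - ρ.2

/-- The unperturbed angular speed is `1`, and each side perturbs a single Cartesian component. The
radial and angular effects are thus one scalar times `c` and `d`: `(cos, -sin / r)` above and `(sin,
cos / r)` below. -/
theorem cylindricalField_upper (p : Params) {θ : ℝ} (hθ : θ ≤ Real.pi) {ρ : ℝ × ℝ} (hr : ρ.1 ≠ 0) :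
    cylindricalField p quadF θ ρ = polarField (Real.cos θ) (-Real.sin θ / ρ.1)
      (p.a0 + p.a1 * ρ.2) (p.a2 + p.a3 * ρ.2) (heightRate θ ρ) := by
  funext ε
  have h1 : (ρ.1 * Real.cos θ * Real.cos θ - (-(ρ.1 * Real.sin θ) + ε * (p.a0 + p.a1 * ρ.2)
      + ε ^ 2 * (p.a2 + p.a3 * ρ.2)) * Real.sin θ) / ρ.1 =
      1 + -Real.sin θ / ρ.1 * (ε * (p.a0 + p.a1 * ρ.2) + ε ^ 2 * (p.a2 + p.a3 * ρ.2)) := by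
    field_simp
    linear_combination ρ.1 * Real.sin_sq_add_cos_sq θ
  simp only [cylindricalField, if_pos hθ, fieldPlus, h1, polarField, companion_quadF, heightRate]
  congr 2 <;> ring

theorem cylindricalField_lower (p : Params) {θ : ℝ} (hθ : Real.pi < θ) {ρ : ℝ × ℝ} (hr : ρ.1 ≠ 0) :
    cylindricalField p quadF θ ρ = polarField (Real.sin θ) (Real.cos θ / ρ.1)
      (0 + p.b1 * ρ.2) (p.b2 + p.b3 * ρ.2) (heightRate θ ρ) := by
  funext ε
  have h1 : ((ρ.1 * Real.cos θ + ε * (p.b1 * ρ.2) + ε ^ 2 * (p.b2 + p.b3 * ρ.2)) * Real.cos θ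
      - -(ρ.1 * Real.sin θ) * Real.sin θ) / ρ.1 =
      1 + Real.cos θ / ρ.1 * (ε * (0 + p.b1 * ρ.2) + ε ^ 2 * (p.b2 + p.b3 * ρ.2)) := by
    field_simp
    linear_combination ρ.1 * Real.sin_sq_add_cos_sq θ
  simp only [cylindricalField, if_neg (not_le.2 hθ), fieldMinus, h1, polarField, companion_quadF,
    heightRate]
  congr 2 <;> ring

theorem hasDerivAt_polarField (c d α β w : ℝ) {ε : ℝ} (h : 1 + d * (ε * α + ε ^ 2 * β) ≠ 0) :
    HasDerivAt (polarField c d α β w)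
      (c * (α + 2 * ε * β) / (1 + d * (ε * α + ε ^ 2 * β)) ^ 2,
        -w * d * (α + 2 * ε * β) / (1 + d * (ε * α + ε ^ 2 * β)) ^ 2) ε := by
  have h1 : HasDerivAt (fun ε : ℝ => ε * α + ε ^ 2 * β) (α + 2 * ε * β) ε := by
    refine (((hasDerivAt_id ε).mul_const α).add
      ((hasDerivAt_pow 2 ε).mul_const β)).congr_deriv ?_
    simp
  have h2 := (h1.const_mul d).const_add 1
  refine (((h1.const_mul c).div h2 h).prodMk ((hasDerivAt_const ε w).div h2 h)).congr_deriv ?_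
  refine Prod.ext ?_ ?_
  · simp only; ring
  · simp only; ring

theorem iteratedDeriv_one_polarField (c d α β w : ℝ) :
    iteratedDeriv 1 (polarField c d α β w) 0 = (c * α, -w * d * α) := by
  rw [iteratedDeriv_one, (hasDerivAt_polarField c d α β w (by simp)).deriv]
  simp

theorem iteratedDeriv_two_polarField (c d α β w : ℝ) :
    iteratedDeriv 2 (polarField c d α β w) 0 =
      (2 * (c * (β - d * α ^ 2)), 2 * (w * (d ^ 2 * α ^ 2 - d * β))) := by
  have h0 : ∀ᶠ ε in 𝓝 (0 : ℝ), 1 + d * (ε * α + ε ^ 2 * β) ≠ 0 := by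
    have : ContinuousAt (fun ε : ℝ => 1 + d * (ε * α + ε ^ 2 * β)) 0 := by fun_prop
    exact this.eventually_ne (by simp)
  -- The formula for the first derivative is valid only where the denominator is nonzero, which
  -- holds near `ε = 0`.
  have h1 : deriv (polarField c d α β w) =ᶠ[𝓝 0] fun ε =>
      (c * (α + 2 * ε * β) / (1 + d * (ε * α + ε ^ 2 * β)) ^ 2,
        -w * d * (α + 2 * ε * β) / (1 + d * (ε * α + ε ^ 2 * β)) ^ 2) :=
    h0.mono fun ε h => (hasDerivAt_polarField c d α β w h).deriv
  rw [iteratedDeriv_succ, iteratedDeriv_one, h1.deriv_eq]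
  have h2 : HasDerivAt (fun ε : ℝ => ε * α + ε ^ 2 * β) α 0 := by
    refine (((hasDerivAt_id (0 : ℝ)).mul_const α).add
      ((hasDerivAt_pow 2 (0 : ℝ)).mul_const β)).congr_deriv ?_
    simp
  have h3 : HasDerivAt (fun ε : ℝ => (1 + d * (ε * α + ε ^ 2 * β)) ^ 2) (2 * (d * α)) 0 := by
    refine (((h2.const_mul d).const_add 1).pow 2).congr_deriv ?_
    simp
  have h4 : HasDerivAt (fun ε : ℝ => α + 2 * ε * β) (2 * β) 0 := by
    refine ((((hasDerivAt_id (0 : ℝ)).const_mul 2).mul_const β).const_add α).congr_deriv ?_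
    simp
  have h5 : (1 + d * ((0 : ℝ) * α + 0 ^ 2 * β)) ^ 2 ≠ 0 := by simp
  refine (((h4.const_mul c).div h3 h5).prodMk ((h4.const_mul (-w * d)).div h3 h5)).deriv.trans ?_
  refine Prod.ext ?_ ?_
  · simp; ring
  · simp; ring

/-- Coefficient of `ε` of the cylindrical field, on either side. -/
noncomputable def coeffOne (c d α₀ α₁ θ : ℝ) (ρ : ℝ × ℝ) : ℝ × ℝ :=
  (c * (α₀ + α₁ * ρ.2), -heightRate θ ρ * (d / ρ.1) * (α₀ + α₁ * ρ.2))

/-- Coefficient of `ε ^ 2` of the cylindrical field, on either side. -/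
noncomputable def coeffTwo (c d α₀ α₁ β₀ β₁ θ : ℝ) (ρ : ℝ × ℝ) : ℝ × ℝ :=
  (c * (β₀ + β₁ * ρ.2 - d / ρ.1 * (α₀ + α₁ * ρ.2) ^ 2),
    heightRate θ ρ * ((d / ρ.1) ^ 2 * (α₀ + α₁ * ρ.2) ^ 2 - d / ρ.1 * (β₀ + β₁ * ρ.2)))

theorem fieldCoeff_zero (p : Params) (θ : ℝ) {ρ : ℝ × ℝ} (hr : ρ.1 ≠ 0) :
    fieldCoeff p quadF 0 θ ρ = (0, heightRate θ ρ) := by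
  rw [fieldCoeff, iteratedDeriv_zero]
  rcases le_or_gt θ Real.pi with h | h
  · rw [cylindricalField_upper p h hr]; simp [polarField]
  · rw [cylindricalField_lower p h hr]; simp [polarField]

theorem fieldCoeff_one_upper (p : Params) {θ : ℝ} (hθ : θ ≤ Real.pi) {ρ : ℝ × ℝ} (hr : ρ.1 ≠ 0) :
    fieldCoeff p quadF 1 θ ρ = coeffOne (Real.cos θ) (-Real.sin θ) p.a0 p.a1 θ ρ := by
  rw [fieldCoeff, cylindricalField_upper p hθ hr, iteratedDeriv_one_polarField, coeffOne]
  simp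

theorem fieldCoeff_one_lower (p : Params) {θ : ℝ} (hθ : Real.pi < θ) {ρ : ℝ × ℝ} (hr : ρ.1 ≠ 0) :
    fieldCoeff p quadF 1 θ ρ = coeffOne (Real.sin θ) (Real.cos θ) 0 p.b1 θ ρ := by
  rw [fieldCoeff, cylindricalField_lower p hθ hr, iteratedDeriv_one_polarField, coeffOne]
  simp

theorem fieldCoeff_two_upper (p : Params) {θ : ℝ} (hθ : θ ≤ Real.pi) {ρ : ℝ × ℝ} (hr : ρ.1 ≠ 0) :
    fieldCoeff p quadF 2 θ ρ =
      coeffTwo (Real.cos θ) (-Real.sin θ) p.a0 p.a1 p.a2 p.a3 θ ρ := by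
  rw [fieldCoeff, cylindricalField_upper p hθ hr, iteratedDeriv_two_polarField, coeffTwo]
  simp [Nat.factorial]

theorem fieldCoeff_two_lower (p : Params) {θ : ℝ} (hθ : Real.pi < θ) {ρ : ℝ × ℝ} (hr : ρ.1 ≠ 0) :
    fieldCoeff p quadF 2 θ ρ =
      coeffTwo (Real.sin θ) (Real.cos θ) 0 p.b1 p.b2 p.b3 θ ρ := by
  rw [fieldCoeff, cylindricalField_lower p hθ hr, iteratedDeriv_two_polarField, coeffTwo]
  simp [Nat.factorial]

theorem hasFDerivAt_heightRate (θ : ℝ) (ρ : ℝ × ℝ) : HasFDerivAt (heightRate θ)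
    ((2 * (2 * Real.cos θ ^ 2 - 6 * Real.cos θ * Real.sin θ - Real.sin θ ^ 2) * ρ.1) •
      ContinuousLinearMap.fst ℝ ℝ ℝ - ContinuousLinearMap.snd ℝ ℝ ℝ) ρ := by
  have h1 : HasFDerivAt (fun ρ : ℝ × ℝ => ρ.1) (ContinuousLinearMap.fst ℝ ℝ ℝ) ρ := hasFDerivAt_fst
  have h2 : HasFDerivAt (fun ρ : ℝ × ℝ => ρ.2) (ContinuousLinearMap.snd ℝ ℝ ℝ) ρ := hasFDerivAt_snd
  refine (((h1.pow 2).const_mul _).sub h2).congr_fderiv ?_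
  ext <;> simp <;> ring

/-- The derivative of `coeffOne` at `ρ` in direction `v`. -/
noncomputable def coeffOneDeriv (c d α₀ α₁ θ : ℝ) (ρ v : ℝ × ℝ) : ℝ × ℝ :=
  (c * α₁ * v.2, -(2 * (2 * Real.cos θ ^ 2 - 6 * Real.cos θ * Real.sin θ - Real.sin θ ^ 2) * ρ.1 * v.1
      - v.2) * (d / ρ.1) * (α₀ + α₁ * ρ.2) + heightRate θ ρ * (d / ρ.1 ^ 2) * v.1 * (α₀ + α₁ * ρ.2)
      - heightRate θ ρ * (d / ρ.1) * (α₁ * v.2))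

theorem fderiv_coeffOne (c d α₀ α₁ θ : ℝ) {ρ : ℝ × ℝ} (hr : ρ.1 ≠ 0) (v : ℝ × ℝ) :
    fderiv ℝ (coeffOne c d α₀ α₁ θ) ρ v = coeffOneDeriv c d α₀ α₁ θ ρ v := by
  have h1 : HasFDerivAt (fun ρ : ℝ × ℝ => ρ.1) (ContinuousLinearMap.fst ℝ ℝ ℝ) ρ := hasFDerivAt_fst
  have h2 : HasFDerivAt (fun ρ : ℝ × ℝ => ρ.2) (ContinuousLinearMap.snd ℝ ℝ ℝ) ρ := hasFDerivAt_snd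
  have h3 := (h2.const_mul α₁).const_add α₀
  have h4 := ((hasDerivAt_inv hr).comp_hasFDerivAt ρ h1).const_mul d
  have h5 := (h3.const_mul c).prodMk (((hasFDerivAt_heightRate θ ρ).neg.mul h4).mul h3)
  have h6 : HasFDerivAt (coeffOne c d α₀ α₁ θ) _ ρ := h5
  rw [h6.fderiv, coeffOneDeriv]
  refine Prod.ext ?_ ?_
  · simp; ring
  · simp; field_simp; ring

/-- `F₀` is quadratic in `r` and affine in `z`, so only `∂²/∂r²` survives. The closed form holds for
`r ≠ 0`, hence the passage through a neighbourhood. -/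
theorem fderiv_fderiv_fieldCoeff_zero (p : Params) (θ : ℝ) {ρ : ℝ × ℝ} (hr : ρ.1 ≠ 0) (v : ℝ × ℝ) :
    fderiv ℝ (fderiv ℝ (fieldCoeff p quadF 0 θ)) ρ v v =
      (0, 2 * (2 * Real.cos θ ^ 2 - 6 * Real.cos θ * Real.sin θ - Real.sin θ ^ 2) * v.1 ^ 2) := by
  set K := 2 * Real.cos θ ^ 2 - 6 * Real.cos θ * Real.sin θ - Real.sin θ ^ 2 with hK
  have hne : ∀ᶠ q in 𝓝 ρ, q.1 ≠ 0 := continuousAt_fst.eventually_ne hr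
  have h1 : ∀ᶠ q in 𝓝 ρ, fderiv ℝ (fieldCoeff p quadF 0 θ) q =
      (0 : ℝ × ℝ →L[ℝ] ℝ).prod ((2 * K * q.1) • ContinuousLinearMap.fst ℝ ℝ ℝ
        - ContinuousLinearMap.snd ℝ ℝ ℝ) := by
    filter_upwards [hne.eventually_nhds] with q hq
    have : HasFDerivAt (fun q => ((0 : ℝ), heightRate θ q)) _ q :=
      (hasFDerivAt_const (0 : ℝ) q).prodMk (hasFDerivAt_heightRate θ q)
    exact (this.congr_of_eventuallyEq (hq.mono fun x hx => fieldCoeff_zero p θ hx)).fderiv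
  set L₁ : ℝ × ℝ →L[ℝ] ℝ × ℝ := (0 : ℝ × ℝ →L[ℝ] ℝ).prod ((2 * K) • ContinuousLinearMap.fst ℝ ℝ ℝ)
  set L₀ : ℝ × ℝ →L[ℝ] ℝ × ℝ := (0 : ℝ × ℝ →L[ℝ] ℝ).prod (-ContinuousLinearMap.snd ℝ ℝ ℝ)
  have h2 : HasFDerivAt (fun q : ℝ × ℝ => q.1 • L₁ + L₀)
      ((ContinuousLinearMap.fst ℝ ℝ ℝ).smulRight L₁) ρ :=
    (((ContinuousLinearMap.fst ℝ ℝ ℝ).hasFDerivAt (x := ρ)).smul_const L₁).add_const L₀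
  have h3 : HasFDerivAt (fderiv ℝ (fieldCoeff p quadF 0 θ))
      ((ContinuousLinearMap.fst ℝ ℝ ℝ).smulRight L₁) ρ := by
    refine h2.congr_of_eventuallyEq (h1.mono fun q hq => ?_)
    rw [hq]
    ext <;> simp [L₁, L₀] <;> ring
  rw [h3.fderiv]
  refine Prod.ext ?_ ?_
  · simp [L₁]
  · simp [L₁]; ring

theorem integral_fst {U : ℝ → ℝ × ℝ} (hU : Continuous U) (a b : ℝ) :
    (∫ s in a..b, U s).1 = ∫ s in a..b, (U s).1 :=
  ((ContinuousLinearMap.fst ℝ ℝ ℝ).intervalIntegral_comp_comm (hU.intervalIntegrable a b)).symm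

theorem integral_snd {U : ℝ → ℝ × ℝ} (hU : Continuous U) (a b : ℝ) :
    (∫ s in a..b, U s).2 = ∫ s in a..b, (U s).2 :=
  ((ContinuousLinearMap.snd ℝ ℝ ℝ).intervalIntegral_comp_comm (hU.intervalIntegrable a b)).symm

theorem integral_upper {E : Type*} [NormedAddCommGroup E] [NormedSpace ℝ E] {I U : ℝ → E}
    (h : ∀ s ∈ Icc 0 Real.pi, I s = U s) {t : ℝ} (ht : t ∈ Icc 0 Real.pi) :
    ∫ s in (0 : ℝ)..t, I s = ∫ s in (0 : ℝ)..t, U s := by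
  refine intervalIntegral.integral_congr fun s hs => h s ?_
  rw [uIcc_of_le ht.1] at hs
  exact ⟨hs.1, hs.2.trans ht.2⟩

/-- The field jumps at `θ = π`, where the upper branch is used; a single point does not affect the
second integral. -/
theorem integral_lower {E : Type*} [NormedAddCommGroup E] [NormedSpace ℝ E] {I U L : ℝ → E}
    (hU : Continuous U) (hL : Continuous L) (h : ∀ s ∈ Icc 0 Real.pi, I s = U s)
    (h' : ∀ s ∈ Ioi Real.pi, I s = L s) {t : ℝ} (ht : Real.pi ≤ t) :
    ∫ s in (0 : ℝ)..t, I s = (∫ s in (0 : ℝ)..Real.pi, U s) + ∫ s in Real.pi..t, L s := by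
  have hπ := Real.pi_pos.le
  have h1 : EqOn U I (uIoc 0 Real.pi) := fun s hs => by
    rw [uIoc_of_le hπ] at hs
    exact (h s (Ioc_subset_Icc_self hs)).symm
  have h2 : EqOn L I (uIoc Real.pi t) := fun s hs => by
    rw [uIoc_of_le ht] at hs
    exact (h' s hs.1).symm
  rw [← intervalIntegral.integral_add_adjacent_intervals
    ((hU.intervalIntegrable 0 Real.pi).congr h1) ((hL.intervalIntegrable Real.pi t).congr h2)]
  congr 1
  · exact intervalIntegral.integral_congr_ae (.of_forall fun s hs => (h1 hs).symm)
  · exact intervalIntegral.integral_congr_ae (.of_forall fun s hs => (h2 hs).symm)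

/-- The integrand of `y1` on either side. -/
noncomputable def driveOne (c d : ℝ → ℝ) (α₀ α₁ r ζ s : ℝ) : ℝ × ℝ :=
  shear (4 * r - Real.exp s * (2 * r * (2 * Real.cos s ^ 2 - Real.sin s ^ 2))) (Real.exp s)
    (coeffOne (c s) (d s) α₀ α₁ s (r, HalfParams.zFree r ζ s))

theorem continuous_driveOne {c d : ℝ → ℝ} (hc : Continuous c) (hd : Continuous d) (α₀ α₁ r ζ : ℝ) :
    Continuous (driveOne c d α₀ α₁ r ζ) := by
  unfold driveOne coeffOne HalfParams.zFree heightRate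
  simp only [shear_apply]
  fun_prop

theorem continuous_driveOne_upper (α₀ α₁ r ζ : ℝ) :
    Continuous (driveOne Real.cos (fun s => -Real.sin s) α₀ α₁ r ζ) :=
  continuous_driveOne Real.continuous_cos Real.continuous_sin.neg _ _ _ _

theorem continuous_driveOne_lower (α₀ α₁ r ζ : ℝ) :
    Continuous (driveOne Real.sin Real.cos α₀ α₁ r ζ) :=
  continuous_driveOne Real.continuous_sin Real.continuous_cos _ _ _ _

theorem driveOne_upper_eq (p : Params) {r : ℝ} (hr : r ≠ 0) (b : ℝ) {s : ℝ} (hs : s ≤ Real.pi) :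
    (fundMatrix quadF s (r, b)).inverse (fieldCoeff p quadF 1 s (unperturbedFlow quadF s (r, b))) =
      driveOne Real.cos (fun s => -Real.sin s) p.a0 p.a1 r (b - 2 * r ^ 2) s := by
  rw [inverse_fundMatrix_quadF, unperturbedFlow_quadF, fieldCoeff_one_upper p hs (by exact hr),
    driveOne]

theorem driveOne_lower_eq (p : Params) {r : ℝ} (hr : r ≠ 0) (b : ℝ) {s : ℝ} (hs : Real.pi < s) :
    (fundMatrix quadF s (r, b)).inverse (fieldCoeff p quadF 1 s (unperturbedFlow quadF s (r, b))) =
      driveOne Real.sin Real.cos 0 p.b1 r (b - 2 * r ^ 2) s := by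
  rw [inverse_fundMatrix_quadF, unperturbedFlow_quadF, fieldCoeff_one_lower p hs (by exact hr),
    driveOne]

theorem g1_eq (p : Params) {r : ℝ} (hr : r ≠ 0) (b : ℝ) : g1 p quadF (r, b) =
    (∫ s in (0 : ℝ)..Real.pi,
      driveOne Real.cos (fun s => -Real.sin s) p.a0 p.a1 r (b - 2 * r ^ 2) s)
    + ∫ s in Real.pi..(2 * Real.pi), driveOne Real.sin Real.cos 0 p.b1 r (b - 2 * r ^ 2) s := by
  rw [g1, y1, inverse_fundMatrix_apply]
  exact integral_lower (continuous_driveOne_upper _ _ _ _)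
    (continuous_driveOne_lower _ _ _ _)
    (fun s hs => driveOne_upper_eq p hr b hs.2) (fun s hs => driveOne_lower_eq p hr b hs)
    (by linarith [Real.pi_pos])

/-- The radial component of `Y⁻¹ F₁` is the integrand of the slow drift. Shifted by `π`, the lower
part is the drift of a rotated half turn that starts at height `exp (-π) ζ`, with `ζ = b - 2 r²`. -/
theorem g1_fst (p : Params) {r : ℝ} (hr : r ≠ 0) (b : ℝ) : (g1 p quadF (r, b)).1 =
    (p.a1 - Real.exp (-Real.pi) * p.b1) * (1 + Real.exp (-Real.pi)) / 2 * (b - 2 * r ^ 2) := by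
  rw [g1_eq p hr, Prod.fst_add,
    integral_fst (continuous_driveOne_upper _ _ _ _),
    integral_fst (continuous_driveOne_lower _ _ _ _)]
  have h1 := slowDrift_upper p r (b - 2 * r ^ 2)
  have h2 := slowDrift_lower p r (Real.exp (-Real.pi) * (b - 2 * r ^ 2))
  simp only [HalfParams.slowDrift, HalfParams.pert1, HalfParams.pert2, upper, lower] at h1 h2
  have h3 : ∫ s in Real.pi..(2 * Real.pi),
      (driveOne Real.sin Real.cos 0 p.b1 r (b - 2 * r ^ 2) s).1 =
      -p.b1 * (1 + Real.exp (-Real.pi)) / 2 * (Real.exp (-Real.pi) * (b - 2 * r ^ 2)) := by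
    rw [← h2]
    have := intervalIntegral.integral_comp_add_right (a := 0) (b := Real.pi)
      (fun s => (driveOne Real.sin Real.cos 0 p.b1 r (b - 2 * r ^ 2) s).1) Real.pi
    rw [zero_add, ← two_mul] at this
    rw [← this]
    congr 1
    funext s
    simp only [driveOne, coeffOne, shear_apply, HalfParams.zFree, Real.sin_add_pi, Real.cos_add_pi,
      neg_add, Real.exp_add]
    ring
  rw [h3]
  have h4 : ∫ s in (0 : ℝ)..Real.pi,
      (driveOne Real.cos (fun s => -Real.sin s) p.a0 p.a1 r (b - 2 * r ^ 2) s).1 =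
      p.a1 * (1 + Real.exp (-Real.pi)) / 2 * (b - 2 * r ^ 2) := by
    rw [← h1]
    congr 1
    funext s
    simp only [driveOne, coeffOne, shear_apply]
    ring
  rw [h4]
  ring

theorem deriv_g1_fst (p : Params) {r : ℝ} (hr : r ≠ 0) (b : ℝ) :
    deriv (fun b => (g1 p quadF (r, b)).1) b =
      (p.a1 - Real.exp (-Real.pi) * p.b1) * (1 + Real.exp (-Real.pi)) / 2 := by
  simp only [g1_fst p hr]
  exact ((((hasDerivAt_id b).sub_const (2 * r ^ 2)).const_mul _).congr_deriv (mul_one _)).deriv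

theorem cornerDelta_quadF (r : ℝ) : cornerDelta quadF r = 1 - Real.exp (2 * Real.pi) := by
  rw [cornerDelta, inverse_fundMatrix_quadF, shear_apply]
  simp

/-- On the paraboloid the unperturbed height rate is `-6 r² cos s sin s`, so `Y⁻¹ F₁` collapses to
an explicit multiple of the radial rate. -/
theorem driveOne_upper_zero (p : Params) {r : ℝ} (hr : r ≠ 0) (s : ℝ) :
    driveOne Real.cos (fun s => -Real.sin s) p.a0 p.a1 r 0 s =
      (Real.cos s * (p.a0 + p.a1 * (r ^ 2 * (2 * Real.cos s ^ 2 - Real.sin s ^ 2))),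
        4 * r * (1 - Real.exp s) *
          (Real.cos s * (p.a0 + p.a1 * (r ^ 2 * (2 * Real.cos s ^ 2 - Real.sin s ^ 2))))) := by
  simp only [driveOne, coeffOne, shear_apply, HalfParams.zFree, heightRate]
  refine Prod.ext ?_ ?_
  · simp only; ring
  · simp only
    field_simp
    linear_combination (-4 * r ^ 2 * Real.exp s * Real.cos s * (p.a0 + p.a1 * r ^ 2 *
      (2 * Real.cos s ^ 2 - Real.sin s ^ 2))) * Real.sin_sq_add_cos_sq s

theorem driveOne_lower_zero (p : Params) {r : ℝ} (hr : r ≠ 0) (s : ℝ) :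
    driveOne Real.sin Real.cos 0 p.b1 r 0 s =
      (Real.sin s * (p.b1 * (r ^ 2 * (2 * Real.cos s ^ 2 - Real.sin s ^ 2))),
        (4 * r + 2 * r * Real.exp s) *
          (Real.sin s * (p.b1 * (r ^ 2 * (2 * Real.cos s ^ 2 - Real.sin s ^ 2))))) := by
  simp only [driveOne, coeffOne, shear_apply, HalfParams.zFree, heightRate]
  refine Prod.ext ?_ ?_
  · simp only; ring
  · simp only
    field_simp
    linear_combination (2 * r ^ 4 * Real.exp s * Real.sin s * p.b1 *
      (2 * Real.cos s ^ 2 - Real.sin s ^ 2)) * Real.sin_sq_add_cos_sq s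

set_option linter.unusedSimpArgs false

theorem integral_radial_upper (p : Params) (r t : ℝ) :
    ∫ s in (0 : ℝ)..t, Real.cos s * (p.a0 + p.a1 * (r ^ 2 * (2 * Real.cos s ^ 2 - Real.sin s ^ 2))) =
      Real.cos t ^ 2 * Real.sin t * p.a1 * r ^ 2 + Real.sin t * p.a0 + Real.sin t * p.a1 * r ^ 2 := by
  refine (integral_eq_of_antideriv (F := fun s => Real.cos s ^ 2 * Real.sin s * p.a1 * r ^ 2 + Real.sin s * p.a0 + Real.sin s * p.a1 * r ^ 2)
    (fun s => HasDerivAt.congr_deriv (DifferentiableAt.hasDerivAt (by fun_prop)) ?_)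
    (by fun_prop) _ _).trans ?_
  · simp (disch := fun_prop) only [deriv_fun_add, deriv_fun_sub, deriv_fun_mul, deriv_fun_pow,
      deriv.fun_neg', deriv_const', deriv_id'', Real.deriv_cos', Real.deriv_sin, Real.deriv_exp,
      deriv_exp_neg', deriv_const_hMul]
    linear_combination (-Real.cos s * p.a1 * r ^ 2) * Real.sin_sq_add_cos_sq s
  · simp only [Real.cos_zero, Real.sin_zero, Real.exp_zero]; ring

theorem integral_height_upper (p : Params) (r t : ℝ) :
    ∫ s in (0 : ℝ)..t, 4 * r * (1 - Real.exp s) *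
      (Real.cos s * (p.a0 + p.a1 * (r ^ 2 * (2 * Real.cos s ^ 2 - Real.sin s ^ 2)))) =
      -2 * Real.cos t * Real.exp t * p.a0 * r - (8 / 5) * Real.cos t * Real.exp t * p.a1 * r ^ 3 -
      (18 / 5) * Real.cos t ^ 2 * Real.exp t * Real.sin t * p.a1 * r ^ 3 + 4 * Real.cos t ^ 2 *
      Real.sin t * p.a1 * r ^ 3 - (6 / 5) * Real.cos t ^ 3 * Real.exp t * p.a1 * r ^ 3 - 2 *
      Real.exp t * Real.sin t * p.a0 * r - (8 / 5) * Real.exp t * Real.sin t * p.a1 * r ^ 3 + 4 *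
      Real.sin t * p.a0 * r + 4 * Real.sin t * p.a1 * r ^ 3 + 2 * p.a0 * r + (14 / 5) * p.a1 * r ^
      3 := by
  refine (integral_eq_of_antideriv (F := fun s => -2 * Real.cos s * Real.exp s * p.a0 * r - (8 / 5) * Real.cos s * Real.exp s * p.a1 * r ^ 3 -
      (18 / 5) * Real.cos s ^ 2 * Real.exp s * Real.sin s * p.a1 * r ^ 3 + 4 * Real.cos s ^ 2 *
      Real.sin s * p.a1 * r ^ 3 - (6 / 5) * Real.cos s ^ 3 * Real.exp s * p.a1 * r ^ 3 - 2 *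
      Real.exp s * Real.sin s * p.a0 * r - (8 / 5) * Real.exp s * Real.sin s * p.a1 * r ^ 3 + 4 *
      Real.sin s * p.a0 * r + 4 * Real.sin s * p.a1 * r ^ 3 + 2 * p.a0 * r + (14 / 5) * p.a1 * r ^
      3)
    (fun s => HasDerivAt.congr_deriv (DifferentiableAt.hasDerivAt (by fun_prop)) ?_)
    (by fun_prop) _ _).trans ?_
  · simp (disch := fun_prop) only [deriv_fun_add, deriv_fun_sub, deriv_fun_mul, deriv_fun_pow,
      deriv.fun_neg', deriv_const', deriv_id'', Real.deriv_cos', Real.deriv_sin, Real.deriv_exp,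
      deriv_exp_neg', deriv_const_hMul]
    linear_combination ((16 / 5) * Real.cos s * Real.exp s * p.a1 * r ^ 3 - 4 * Real.cos s * p.a1 * r ^ 3) * Real.sin_sq_add_cos_sq s
  · simp only [Real.cos_zero, Real.sin_zero, Real.exp_zero]; ring

theorem integral_radial_lower (p : Params) (r t : ℝ) :
    ∫ s in Real.pi..t, Real.sin s * (p.b1 * (r ^ 2 * (2 * Real.cos s ^ 2 - Real.sin s ^ 2))) =
      Real.cos t * p.b1 * r ^ 2 - Real.cos t ^ 3 * p.b1 * r ^ 2 := by
  refine (integral_eq_of_antideriv (F := fun s => Real.cos s * p.b1 * r ^ 2 - Real.cos s ^ 3 * p.b1 * r ^ 2)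
    (fun s => HasDerivAt.congr_deriv (DifferentiableAt.hasDerivAt (by fun_prop)) ?_)
    (by fun_prop) _ _).trans ?_
  · simp (disch := fun_prop) only [deriv_fun_add, deriv_fun_sub, deriv_fun_mul, deriv_fun_pow,
      deriv.fun_neg', deriv_const', deriv_id'', Real.deriv_cos', Real.deriv_sin, Real.deriv_exp,
      deriv_exp_neg', deriv_const_hMul]
    linear_combination (Real.sin s * p.b1 * r ^ 2) * Real.sin_sq_add_cos_sq s
  · simp only [Real.cos_pi, Real.sin_pi]; ring

theorem integral_height_lower (p : Params) (r t : ℝ) :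
    ∫ s in Real.pi..t, (4 * r + 2 * r * Real.exp s) * (Real.sin s * (p.b1 * (r ^ 2 * (2 * Real.cos s ^ 2 - Real.sin s ^ 2)))) =
      (8 / 5) * Real.cos t * Real.exp t * p.b1 * r ^ 3 + 4 * Real.cos t * p.b1 * r ^ 3 + (3 / 5) *
      Real.cos t ^ 2 * Real.exp t * Real.sin t * p.b1 * r ^ 3 - (9 / 5) * Real.cos t ^ 3 *
      Real.exp t * p.b1 * r ^ 3 - 4 * Real.cos t ^ 3 * p.b1 * r ^ 3 - (2 / 5) * Real.exp t *
      Real.sin t * p.b1 * r ^ 3 - (1 / 5) * Real.exp Real.pi * p.b1 * r ^ 3 := by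
  refine (integral_eq_of_antideriv (F := fun s => (8 / 5) * Real.cos s * Real.exp s * p.b1 * r ^ 3 + 4 * Real.cos s * p.b1 * r ^ 3 + (3 / 5) *
      Real.cos s ^ 2 * Real.exp s * Real.sin s * p.b1 * r ^ 3 - (9 / 5) * Real.cos s ^ 3 *
      Real.exp s * p.b1 * r ^ 3 - 4 * Real.cos s ^ 3 * p.b1 * r ^ 3 - (2 / 5) * Real.exp s *
      Real.sin s * p.b1 * r ^ 3 - (1 / 5) * Real.exp Real.pi * p.b1 * r ^ 3)
    (fun s => HasDerivAt.congr_deriv (DifferentiableAt.hasDerivAt (by fun_prop)) ?_)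
    (by fun_prop) _ _).trans ?_
  · simp (disch := fun_prop) only [deriv_fun_add, deriv_fun_sub, deriv_fun_mul, deriv_fun_pow,
      deriv.fun_neg', deriv_const', deriv_id'', Real.deriv_cos', Real.deriv_sin, Real.deriv_exp,
      deriv_exp_neg', deriv_const_hMul]
    linear_combination (-(6 / 5) * Real.cos s * Real.exp s * p.b1 * r ^ 3 + 2 * Real.exp s * Real.sin s * p.b1 * r ^
      3 + 4 * Real.sin s * p.b1 * r ^ 3) * Real.sin_sq_add_cos_sq s
  · simp only [Real.cos_pi, Real.sin_pi]; ring

/-- `y1` for `θ ∈ [0, π]` on the invariant paraboloid. -/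
noncomputable def y1Upper (p : Params) (r s : ℝ) : ℝ × ℝ :=
  (Real.cos s ^ 2 * Real.sin s * p.a1 * r ^ 2 + Real.sin s * p.a0 + Real.sin s * p.a1 * r ^ 2,
    -2 * Real.cos s * p.a0 * r - (8 / 5) * Real.cos s * p.a1 * r ^ 3 + 6 * Real.cos s ^ 2 *
    Real.sin s * p.a0 * r + (2 / 5) * Real.cos s ^ 2 * Real.sin s * p.a1 * r ^ 3 - (6 / 5) *
    Real.cos s ^ 3 * p.a1 * r ^ 3 + 6 * Real.cos s ^ 4 * Real.sin s * p.a1 * r ^ 3 + 2 *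
    Real.exp (-s) * p.a0 * r + (14 / 5) * Real.exp (-s) * p.a1 * r ^ 3 - 4 * Real.sin s * p.a0 * r
    - (18 / 5) * Real.sin s * p.a1 * r ^ 3)

/-- The value at `π` of the drift of `z`, rescaled by `exp π`. -/
noncomputable def halfDrift (p : Params) (r : ℝ) : ℝ :=
  (Real.exp Real.pi + 1) * (2 * p.a0 * r + 14 / 5 * p.a1 * r ^ 3)

/-- `y1` for `θ ≥ π` on the invariant paraboloid, where `j` is `halfDrift`. -/
noncomputable def y1Lower (p : Params) (r j s : ℝ) : ℝ × ℝ :=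
  (Real.cos s * p.b1 * r ^ 2 - Real.cos s ^ 3 * p.b1 * r ^ 2,
    -(2 / 5) * Real.cos s * p.b1 * r ^ 3 + (3 / 5) * Real.cos s ^ 2 * Real.sin s * p.b1 * r ^ 3 +
    (31 / 5) * Real.cos s ^ 3 * p.b1 * r ^ 3 - 6 * Real.cos s ^ 5 * p.b1 * r ^ 3 - (1 / 5) *
    Real.exp (-s) * Real.exp Real.pi * p.b1 * r ^ 3 + Real.exp (-s) * j - (2 / 5) * Real.sin s *
    p.b1 * r ^ 3)

theorem continuous_y1Upper (p : Params) (r : ℝ) : Continuous (y1Upper p r) := by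
  unfold y1Upper; fun_prop

theorem continuous_y1Lower (p : Params) (r j : ℝ) : Continuous (y1Lower p r j) := by
  unfold y1Lower; fun_prop

theorem y1_upper (p : Params) {r t : ℝ} (hr : r ≠ 0) (ht : t ∈ Icc 0 Real.pi) :
    y1 p quadF t (r, 2 * r ^ 2) = y1Upper p r t := by
  have he : Real.exp (-t) * Real.exp t = 1 := by rw [← Real.exp_add, neg_add_cancel, Real.exp_zero]
  have hc := continuous_driveOne_upper p.a0 p.a1 r 0
  rw [y1, integral_upper (U := driveOne Real.cos (fun s => -Real.sin s) p.a0 p.a1 r 0) (fun s hs => by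
    rw [driveOne_upper_eq p hr _ hs.2, sub_self]) ht, fundMatrix_quadF, shear_apply,
    integral_fst hc, integral_snd hc]
  simp only [driveOne_upper_zero p hr, integral_radial_upper, integral_height_upper, y1Upper]
  refine Prod.ext rfl ?_
  linear_combination (-2 * Real.cos t * p.a0 * r - (8 / 5) * Real.cos t * p.a1 * r ^ 3 - (18 / 5) * Real.cos t ^ 2
      * Real.sin t * p.a1 * r ^ 3 - (6 / 5) * Real.cos t ^ 3 * p.a1 * r ^ 3 - 2 * Real.sin t *
      p.a0 * r - (8 / 5) * Real.sin t * p.a1 * r ^ 3) * he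
    + (-2 * Real.cos t ^ 2 * Real.sin t * p.a1 * r ^ 3 - 2 * Real.sin t * p.a0 * r - 2 * Real.sin t
      * p.a1 * r ^ 3) * Real.sin_sq_add_cos_sq t

theorem y1_lower (p : Params) {r t : ℝ} (hr : r ≠ 0) (ht : Real.pi ≤ t) :
    y1 p quadF t (r, 2 * r ^ 2) = y1Lower p r (halfDrift p r) t := by
  have he : Real.exp (-t) * Real.exp t = 1 := by rw [← Real.exp_add, neg_add_cancel, Real.exp_zero]
  have hc := continuous_driveOne_upper p.a0 p.a1 r 0
  have hc' := continuous_driveOne_lower 0 p.b1 r 0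
  rw [y1, integral_lower hc hc' (fun s hs => by rw [driveOne_upper_eq p hr _ hs.2, sub_self])
    (fun s hs => by rw [driveOne_lower_eq p hr _ hs, sub_self]) ht, fundMatrix_quadF, shear_apply,
    Prod.fst_add, Prod.snd_add, integral_fst hc, integral_snd hc, integral_fst hc', integral_snd hc']
  simp only [driveOne_upper_zero p hr, driveOne_lower_zero p hr, integral_radial_upper,
    integral_height_upper, integral_radial_lower, integral_height_lower, y1Lower, Real.cos_pi,
    Real.sin_pi, halfDrift]
  refine Prod.ext ?_ ?_
  · simp only; ring
  · linear_combination ((8 / 5) * Real.cos t * p.b1 * r ^ 3 + (3 / 5) * Real.cos t ^ 2 * Real.sin t * p.b1 * r ^ 3 -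
      (9 / 5) * Real.cos t ^ 3 * p.b1 * r ^ 3 - (2 / 5) * Real.sin t * p.b1 * r ^ 3) * he
      + (-2 * Real.cos t * p.b1 * r ^ 3 + 2 * Real.cos t ^ 3 * p.b1 * r ^ 3) * Real.sin_sq_add_cos_sq t

/-- `q` stands for `1 / r`, which keeps the integrand polynomial; its coefficient integrates to zero
since `cos * sin` has integral `0` over `[0, π]`. -/
theorem integral_second_upper (p : Params) (r q : ℝ) :
    ∫ s in (0 : ℝ)..Real.pi, (Real.cos s * (p.a2 + p.a3 * (r ^ 2 * (2 * Real.cos s ^ 2 - Real.sin s ^ 2)))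
      + Real.cos s * Real.sin s * (p.a0 ^ 2 * q + 2 * p.a0 * p.a1 * r * (2 * Real.cos s ^ 2 - Real.sin s ^ 2)
        + p.a1 ^ 2 * r ^ 3 * (2 * Real.cos s ^ 2 - Real.sin s ^ 2) ^ 2)
      + Real.cos s * p.a1 * (-2 * Real.cos s * p.a0 * r - (8 / 5) * Real.cos s * p.a1 * r ^ 3 + 6 * Real.cos s ^ 2 *
        Real.sin s * p.a0 * r + (2 / 5) * Real.cos s ^ 2 * Real.sin s * p.a1 * r ^ 3 - (6 / 5) *
        Real.cos s ^ 3 * p.a1 * r ^ 3 + 6 * Real.cos s ^ 4 * Real.sin s * p.a1 * r ^ 3 + 2 *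
        Real.exp (-s) * p.a0 * r + (14 / 5) * Real.exp (-s) * p.a1 * r ^ 3 - 4 * Real.sin s * p.a0
        * r - (18 / 5) * Real.sin s * p.a1 * r ^ 3)) =
    (1 + Real.exp (-Real.pi) - Real.pi) * p.a0 * p.a1 * r
      + (7 / 5 * (1 + Real.exp (-Real.pi)) - 5 / 4 * Real.pi) * p.a1 ^ 2 * r ^ 3 := by
  refine (integral_eq_of_antideriv (F := fun s => -Real.cos s * Real.exp (-s) * p.a0 * p.a1 * r - (7 / 5) * Real.cos s * Real.exp (-s) * p.a1
      ^ 2 * r ^ 3 - Real.cos s * Real.sin s * p.a0 * p.a1 * r - (5 / 4) * Real.cos s * Real.sin s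
      * p.a1 ^ 2 * r ^ 3 + Real.cos s ^ 2 * Real.sin s * p.a3 * r ^ 2 + 3 * Real.cos s ^ 2 * p.a0
      * p.a1 * r - (1 / 2) * Real.cos s ^ 2 * p.a0 ^ 2 * q + (13 / 10) * Real.cos s ^ 2 * p.a1 ^ 2
      * r ^ 3 - (3 / 10) * Real.cos s ^ 3 * Real.sin s * p.a1 ^ 2 * r ^ 3 - 3 * Real.cos s ^ 4 *
      p.a0 * p.a1 * r + (7 / 5) * Real.cos s ^ 4 * p.a1 ^ 2 * r ^ 3 - (5 / 2) * Real.cos s ^ 6 *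
      p.a1 ^ 2 * r ^ 3 + Real.exp (-s) * Real.sin s * p.a0 * p.a1 * r + (7 / 5) * Real.exp (-s) *
      Real.sin s * p.a1 ^ 2 * r ^ 3 + Real.sin s * p.a2 + Real.sin s * p.a3 * r ^ 2 - (3 / 8) *
      p.a0 * p.a1 * r - p.a0 * p.a1 * r * s + (1 / 4) * p.a0 ^ 2 * q - (63 / 160) * p.a1 ^ 2 * r ^
      3 - (5 / 4) * p.a1 ^ 2 * r ^ 3 * s)
    (fun s => HasDerivAt.congr_deriv (DifferentiableAt.hasDerivAt (by fun_prop)) ?_)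
    (by fun_prop) _ _).trans ?_
  · simp (disch := fun_prop) only [deriv_fun_add, deriv_fun_sub, deriv_fun_mul, deriv_fun_pow,
      deriv.fun_neg', deriv_const', deriv_id'', Real.deriv_cos', Real.deriv_sin, Real.deriv_exp,
      deriv_exp_neg', deriv_const_hMul]
    linear_combination (2 * Real.cos s * Real.sin s * p.a0 * p.a1 * r - Real.cos s * Real.sin s * p.a1 ^ 2 * r ^ 3 -
      Real.cos s * Real.sin s ^ 3 * p.a1 ^ 2 * r ^ 3 - Real.cos s * p.a3 * r ^ 2 + (9 / 10) *
      Real.cos s ^ 2 * p.a1 ^ 2 * r ^ 3 + 5 * Real.cos s ^ 3 * Real.sin s * p.a1 ^ 2 * r ^ 3 +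
      p.a0 * p.a1 * r + (5 / 4) * p.a1 ^ 2 * r ^ 3) * Real.sin_sq_add_cos_sq s
  · simp only [Real.cos_zero, Real.sin_zero, Real.exp_zero, Real.cos_pi, Real.sin_pi, neg_zero]; ring

/-- `j` stands for the height drift accumulated in the upper half, which enters the lower half
linearly. -/
theorem integral_second_lower (p : Params) (r j : ℝ) :
    ∫ s in Real.pi..(2 * Real.pi), (Real.sin s * (p.b2 + p.b3 * (r ^ 2 * (2 * Real.cos s ^ 2 - Real.sin s ^ 2)))
      - Real.sin s * Real.cos s * (p.b1 ^ 2 * r ^ 3 * (2 * Real.cos s ^ 2 - Real.sin s ^ 2) ^ 2)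
      + Real.sin s * p.b1 * (-(2 / 5) * Real.cos s * p.b1 * r ^ 3 + (3 / 5) * Real.cos s ^ 2 * Real.sin s * p.b1 * r ^
        3 + (31 / 5) * Real.cos s ^ 3 * p.b1 * r ^ 3 - 6 * Real.cos s ^ 5 * p.b1 * r ^ 3 - (1 / 5)
        * Real.exp (-s) * Real.exp Real.pi * p.b1 * r ^ 3 + Real.exp (-s) * j - (2 / 5) * Real.sin
        s * p.b1 * r ^ 3)) =
    -2 * p.b2 + (1 / 10 * (1 + Real.exp (-Real.pi)) - 1 / 8 * Real.pi) * p.b1 ^ 2 * r ^ 3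
      - 1 / 2 * p.b1 * j * (Real.exp (-Real.pi) + Real.exp (-Real.pi) ^ 2) := by
  refine (integral_eq_of_antideriv (F := fun s => (1 / 10) * Real.cos s * Real.exp (-s) * Real.exp Real.pi * p.b1 ^ 2 * r ^ 3 - (1 / 2) *
      Real.cos s * Real.exp (-s) * j * p.b1 + (11 / 40) * Real.cos s * Real.sin s * p.b1 ^ 2 * r ^
      3 - Real.cos s * p.b2 + Real.cos s * p.b3 * r ^ 2 + (7 / 10) * Real.cos s ^ 2 * p.b1 ^ 2 * r
      ^ 3 - (3 / 20) * Real.cos s ^ 3 * Real.sin s * p.b1 ^ 2 * r ^ 3 - Real.cos s ^ 3 * p.b3 * r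
      ^ 2 - (61 / 20) * Real.cos s ^ 4 * p.b1 ^ 2 * r ^ 3 + (5 / 2) * Real.cos s ^ 6 * p.b1 ^ 2 *
      r ^ 3 + (1 / 10) * Real.exp (-s) * Real.sin s * Real.exp Real.pi * p.b1 ^ 2 * r ^ 3 - (1 /
      2) * Real.exp (-s) * Real.sin s * j * p.b1 + (1 / 80) * p.b1 ^ 2 * r ^ 3 - (1 / 8) * p.b1 ^
      2 * r ^ 3 * s)
    (fun s => HasDerivAt.congr_deriv (DifferentiableAt.hasDerivAt (by fun_prop)) ?_)
    (by fun_prop) _ _).trans ?_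
  · simp (disch := fun_prop) only [deriv_fun_add, deriv_fun_sub, deriv_fun_mul, deriv_fun_pow,
      deriv.fun_neg', deriv_const', deriv_id'', Real.deriv_cos', Real.deriv_sin, Real.deriv_exp,
      deriv_exp_neg', deriv_const_hMul]
    linear_combination (Real.cos s * Real.sin s * p.b1 ^ 2 * r ^ 3 + Real.cos s * Real.sin s ^ 3 * p.b1 ^ 2 * r ^ 3
      - (3 / 20) * Real.cos s ^ 2 * p.b1 ^ 2 * r ^ 3 - 5 * Real.cos s ^ 3 * Real.sin s * p.b1 ^ 2
      * r ^ 3 + Real.sin s * p.b3 * r ^ 2 + (1 / 8) * p.b1 ^ 2 * r ^ 3) * Real.sin_sq_add_cos_sq s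
  · have h1 : Real.exp (-(2 * Real.pi)) = Real.exp (-Real.pi) ^ 2 := by
      rw [← Real.exp_nat_mul]; congr 1; push_cast; ring
    have h2 : Real.exp (-Real.pi) * Real.exp Real.pi = 1 := by
      rw [← Real.exp_add, neg_add_cancel, Real.exp_zero]
    simp only [Real.cos_two_pi, Real.sin_two_pi, Real.cos_pi, Real.sin_pi, h1]
    linear_combination ((1 / 10) * Real.exp (-Real.pi) * p.b1 ^ 2 * r ^ 3 + (1 / 10) * p.b1 ^ 2 * r ^ 3) * h2

/-- The integrand of `y2` on either side, where `Y` is `y1` along the solution. -/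
noncomputable def driveTwo (c d : ℝ → ℝ) (α₀ α₁ β₀ β₁ r : ℝ) (Y : ℝ → ℝ × ℝ) (s : ℝ) : ℝ × ℝ :=
  shear (4 * r - Real.exp s * (2 * r * (2 * Real.cos s ^ 2 - Real.sin s ^ 2))) (Real.exp s)
    (coeffTwo (c s) (d s) α₀ α₁ β₀ β₁ s (r, HalfParams.zFree r 0 s)
      + coeffOneDeriv (c s) (d s) α₀ α₁ s (r, HalfParams.zFree r 0 s) (Y s)
      + (1 / 2 : ℝ) • ((0 : ℝ), 2 * (2 * Real.cos s ^ 2 - 6 * Real.cos s * Real.sin s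
          - Real.sin s ^ 2) * (Y s).1 ^ 2))

theorem continuous_driveTwo {c d : ℝ → ℝ} (hc : Continuous c) (hd : Continuous d)
    (α₀ α₁ β₀ β₁ r : ℝ) {Y : ℝ → ℝ × ℝ} (hY : Continuous Y) :
    Continuous (driveTwo c d α₀ α₁ β₀ β₁ r Y) := by
  unfold driveTwo coeffTwo coeffOneDeriv HalfParams.zFree heightRate
  simp only [shear_apply, Prod.mk_add_mk, Prod.smul_mk]
  fun_prop

/-- The shear fixes the first coordinate and `F₀` has no radial component. Only the `z` component of
`y1` therefore enters, and neither the second derivative of `F₀` nor the radial part of `y1`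
contributes. -/
theorem driveTwo_fst (c d : ℝ → ℝ) (α₀ α₁ β₀ β₁ r : ℝ) (Y : ℝ → ℝ × ℝ) (s : ℝ) :
    (driveTwo c d α₀ α₁ β₀ β₁ r Y s).1 = c s * (β₀ + β₁ * HalfParams.zFree r 0 s
      - d s / r * (α₀ + α₁ * HalfParams.zFree r 0 s) ^ 2) + c s * α₁ * (Y s).2 := by
  simp [driveTwo, coeffTwo, coeffOneDeriv, shear_apply]

theorem driveTwo_upper_eq (p : Params) {r : ℝ} (hr : r ≠ 0) {s : ℝ} (hs : s ∈ Icc 0 Real.pi) :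
    (fundMatrix quadF s (r, 2 * r ^ 2)).inverse
      (fieldCoeff p quadF 2 s (unperturbedFlow quadF s (r, 2 * r ^ 2))
        + fderiv ℝ (fieldCoeff p quadF 1 s) (unperturbedFlow quadF s (r, 2 * r ^ 2))
            (y1 p quadF s (r, 2 * r ^ 2))
        + (1 / 2 : ℝ) • fderiv ℝ (fderiv ℝ (fieldCoeff p quadF 0 s))
            (unperturbedFlow quadF s (r, 2 * r ^ 2))
            (y1 p quadF s (r, 2 * r ^ 2)) (y1 p quadF s (r, 2 * r ^ 2))) =
      driveTwo Real.cos (fun s => -Real.sin s) p.a0 p.a1 p.a2 p.a3 r (y1Upper p r) s := by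
  have hne : ∀ᶠ q in 𝓝 (r, HalfParams.zFree r 0 s), q.1 ≠ 0 := continuousAt_fst.eventually_ne hr
  have h1 : fderiv ℝ (fieldCoeff p quadF 1 s) (r, HalfParams.zFree r 0 s) =
      fderiv ℝ (coeffOne (Real.cos s) (-Real.sin s) p.a0 p.a1 s) (r, HalfParams.zFree r 0 s) :=
    Filter.EventuallyEq.fderiv_eq (hne.mono fun q hq => fieldCoeff_one_upper p hs.2 hq)
  rw [inverse_fundMatrix_quadF, unperturbedFlow_quadF, sub_self, y1_upper p hr hs, h1,
    fderiv_coeffOne _ _ _ _ _ hr, fderiv_fderiv_fieldCoeff_zero p _ hr,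
    fieldCoeff_two_upper p hs.2 hr, driveTwo]

theorem driveTwo_lower_eq (p : Params) {r : ℝ} (hr : r ≠ 0) {s : ℝ} (hs : Real.pi < s) :
    (fundMatrix quadF s (r, 2 * r ^ 2)).inverse
      (fieldCoeff p quadF 2 s (unperturbedFlow quadF s (r, 2 * r ^ 2))
        + fderiv ℝ (fieldCoeff p quadF 1 s) (unperturbedFlow quadF s (r, 2 * r ^ 2))
            (y1 p quadF s (r, 2 * r ^ 2))
        + (1 / 2 : ℝ) • fderiv ℝ (fderiv ℝ (fieldCoeff p quadF 0 s))
            (unperturbedFlow quadF s (r, 2 * r ^ 2))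
            (y1 p quadF s (r, 2 * r ^ 2)) (y1 p quadF s (r, 2 * r ^ 2))) =
      driveTwo Real.sin Real.cos 0 p.b1 p.b2 p.b3 r (y1Lower p r (halfDrift p r)) s := by
  have hne : ∀ᶠ q in 𝓝 (r, HalfParams.zFree r 0 s), q.1 ≠ 0 := continuousAt_fst.eventually_ne hr
  have h1 : fderiv ℝ (fieldCoeff p quadF 1 s) (r, HalfParams.zFree r 0 s) =
      fderiv ℝ (coeffOne (Real.sin s) (Real.cos s) 0 p.b1 s) (r, HalfParams.zFree r 0 s) :=
    Filter.EventuallyEq.fderiv_eq (hne.mono fun q hq => fieldCoeff_one_lower p hs hq)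
  rw [inverse_fundMatrix_quadF, unperturbedFlow_quadF, sub_self, y1_lower p hr hs.le, h1,
    fderiv_coeffOne _ _ _ _ _ hr, fderiv_fderiv_fieldCoeff_zero p _ hr,
    fieldCoeff_two_lower p hs hr, driveTwo]

theorem g2_fst (p : Params) {r : ℝ} (hr : r ≠ 0) : (g2 p quadF (r, 2 * r ^ 2)).1 =
    ((1 + Real.exp (-Real.pi) - Real.pi) * p.a0 * p.a1 * r
      + (7 / 5 * (1 + Real.exp (-Real.pi)) - 5 / 4 * Real.pi) * p.a1 ^ 2 * r ^ 3)
    + (-2 * p.b2 + (1 / 10 * (1 + Real.exp (-Real.pi)) - 1 / 8 * Real.pi) * p.b1 ^ 2 * r ^ 3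
      - 1 / 2 * p.b1 * halfDrift p r * (Real.exp (-Real.pi) + Real.exp (-Real.pi) ^ 2)) := by
  have hU := continuous_driveTwo Real.continuous_cos Real.continuous_sin.neg p.a0 p.a1 p.a2 p.a3 r
    (continuous_y1Upper p r)
  have hL := continuous_driveTwo Real.continuous_sin Real.continuous_cos 0 p.b1 p.b2 p.b3 r
    (continuous_y1Lower p r (halfDrift p r))
  rw [g2, y2, map_smul, inverse_fundMatrix_apply, smul_smul,
    integral_lower hU hL (fun s hs => driveTwo_upper_eq p hr hs)
      (fun s hs => driveTwo_lower_eq p hr hs) (by linarith [Real.pi_pos]),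
    Prod.smul_fst, Prod.fst_add, integral_fst hU, integral_fst hL,
    ← integral_second_upper p r r⁻¹, ← integral_second_lower p r (halfDrift p r)]
  norm_num only
  rw [one_smul]
  congr 1
  · congr 1
    funext s
    rw [driveTwo_fst]
    simp only [HalfParams.zFree, y1Upper, Pi.neg_apply]
    field_simp
    ring
  · congr 1
    funext s
    rw [driveTwo_fst]
    simp only [HalfParams.zFree, y1Lower]
    field_simp
    ring

theorem g1_snd (p : Params) {r : ℝ} (hr : r ≠ 0) : (g1 p quadF (r, 2 * r ^ 2)).2 =
    halfDrift p r - (Real.exp Real.pi + Real.exp Real.pi ^ 2) * p.b1 * r ^ 3 / 5 := by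
  have hc := continuous_driveOne_upper p.a0 p.a1 r 0
  have hc' := continuous_driveOne_lower 0 p.b1 r 0
  have h1 : Real.exp (2 * Real.pi) = Real.exp Real.pi ^ 2 := by rw [two_mul, Real.exp_add, sq]
  rw [g1_eq p hr, sub_self, Prod.snd_add, integral_snd hc, integral_snd hc']
  simp only [driveOne_upper_zero p hr, driveOne_lower_zero p hr, integral_height_upper,
    integral_height_lower, Real.cos_pi, Real.sin_pi, Real.cos_two_pi, Real.sin_two_pi, halfDrift, h1]
  ring

/-- The bifurcation function of order two. -/
theorem bifurcation2_quadF (p : Params) (h : denom p ≠ 0) {r : ℝ} (hr : 0 < r) :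
    bifurcation2 p quadF r =
      -denom p / (40 * (Real.exp Real.pi - 1)) * (A0 p + A1 p * r + r ^ 3) := by
  have hz : quadF r 0 = 2 * r ^ 2 := by simp [quadF]
  have hE : Real.exp (2 * Real.pi) = Real.exp Real.pi ^ 2 := by rw [two_mul, Real.exp_add, sq]
  rw [bifurcation_poly p h, bifurcation2, gamma1, cornerDelta_quadF, hz, deriv_g1_fst p hr.ne',
    g1_snd p hr.ne', g2_fst p hr.ne', halfDrift, denom, Real.exp_neg, hE]
  have h0 := one_lt_exp_pi
  generalize Real.exp Real.pi = E at h0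
  have h1 : E - 1 ≠ 0 := (sub_pos.2 h0).ne'
  have h2 : E ≠ 0 := by positivity
  have h3 : E + 1 ≠ 0 := by positivity
  have h4 : (1 - E ^ 2)⁻¹ = -((E - 1)⁻¹ * (E + 1)⁻¹) := by
    rw [← mul_inv, ← inv_neg]; congr 1; ring
  rw [h4]
  field_simp
  ring

/-! ### Positivity of `Δ` and simple roots of the cubic. -/

theorem exp_pi_gt : 22.91 < Real.exp Real.pi := by
  have h1 : Real.exp 3.14 < Real.exp Real.pi := Real.exp_lt_exp.2 Real.pi_gt_d2
  have h2 : Real.exp 3.14 = Real.exp 1 ^ 3 * Real.exp 0.14 := by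
    rw [← Real.exp_nat_mul, ← Real.exp_add]; norm_num
  have h3 := Real.quadratic_le_exp_of_nonneg (x := 0.14) (by norm_num)
  have h4 : (2.718 : ℝ) ^ 3 ≤ Real.exp 1 ^ 3 := by
    gcongr
    linarith [Real.exp_one_gt_d9]
  have h5 : (2.718 : ℝ) ^ 3 * (1 + 0.14 + 0.14 ^ 2 / 2) ≤ Real.exp 1 ^ 3 * Real.exp 0.14 := by
    gcongr
  have h6 : (22.91 : ℝ) < 2.718 ^ 3 * (1 + 0.14 + 0.14 ^ 2 / 2) := by norm_num
  rw [h2] at h1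
  exact (h6.trans_le h5).trans h1

/-- With `k = (E + 1) / (E - 1)`, `Δ / (E - 1)` is a quadratic form in `a1, b1`; completing the
square in `b1` leaves `1000 π² - 1920 π k - 2704 k²` as coefficient of `a1²`. The margin is narrow:
about 9860 against 9800 at `π = 3.14`, `k = 1.0913`, hence the precise bound on `exp π`. -/
theorem denom_pos (p : Params) (hp : p.a1 ^ 2 + p.b1 ^ 2 ≠ 0) : 0 < denom p := by
  have hE := exp_pi_gt
  have hπ := Real.pi_gt_d2
  set k := (Real.exp Real.pi + 1) / (Real.exp Real.pi - 1) with hk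
  have hD : 0 < Real.exp Real.pi - 1 := by linarith
  have hk0 : 0 < k := div_pos (by linarith) hD
  have hk1 : k ≤ 1.0913 := by
    rw [hk, div_le_iff₀ hD]; linarith
  have hS : 1 + Real.exp Real.pi = k * (Real.exp Real.pi - 1) := by
    rw [hk, div_mul_cancel₀ _ hD.ne']; ring
  have h1 : denom p = (Real.exp Real.pi - 1) * ((50 * Real.pi - 56 * k) * p.a1 ^ 2
      + 60 * k * p.a1 * p.b1 + (5 * Real.pi - 4 * k) * p.b1 ^ 2) := by
    rw [denom, hS]; ring
  have hβ : 0 < 5 * Real.pi - 4 * k := by linarith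
  have hdisc : 0 < 1000 * Real.pi ^ 2 - 1920 * Real.pi * k - 2704 * k ^ 2 := by
    nlinarith [mul_pos hk0 (by linarith : 0 < Real.pi - 3.14), mul_nonneg hk0.le (sub_nonneg.2 hk1)]
  rw [h1]
  refine mul_pos hD (pos_of_mul_pos_right (a := 4 * (5 * Real.pi - 4 * k)) ?_ (by linarith))
  have h2 : 4 * (5 * Real.pi - 4 * k) * ((50 * Real.pi - 56 * k) * p.a1 ^ 2
      + 60 * k * p.a1 * p.b1 + (5 * Real.pi - 4 * k) * p.b1 ^ 2) =
      (2 * (5 * Real.pi - 4 * k) * p.b1 + 60 * k * p.a1) ^ 2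
        + (1000 * Real.pi ^ 2 - 1920 * Real.pi * k - 2704 * k ^ 2) * p.a1 ^ 2 := by ring
  rw [h2]
  by_cases ha : p.a1 = 0
  · have hb : p.b1 ≠ 0 := fun hb => hp (by rw [ha, hb]; ring)
    have h3 : 0 < (2 * (5 * Real.pi - 4 * k) * p.b1) ^ 2 := by
      have := mul_ne_zero (mul_ne_zero two_ne_zero hβ.ne') hb
      positivity
    rw [ha]
    linarith
  · exact add_pos_of_nonneg_of_pos (sq_nonneg _) (mul_pos hdisc (by positivity))

/-- The prefactor of the cubic is nonzero, so simple roots of the cubic are simple zeros of the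
bifurcation function. -/
theorem exists_limitCycleFamily_of_root (p : Params) (h : denom p ≠ 0) {r : ℝ} (hr : 0 < r)
    (h0 : A0 p + A1 p * r + r ^ 3 = 0) (h1 : A1 p + 3 * r ^ 2 ≠ 0) :
    ∃ φ T, IsLimitCycleFamily p quadF r φ T := by
  have h2 : HasDerivAt (fun r => A0 p + A1 p * r + r ^ 3) (A1 p + 3 * r ^ 2) r := by
    refine ((((hasDerivAt_id r).const_mul (A1 p)).const_add (A0 p)).add
      (hasDerivAt_pow 3 r)).congr_deriv ?_
    simp
  have h3 : -denom p / (40 * (Real.exp Real.pi - 1)) ≠ 0 :=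
    div_ne_zero (neg_ne_zero.2 h) (mul_ne_zero (by norm_num) (sub_pos.2 one_lt_exp_pi).ne')
  exact exists_limitCycleFamily p hr (fun r ζ => slowDrift_upper p r ζ)
    (fun r ζ => slowDrift_lower p r ζ) (fun r hr => turnBifurcation_eq p h hr.ne')
    (by rw [h0, mul_zero]) (h2.const_mul _) (mul_ne_zero h3 h1)

/-- A depressed cubic that is negative at `0` has a simple positive root. -/
theorem exists_simple_root_of_neg {a b : ℝ} (ha : a < 0) :
    ∃ r, 0 < r ∧ a + b * r + r ^ 3 = 0 ∧ b + 3 * r ^ 2 ≠ 0 := by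
  -- At `1 + |a| + |b|` the cubic term dominates.
  have hR : 0 ≤ a + b * (1 + |a| + |b|) + (1 + |a| + |b|) ^ 3 := by
    have h1 := abs_nonneg a
    have h2 := abs_nonneg b
    have h3 := neg_abs_le a
    have h4 : -|b| * (1 + |a| + |b|) ≤ b * (1 + |a| + |b|) := by
      gcongr; exact neg_abs_le b
    have h5 : (1 + |a| + |b|) * (1 + |a| + |b|) ≤ (1 + |a| + |b|) ^ 2 * (1 + |a| + |b|) := by
      gcongr; nlinarith
    nlinarith
  obtain ⟨r, hr, hr0⟩ := intermediate_value_Icc (a := 0) (b := 1 + |a| + |b|) (by positivity)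
    (f := fun r => a + b * r + r ^ 3) (by fun_prop) (show (0 : ℝ) ∈ Icc _ _ from ⟨by simp [ha.le], hR⟩)
  have hr0 : a + b * r + r ^ 3 = 0 := hr0
  have hpos : 0 < r := by
    refine lt_of_le_of_ne hr.1 fun h => ha.ne ?_
    rw [← h] at hr0
    simpa using hr0
  refine ⟨r, hpos, hr0, fun h => ?_⟩
  -- A double root satisfies `b = -3 r²`, which forces `a = 2 r³ > 0`.
  have : a = 2 * r ^ 3 := by linear_combination hr0 - r * h
  have : 0 < r ^ 3 := by positivity
  linarith

/-- A depressed cubic with three distinct real roots: simple roots on both sides of its positive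
critical point. -/
theorem exists_simple_roots_of_discr_pos {a b : ℝ} (h : 0 < -4 * b ^ 3 - 27 * a ^ 2) :
    ∃ m, 0 < m ∧ (∃ r, m < r ∧ a + b * r + r ^ 3 = 0 ∧ b + 3 * r ^ 2 ≠ 0) ∧
      (0 < a → ∃ r, 0 < r ∧ r < m ∧ a + b * r + r ^ 3 = 0 ∧ b + 3 * r ^ 2 ≠ 0) := by
  have hb : b < 0 := by
    by_contra hb
    have : 0 ≤ b ^ 3 := pow_nonneg (not_lt.1 hb) 3
    nlinarith [sq_nonneg a]
  set m := Real.sqrt (-b / 3) with hm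
  have hm0 : 0 < m := Real.sqrt_pos.2 (by linarith)
  have hbm : b = -3 * m ^ 2 := by
    rw [hm, Real.sq_sqrt (by linarith)]; ring
  -- With `b = -3 m²` the discriminant is `27 (4 m⁶ - a²)`. The cubic equals `a - 2 m³` at `m` and
  -- `a + 2 m³` at `2 m`, so it changes sign on `(m, 2 m)`, and on `(0, m)` as well when `a > 0`.
  have ha : |a| < 2 * m ^ 3 := by
    refine abs_lt_of_sq_lt_sq ?_ (by positivity)
    rw [hbm] at h
    nlinarith
  obtain ⟨ha1, ha2⟩ := abs_lt.1 ha
  have hcont : Continuous fun r => a + b * r + r ^ 3 := by fun_prop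
  have hneg : a + b * m + m ^ 3 < 0 := by rw [hbm]; linarith
  have simple : ∀ r, 0 < r → r ≠ m → b + 3 * r ^ 2 ≠ 0 := by
    intro r hr hrm h
    refine hrm ((sq_eq_sq₀ hr.le hm0.le).1 ?_)
    linarith
  refine ⟨m, hm0, ?_, fun ha => ?_⟩
  · obtain ⟨r, hr, hr0⟩ := intermediate_value_Ioo (a := m) (b := 2 * m) (by linarith)
      hcont.continuousOn (show (0 : ℝ) ∈ Ioo _ _ from ⟨hneg, by rw [hbm]; linarith⟩)
    exact ⟨r, hr.1, hr0, simple r (hm0.trans hr.1) hr.1.ne'⟩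
  · obtain ⟨r, hr, hr0⟩ := intermediate_value_Ioo' (a := 0) (b := m) hm0.le
      hcont.continuousOn (show (0 : ℝ) ∈ Ioo _ _ from ⟨hneg, by simpa using ha⟩)
    exact ⟨r, hr.1, hr.2, hr0, simple r hr.1 hr.2.ne⟩

/-- Both orbits stay within `O(ε)` of circles whose projections to the `(x, y)`-plane have different
radii, so for small `ε` they cannot share a point. -/
theorem IsLimitCycleFamily.eventually_disjoint {p : Params} {f : ℝ → ℝ → ℝ} {r r' : ℝ}
    {φ φ' : ℝ → ℝ → ℝ × ℝ × ℝ} {T T' : ℝ → ℝ} (hr : 0 < r) (hrr' : r < r')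
    (h : IsLimitCycleFamily p f r φ T) (h' : IsLimitCycleFamily p f r' φ' T') :
    ∀ᶠ ε in 𝓝[≠] (0 : ℝ), Disjoint (range (φ ε)) (range (φ' ε)) := by
  obtain ⟨C, hC⟩ := h
  obtain ⟨C', hC'⟩ := h'
  have hsmall : ∀ᶠ ε in 𝓝[≠] (0 : ℝ), 2 * (C + C') * |ε| < r' - r := by
    refine Filter.Tendsto.eventually_lt_const (v := 0) (sub_pos.2 hrr') ?_
    exact (Continuous.tendsto' (by fun_prop) 0 0 (by simp)).mono_left nhdsWithin_le_nhds
  have key : ∀ {C ρ ε S : ℝ} {ψ : ℝ → ℝ × ℝ × ℝ} {q : ℝ × ℝ × ℝ}, 0 < S → Function.Periodic ψ S →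
      (∀ t ∈ Icc 0 S, ‖ψ t - (ρ * Real.cos t, ρ * Real.sin t,
        f (ρ * Real.cos t) (ρ * Real.sin t))‖ ≤ C * |ε|) → q ∈ range ψ →
      ∃ t, |q.1 - ρ * Real.cos t| ≤ C * |ε| ∧ |q.2.1 - ρ * Real.sin t| ≤ C * |ε| := by
    rintro C ρ ε S ψ _ hS hψ hclose ⟨s, rfl⟩
    obtain ⟨t, ht, hst⟩ := hψ.exists_mem_Ico₀ hS s
    have h1 := hclose t (Ico_subset_Icc_self ht)
    rw [hst]
    exact ⟨t, (norm_fst_le _).trans h1, ((norm_fst_le _).trans (norm_snd_le _)).trans h1⟩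
  filter_upwards [hC, hC', hsmall] with ε hε hε' h3
  obtain ⟨h1, -, h2⟩ := hε
  obtain ⟨h1', -, h2'⟩ := hε'
  refine Set.disjoint_left.2 fun q hq hq' => ?_
  obtain ⟨t, hx, hy⟩ := key h1.1.2.1 h1.1.2.2.1 h2 hq
  obtain ⟨t', hx', hy'⟩ := key h1'.1.2.1 h1'.1.2.2.1 h2' hq'
  set d := r' * Real.cos t' - r * Real.cos t with hd
  set e := r' * Real.sin t' - r * Real.sin t with he
  have hd1 : |d| ≤ (C + C') * |ε| := by
    have := abs_sub (q.1 - r * Real.cos t) (q.1 - r' * Real.cos t')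
    rw [show (q.1 - r * Real.cos t) - (q.1 - r' * Real.cos t') = d by rw [hd]; ring] at this
    linarith
  have he1 : |e| ≤ (C + C') * |ε| := by
    have := abs_sub (q.2.1 - r * Real.sin t) (q.2.1 - r' * Real.sin t')
    rw [show (q.2.1 - r * Real.sin t) - (q.2.1 - r' * Real.sin t') = e by rw [he]; ring] at this
    linarith
  -- Projecting the difference `(d, e)` of the two circle points onto the direction of angle `t'`
  -- bounds `r' - r` by `|d| + |e|`.
  have h4 : r' = r * Real.cos (t' - t) + Real.cos t' * d + Real.sin t' * e := by
    rw [hd, he, Real.cos_sub]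
    linear_combination (-r') * Real.sin_sq_add_cos_sq t'
  have h5 : r * Real.cos (t' - t) ≤ r * 1 := by gcongr; exact Real.cos_le_one _
  have h6 : ∀ {c x : ℝ}, |c| ≤ 1 → c * x ≤ |x| := fun {c x} hc => by
    refine (le_abs_self _).trans ?_
    rw [abs_mul]
    exact mul_le_of_le_one_left (abs_nonneg x) hc
  have h7 := h6 (x := d) (Real.abs_cos_le_one t')
  have h8 := h6 (x := e) (Real.abs_sin_le_one t')
  linarith

end PiecewiseField

theorem mainTheorem6 (p : Params) (hp : p.a1 ^ 2 + p.b1 ^ 2 ≠ 0) :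
    (denom p ≠ 0 ∧ ∀ r : ℝ, 0 < r →
      bifurcation2 p quadF r =
        -denom p / (40 * (Real.exp Real.pi - 1)) * (A0 p + A1 p * r + r ^ 3)) ∧
    (0 < discr p →
      (∃ (r : ℝ) (φ : ℝ → ℝ → ℝ × ℝ × ℝ) (T : ℝ → ℝ),
        0 < r ∧ A0 p + A1 p * r + r ^ 3 = 0 ∧ IsLimitCycleFamily p quadF r φ T) ∧
      (A1 p < 0 → 0 < A0 p →
        ∃ (r r' : ℝ) (φ φ' : ℝ → ℝ → ℝ × ℝ × ℝ) (T T' : ℝ → ℝ),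
          0 < r ∧ r < r' ∧
          A0 p + A1 p * r + r ^ 3 = 0 ∧ A0 p + A1 p * r' + r' ^ 3 = 0 ∧
          IsLimitCycleFamily p quadF r φ T ∧ IsLimitCycleFamily p quadF r' φ' T' ∧
          ∀ᶠ ε in 𝓝[≠] (0 : ℝ), Disjoint (Set.range (φ ε)) (Set.range (φ' ε)))) ∧
    (discr p ≤ 0 → A0 p < 0 →
      ∃ (r : ℝ) (φ : ℝ → ℝ → ℝ × ℝ × ℝ) (T : ℝ → ℝ),
        0 < r ∧ A0 p + A1 p * r + r ^ 3 = 0 ∧ IsLimitCycleFamily p quadF r φ T) := by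
  have hΔ := (denom_pos p hp).ne'
  refine ⟨⟨hΔ, fun r hr => bifurcation2_quadF p hΔ hr⟩, fun hdisc => ?_, fun _ hA0 => ?_⟩
  · obtain ⟨m, hm, ⟨r', hmr', hr'0, hr'1⟩, hsmall⟩ := exists_simple_roots_of_discr_pos hdisc
    have hr' := hm.trans hmr'
    obtain ⟨φ', T', h'⟩ := exists_limitCycleFamily_of_root p hΔ hr' hr'0 hr'1
    refine ⟨⟨r', φ', T', hr', hr'0, h'⟩, fun _ hA0 => ?_⟩
    obtain ⟨r, hr, hrm, hr0, hr1⟩ := hsmall hA0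
    obtain ⟨φ, T, h⟩ := exists_limitCycleFamily_of_root p hΔ hr hr0 hr1
    exact ⟨r, r', φ, φ', T, T', hr, hrm.trans hmr', hr0, hr'0, h, h',
      h.eventually_disjoint hr (hrm.trans hmr') h'⟩
  · obtain ⟨r, hr, hr0, hr1⟩ := exists_simple_root_of_neg (b := A1 p) hA0
    obtain ⟨φ, T, h⟩ := exists_limitCycleFamily_of_root p hΔ hr hr0 hr1
    exact ⟨r, φ, T, hr, hr0, h⟩
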